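/- Notation. For $u\in H^{1/2}(\mathbb R)=W^{1/2,2}(\mathbb R)$, i.e. $u\in L^2(\mathbb R)$ real-valued with $\int_{\mathbb R}\int_{\mathbb R}\frac{|u(x)-u(y)|^2}{|x-y|^2}\,dx\,dy<\infty$, let $(-\Delta)^{1/4}u=\mathscr F^{-1}(|\xi|^{1/2}\mathscr F u)\in L^2(\mathbb R)$, where $\mathscr F$ is the Fourier transform with kernel $e^{-ix\xi}$. Let $I=(a,b)$, $a<b$, be a bounded open interval and let $H_0^{1/2}(I)=W_0^{1/2,2}(I)$ be the space of all $u\in H^{1/2}(\mathbb R)$ that vanish a.e. outside $I$. For a set $D\in\{I,\mathbb R\}$ put $$E=E_D=\{u\in H_0^{1/2}(I):\ \|(-\Delta)^{1/4}u\|_{L^2(D)}\le 1\},$$ $$\Phi(u)=\int_I\int_I\log\frac1{|x-y|}\,G(u(x))G(u(y))\,dx\,dy .$$ Put also $$E_\infty=\{u\in H^{1/2}(\mathbb R):\ \|(-\Delta)^{1/4}u\|_{L^2(\mathbb R)}^2+\|u\|_{L^2(\mathbb R)}^2\le 1\},$$ $$\Psi(u)=\int_{\mathbb R}\int_{\mathbb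 R}\log^+\frac1{|x-y|}\,G(u(x))G(u(y))\,dx\,dy-\int_{\mathbb R}\int_{\mathbb R}\log^+|x-y|\,G(u(x))G(u(y))\,dx\,dy\in[-\infty,\infty),$$ where $\log^+=\max\{\log,0\}$ (the first integral is finite for $u\in H^{1/2}(\mathbb R)$ under the assumptions of (ii)). Assumption (A): $G:\mathbb R\to[0,\infty)$ is even, continuous and strictly increasing on $[0,\infty)$, and there are $\alpha,c>0$ with $G(t)\le c\,e^{\alpha t^2}$ for all $t\in\mathbb R$. Assumption (A$_1$): $G$ satisfies (A) and $G(t)=O(|t|)$ as $t\to0$. **Proposition 1.5.** Suppose that $G\in C^1(\mathbb R)$ satisfies (A), and that $g:=G'$ satisfies $g(t)\le c\,e^{\alpha t^2}$ for all $t\in\mathbb R$, with some constants $c,\alpha>0$. (i) Let $D=I$ or $D=\mathbb R$, and let $u\in E_D$ be a maximizer of $\Phi$ on $E_D$. Then there exists $\theta>0$ such that $$\int_D(-\Delta)^{1/4}u\,(-\Delta)^{1/4}\varphi\,dx=\theta\int_I\Big(\log\frac1{|\cdot|}*(1_IG(u))\Big)g(u)\,\varphi\,dx\qquad\text{for all }\varphi\in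 H_0^{1/2}(I).$$ (ii) If $G$ satisfies (A$_1$) and $u\in E_\infty$ is a maximizer of $\Psi$ on $E_\infty$, then there exists $\theta\in\mathbb R$ such that $$\int_{\mathbb R}\Big((-\Delta)^{1/4}u\,(-\Delta)^{1/4}\varphi+u\varphi\Big)dx=\theta\int_{\mathbb R}\Big(\log\frac1{|\cdot|}*G(u)\Big)g(u)\,\varphi\,dx$$ for all $\varphi\in H^{1/2}(\mathbb R)$ with bounded support. In both equations the convolution integrals converge absolutely almost everywhere (on $I$, respectively on $\mathbb R$), and the integrals on the right-hand sides converge absolutely. -/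

import Mathlib

namespace LogTM

noncomputable section

open MeasureTheory Asymptotics
open scoped FourierTransform ENNReal Topology Real

/-- The class in `L²(ℝ; ℂ)` of a square-integrable function (and `0` if the function is not
square-integrable). -/
def toL2 (f : ℝ → ℂ) : Lp ℂ 2 (volume : Measure ℝ) :=
  open Classical in if h : MemLp f 2 volume then h.toLp f else 0

/-- The fractional Laplacian `(-Δ)^{1/4} u = 𝓕⁻¹ (|ξ|^{1/2} 𝓕 u)` of `u ∈ H^{1/2}(ℝ)`, with the
Fourier transform on `L²`. Mathlib's Fourier transform has the kernel `exp (-2 π i x ξ)`, so that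
the symbol reads `|2 π ξ|^{1/2}`; the result is real-valued for real-valued `u`. -/
def quarterLaplacian (u : ℝ → ℝ) : ℝ → ℝ := fun x =>
  ((𝓕⁻ (toL2 fun ξ => ((|2 * π * ξ| ^ (1 / 2 : ℝ) : ℝ) : ℂ) *
      (𝓕 (toL2 fun y => (u y : ℂ)) : Lp ℂ 2 (volume : Measure ℝ)) ξ) :
    Lp ℂ 2 (volume : Measure ℝ)) x).re

/-- `u ∈ H^{1/2}(ℝ) = W^{1/2,2}(ℝ)`: `u` is in `L²` and has a finite Gagliardo seminorm. -/
def MemHHalf (u : ℝ → ℝ) : Prop :=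
  MemLp u 2 volume ∧
    ∫⁻ x : ℝ, ∫⁻ y : ℝ, ENNReal.ofReal (|u x - u y| ^ 2 / |x - y| ^ 2) < ∞

/-- `u ∈ H₀^{1/2}(I) = W₀^{1/2,2}(I)`, as a space of functions on the line: the functions in
`H^{1/2}(ℝ)` that vanish outside `I`. -/
def MemHHalfZero (I : Set ℝ) (u : ℝ → ℝ) : Prop :=
  MemHHalf u ∧ ∀ᵐ x : ℝ, x ∉ I → u x = 0

/-- `φ` vanishes outside a bounded set. -/
def HasBoundedSupport (φ : ℝ → ℝ) : Prop :=
  ∃ R : ℝ, ∀ᵐ x : ℝ, R < |x| → φ x = 0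

/-- The set `E = {u ∈ H₀^{1/2}(I) : ‖(-Δ)^{1/4} u‖_{L²(D)} ≤ 1}`. -/
def unitSet (I D : Set ℝ) : Set (ℝ → ℝ) :=
  {u | MemHHalfZero I u ∧ eLpNorm (quarterLaplacian u) 2 (volume.restrict D) ≤ 1}

/-- The norm `(‖(-Δ)^{1/4} u‖₂² + ‖u‖₂²)^{1/2}` of `H^{1/2}(ℝ)`. -/
def normHHalf (u : ℝ → ℝ) : ℝ≥0∞ :=
  (eLpNorm (quarterLaplacian u) 2 volume ^ 2 + eLpNorm u 2 volume ^ 2) ^ (1 / 2 : ℝ)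

/-- The set `E_∞`, the closed unit ball of `H^{1/2}(ℝ)`. -/
def unitSetInfty : Set (ℝ → ℝ) :=
  {u | MemHHalf u ∧ normHHalf u ≤ 1}

/-- Assumption (A). -/
structure CondA (G : ℝ → ℝ) : Prop where
  nonneg : ∀ t, 0 ≤ G t
  even : ∀ t, G (-t) = G t
  continuous : Continuous G
  strictMonoOn : StrictMonoOn G (Set.Ici 0)
  growth : ∃ α > 0, ∃ c > 0, ∀ t, G t ≤ c * Real.exp (α * t ^ 2)

/-- Assumption (A₁). -/
structure CondA1 (G : ℝ → ℝ) : Prop extends CondA G where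
  isBigO : G =O[𝓝 0] fun t => |t|

/-- `∫_S ∫_S log⁺ (1/|x-y|) G(u(x)) G(u(y)) dx dy`. -/
def energyPos (S : Set ℝ) (G u : ℝ → ℝ) : ℝ≥0∞ :=
  ∫⁻ x in S, ∫⁻ y in S, ENNReal.ofReal (Real.posLog (1 / |x - y|) * G (u x) * G (u y))

/-- `∫_S ∫_S log⁺ |x-y| G(u(x)) G(u(y)) dx dy`. -/
def energyNeg (S : Set ℝ) (G u : ℝ → ℝ) : ℝ≥0∞ :=
  ∫⁻ x in S, ∫⁻ y in S, ENNReal.ofReal (Real.posLog |x - y| * G (u x) * G (u y))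

/-- `∫_S ∫_S log (1/|x-y|) G(u(x)) G(u(y)) dx dy`, as the difference of the contributions of the
positive and the negative part of the kernel: `Φ` for `S = I` and `Ψ` for `S = ℝ`. The positive
part is finite for the functions considered here, while the negative one may be infinite for
`S = ℝ`; the value is then `-∞`. -/
def energy (S : Set ℝ) (G u : ℝ → ℝ) : EReal :=
  (energyPos S G u : EReal) - (energyNeg S G u : EReal)

/-- The convolution `log (1/|·|) * (1_S G(u))`. -/
def logPotential (S : Set ℝ) (G u : ℝ → ℝ) (x : ℝ) : ℝ :=
  ∫ y in S, Real.log (1 / |x - y|) * G (u y)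

/-- The integral defining `log (1/|·|) * (1_S G(u))` converges absolutely at almost every point
of `S`. -/
def PotentialDefined (S : Set ℝ) (G u : ℝ → ℝ) : Prop :=
  ∀ᵐ x ∂volume.restrict S, IntegrableOn (fun y => Real.log (1 / |x - y|) * G (u y)) S volume

/-- `u` is a weak solution of the Euler–Lagrange equation on `I` with multiplier `θ`: for all
`φ ∈ H₀^{1/2}(I)`,
`∫_D (-Δ)^{1/4}u (-Δ)^{1/4}φ = θ ∫_I (log (1/|·|) * (1_I G(u))) G'(u) φ`,
where the integrals on the right converge absolutely. -/
def WeakSolution (I D : Set ℝ) (G : ℝ → ℝ) (θ : ℝ) (u : ℝ → ℝ) : Prop :=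
  PotentialDefined I G u ∧
  ∀ φ : ℝ → ℝ, MemHHalfZero I φ →
    IntegrableOn (fun x => logPotential I G u x * deriv G (u x) * φ x) I volume ∧
    ∫ x in D, quarterLaplacian u x * quarterLaplacian φ x =
      θ * ∫ x in I, logPotential I G u x * deriv G (u x) * φ x

/-- `u` is a weak solution of the Euler–Lagrange equation on `ℝ` with multiplier `θ`: for all
`φ ∈ H^{1/2}(ℝ)` with bounded support,
`∫ ((-Δ)^{1/4}u (-Δ)^{1/4}φ + u φ) = θ ∫ (log (1/|·|) * G(u)) G'(u) φ`,
where the integrals on the right converge absolutely. -/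
def WeakSolutionInfty (G : ℝ → ℝ) (θ : ℝ) (u : ℝ → ℝ) : Prop :=
  PotentialDefined Set.univ G u ∧
  ∀ φ : ℝ → ℝ, MemHHalf φ → HasBoundedSupport φ →
    Integrable (fun x => logPotential Set.univ G u x * deriv G (u x) * φ x) volume ∧
    ∫ x, (quarterLaplacian u x * quarterLaplacian φ x + u x * φ x) =
      θ * ∫ x, logPotential Set.univ G u x * deriv G (u x) * φ x

end

end LogTM

namespace LogTM

noncomputable section

open MeasureTheory Asymptotics Filter Set
open scoped FourierTransform ENNReal Topology Real NNReal

/-! Let `B` be the bilinear form with kernel `log (1/|x-y|)`, so that the energy of `u` is `B(G(u),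
G(u))`. Its half derivative in the direction `φ` is `L φ = B(G(u), g(u) φ)`, with `g = G'`, and half
the derivative of the constraint is a linear functional `q φ`. A direction with `q φ < 0` keeps `u +
tφ` admissible for small `t > 0`, so maximality gives `L φ ≤ 0`. Hence `L` vanishes on the kernel of
`q`, and if `q ψ = -1` then `L = -L(ψ) q` with `L ψ ≤ 0`. By Fubini `L φ` is the right-hand side of
the equation, and a positive multiplier exists as soon as `L ≠ 0`.

That `L ≠ 0` needs a second-order argument (`IsConstrainedMax.exists_energyDeriv_ne_zero`). Suppose
`L = 0`. Then `V g(u) = 0` a.e., where `V` is the potential of `G(u)`. Take `φ` vanishing where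
`g(u) = 0`, with `B(g(u)φ, g(u)φ) > 0`, and follow `u + tφ + t²ψ`, where `q ψ` is so negative that
the constraint survives. The mixed term `B(G(u), ·)` of the expansion is `o(t²)`: either `V = 0`, or
`φ = 0` and `g(u) = 0`, in which case the increment itself is `o(t²)`. The energy thus grows by `t²
B(g(u)φ, g(u)φ) + o(t²)`, a contradiction.

Such a `φ` exists because the kernel is positive at distances below 1: it is a narrow cutoff times
the signed distance of `u` to the critical set of `G` (`exists_isTest_logForm_pos`). It is
nontrivial because a nonzero function in `H^{1/2}` cannot take only critical values. The critical
set has empty interior, so such a function would skip a level, and the indicator of a superlevel set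
would lie in `W^{1/2,2}`; only null sets of finite measure have this property
(`volume_eq_zero_of_gagliardo_indicator`).

Two analytic facts make the expansion legitimate. First, `exp (β u²)` is locally integrable for
every `β` and every `u` in `H^{1/2}` (`MemHHalf.setLIntegral_exp_lt_top`), which gives dominating
functions for all increments. Second, `B` converges absolutely on square-integrable densities that
are integrable against `log (2 + |y|)` (`LogAdmissible.integrable_prod`). On the line, `G(u)` is
such a density because a maximizer has energy at least that of `0`, so the negative part of its
energy is finite. -/

/-! ### The Gagliardo seminorm -/

/-- The square of the Gagliardo seminorm of `W^{1/2,2}(ℝ)`. -/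
def gagliardo (u : ℝ → ℝ) : ℝ≥0∞ :=
  ∫⁻ x : ℝ, ∫⁻ y : ℝ, ENNReal.ofReal (|u x - u y| ^ 2 / |x - y| ^ 2)

theorem aemeasurable_diff_quotient {u : ℝ → ℝ} (hu : AEMeasurable u volume) :
    AEMeasurable (fun p : ℝ × ℝ => ENNReal.ofReal (|u p.1 - u p.2| ^ 2 / |p.1 - p.2| ^ 2))
      (volume.prod volume) := by
  have h1 : AEMeasurable (fun p : ℝ × ℝ => u p.1) (volume.prod volume) := hu.comp_fst
  have h2 : AEMeasurable (fun p : ℝ × ℝ => u p.2) (volume.prod volume) := hu.comp_snd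
  have h3 : Measurable (fun p : ℝ × ℝ => |p.1 - p.2| ^ 2) := by fun_prop
  have h4 : AEMeasurable (fun p : ℝ × ℝ => |u p.1 - u p.2|) (volume.prod volume) :=
    (h1.sub h2).norm
  exact ((h4.pow_const 2).div h3.aemeasurable).ennreal_ofReal

theorem gagliardo_eq_lintegral_prod {u : ℝ → ℝ} (hu : AEMeasurable u volume) :
    gagliardo u = ∫⁻ p : ℝ × ℝ, ENNReal.ofReal (|u p.1 - u p.2| ^ 2 / |p.1 - p.2| ^ 2) :=
  (lintegral_prod _ (aemeasurable_diff_quotient hu)).symm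

theorem aemeasurable_shift {u : ℝ → ℝ} (hu : AEMeasurable u volume) :
    AEMeasurable (fun p : ℝ × ℝ => u (p.1 + p.2)) (volume.prod volume) := by
  refine hu.comp_quasiMeasurePreserving ?_
  exact Measure.quasiMeasurePreserving_fst.comp
    (measurePreserving_add_prod (G := ℝ) volume volume).quasiMeasurePreserving

theorem aemeasurable_shift_sub {u : ℝ → ℝ} (hu : AEMeasurable u volume) :
    AEMeasurable (fun p : ℝ × ℝ => ENNReal.ofReal (|u (p.1 + p.2) - u p.1| ^ 2))
      (volume.prod volume) := by
  have h1 : AEMeasurable (fun p : ℝ × ℝ => u p.1) (volume.prod volume) := hu.comp_fst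
  have h4 : AEMeasurable (fun p : ℝ × ℝ => |u (p.1 + p.2) - u p.1|) (volume.prod volume) :=
    ((aemeasurable_shift hu).sub h1).norm
  exact (h4.pow_const 2).ennreal_ofReal

/-- The square of the `L²` modulus of continuity of `u`. -/
def modulus (u : ℝ → ℝ) (h : ℝ) : ℝ≥0∞ :=
  ∫⁻ x : ℝ, ENNReal.ofReal (|u (x + h) - u x| ^ 2)

theorem aemeasurable_modulus {u : ℝ → ℝ} (hu : AEMeasurable u volume) :
    AEMeasurable (modulus u) volume :=
  (aemeasurable_shift_sub hu).lintegral_prod_left'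

/-- Substitute `y = x + h` and apply Tonelli. In this form the seminorm can be treated by Plancherel
in `x` and by scaling in `h`. -/
theorem gagliardo_eq_lintegral_modulus {u : ℝ → ℝ} (hu : AEMeasurable u volume) :
    gagliardo u = ∫⁻ h : ℝ, modulus u h * ENNReal.ofReal ((|h| ^ 2)⁻¹) := by
  have key : ∀ x h : ℝ, ENNReal.ofReal (|u x - u (h + x)| ^ 2 / |x - (h + x)| ^ 2)
      = ENNReal.ofReal (|u (x + h) - u x| ^ 2) * ENNReal.ofReal ((|h| ^ 2)⁻¹) := by
    intro x h
    rw [← ENNReal.ofReal_mul (by positivity), div_eq_mul_inv, abs_sub_comm (u x), add_comm h x]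
    congr 3
    simp
  have h1 : gagliardo u = ∫⁻ x : ℝ, ∫⁻ h : ℝ,
      ENNReal.ofReal (|u (x + h) - u x| ^ 2) * ENNReal.ofReal ((|h| ^ 2)⁻¹) := by
    unfold gagliardo
    refine lintegral_congr fun x => ?_
    rw [← lintegral_add_right_eq_self _ x]
    exact lintegral_congr fun h => key x h
  rw [h1, lintegral_lintegral_swap]
  · refine lintegral_congr fun h => ?_
    rw [lintegral_mul_const' _ _ ENNReal.ofReal_ne_top]
    rfl
  · refine (aemeasurable_shift_sub hu).mul ?_
    exact Measurable.aemeasurable (by fun_prop)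

theorem MemHHalf.aemeasurable {u : ℝ → ℝ} (hu : MemHHalf u) : AEMeasurable u volume :=
  hu.1.aestronglyMeasurable.aemeasurable

theorem lintegral_kernel_lt_top :
    ∫⁻ h : ℝ, ENNReal.ofReal (1 / (1 + |h| ^ 2)) < ∞ := by
  have h := (integrable_inv_one_add_sq).hasFiniteIntegral
  rw [hasFiniteIntegral_iff_ofReal (ae_of_all _ fun x => by positivity)] at h
  simpa using h

theorem lintegral_sq_lt_top {p : ℝ → ℝ} (hp : MemLp p 2 volume) :
    ∫⁻ x, ENNReal.ofReal (p x ^ 2) < ∞ := by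
  have h := hp.integrable_sq.hasFiniteIntegral
  rwa [hasFiniteIntegral_iff_ofReal (ae_of_all _ fun x => by positivity)] at h

theorem lintegral_sq_kernel_lt_top {p : ℝ → ℝ} (hp : MemLp p 2 volume) :
    ∫⁻ x, ∫⁻ y, ENNReal.ofReal (p x ^ 2) * ENNReal.ofReal (1 / (1 + |x - y| ^ 2)) < ∞ := by
  have : ∀ x : ℝ, ∫⁻ y, ENNReal.ofReal (p x ^ 2) * ENNReal.ofReal (1 / (1 + |x - y| ^ 2))
      = ENNReal.ofReal (p x ^ 2) * ∫⁻ h : ℝ, ENNReal.ofReal (1 / (1 + |h| ^ 2)) := by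
    intro x
    rw [lintegral_const_mul' _ _ ENNReal.ofReal_ne_top,
      lintegral_sub_left_eq_self (fun h : ℝ => ENNReal.ofReal (1 / (1 + |h| ^ 2))) x]
  simp_rw [this]
  rw [lintegral_mul_const' _ _ lintegral_kernel_lt_top.ne]
  exact ENNReal.mul_lt_top (lintegral_sq_lt_top hp) lintegral_kernel_lt_top

/-- A common criterion for the closure properties below. Dividing the error term by `|x-y|²` leaves
the integrable kernel `1 / (1 + |x-y|²)` against an `L¹` function of one variable. -/
theorem gagliardo_lt_top_of_le {w u v p : ℝ → ℝ} (hu : MemHHalf u) (hv : MemHHalf v)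
    (hp : MemLp p 2 volume) (A : ℝ≥0)
    (h : ∀ x y, |w x - w y| ^ 2 ≤ A * |u x - u y| ^ 2 + A * |v x - v y| ^ 2
      + |x - y| ^ 2 / (1 + |x - y| ^ 2) * (p x ^ 2 + p y ^ 2)) :
    gagliardo w < ∞ := by
  have hpm : AEMeasurable p volume := hp.aestronglyMeasurable.aemeasurable
  set k : ℝ × ℝ → ℝ≥0∞ := fun q => ENNReal.ofReal (1 / (1 + |q.1 - q.2| ^ 2)) with hk
  have hkm : AEMeasurable k (volume.prod volume) := Measurable.aemeasurable (by fun_prop)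
  have hpk1 : AEMeasurable (fun q : ℝ × ℝ => ENNReal.ofReal (p q.1 ^ 2) * k q)
      (volume.prod volume) := ((hpm.comp_fst.pow_const 2).ennreal_ofReal).mul hkm
  have hpk2 : AEMeasurable (fun q : ℝ × ℝ => ENNReal.ofReal (p q.2 ^ 2) * k q)
      (volume.prod volume) := ((hpm.comp_snd.pow_const 2).ennreal_ofReal).mul hkm
  have e1 : ∫⁻ q, ENNReal.ofReal (p q.1 ^ 2) * k q ∂(volume.prod volume) < ∞ := by
    rw [lintegral_prod _ hpk1]
    exact lintegral_sq_kernel_lt_top hp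
  have e2 : ∫⁻ q, ENNReal.ofReal (p q.2 ^ 2) * k q ∂(volume.prod volume) < ∞ := by
    rw [lintegral_prod_symm _ hpk2]
    refine lt_of_eq_of_lt ?_ (lintegral_sq_kernel_lt_top hp)
    refine lintegral_congr fun y => lintegral_congr fun x => ?_
    simp only [hk, abs_sub_comm x y]
  set U : ℝ × ℝ → ℝ≥0∞ := fun q => ENNReal.ofReal (|u q.1 - u q.2| ^ 2 / |q.1 - q.2| ^ 2)
  set W : ℝ × ℝ → ℝ≥0∞ := fun q => ENNReal.ofReal (|v q.1 - v q.2| ^ 2 / |q.1 - q.2| ^ 2)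
  have eU : ∫⁻ q, U q ∂(volume.prod volume) < ∞ := by
    have := gagliardo_eq_lintegral_prod hu.aemeasurable
    exact this ▸ hu.2
  have eW : ∫⁻ q, W q ∂(volume.prod volume) < ∞ := by
    have := gagliardo_eq_lintegral_prod hv.aemeasurable
    exact this ▸ hv.2
  have hUm : AEMeasurable U (volume.prod volume) := aemeasurable_diff_quotient hu.aemeasurable
  have hWm : AEMeasurable W (volume.prod volume) := aemeasurable_diff_quotient hv.aemeasurable
  have key : ∀ x y : ℝ, ENNReal.ofReal (|w x - w y| ^ 2 / |x - y| ^ 2)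
      ≤ (A * U (x, y) + A * W (x, y)) + (ENNReal.ofReal (p x ^ 2) * k (x, y)
        + ENNReal.ofReal (p y ^ 2) * k (x, y)) := by
    intro x y
    have hA : (A : ℝ≥0∞) = ENNReal.ofReal A := by simp
    simp only [U, W, hk, hA]
    rw [← ENNReal.ofReal_mul (by positivity), ← ENNReal.ofReal_mul (by positivity),
      ← ENNReal.ofReal_mul (by positivity), ← ENNReal.ofReal_mul (by positivity),
      ← ENNReal.ofReal_add (by positivity) (by positivity),
      ← ENNReal.ofReal_add (by positivity) (by positivity),
      ← ENNReal.ofReal_add (by positivity) (by positivity)]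
    apply ENNReal.ofReal_le_ofReal
    rcases eq_or_ne x y with rfl | hxy
    · simp; positivity
    · have : 0 < |x - y| ^ 2 := by have := abs_pos.2 (sub_ne_zero.2 hxy); positivity
      rw [div_le_iff₀ this]
      refine (h x y).trans (le_of_eq ?_)
      field_simp
  calc gagliardo w ≤ ∫⁻ x, ∫⁻ y, ((A * U (x, y) + A * W (x, y)) + (ENNReal.ofReal (p x ^ 2) * k (x, y)
        + ENNReal.ofReal (p y ^ 2) * k (x, y))) :=
        lintegral_mono fun x => lintegral_mono fun y => key x y
    _ = ∫⁻ q, ((A * U q + A * W q) + (ENNReal.ofReal (p q.1 ^ 2) * k q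
        + ENNReal.ofReal (p q.2 ^ 2) * k q)) ∂(volume.prod volume) := by
        rw [lintegral_prod]
        exact ((hUm.const_mul _).add (hWm.const_mul _)).add (hpk1.add hpk2)
    _ < ∞ := by
        have hUW : AEMeasurable (fun q => A * U q + A * W q) (volume.prod volume) :=
          (hUm.const_mul _).add (hWm.const_mul _)
        rw [lintegral_add_left' hUW,
          lintegral_add_left' hpk1, lintegral_add_left' (hUm.const_mul _),
          lintegral_const_mul' _ _ ENNReal.coe_ne_top, lintegral_const_mul' _ _ ENNReal.coe_ne_top]
        have hA : (A : ℝ≥0∞) < ∞ := ENNReal.coe_lt_top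
        exact ENNReal.add_lt_top.2 ⟨ENNReal.add_lt_top.2 ⟨ENNReal.mul_lt_top hA eU,
          ENNReal.mul_lt_top hA eW⟩, ENNReal.add_lt_top.2 ⟨e1, e2⟩⟩

/-! ### Closure properties of `H^{1/2}(ℝ)`. -/

theorem memHHalf_zero : MemHHalf (fun _ => 0) := by
  refine ⟨MemLp.zero', ?_⟩
  simp

theorem MemHHalf.add {u v : ℝ → ℝ} (hu : MemHHalf u) (hv : MemHHalf v) :
    MemHHalf (fun x => u x + v x) := by
  refine ⟨hu.1.add hv.1, gagliardo_lt_top_of_le hu hv (p := fun _ => 0) MemLp.zero' 2 ?_⟩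
  intro x y
  simp only [sq_abs]
  push_cast
  nlinarith [sq_nonneg ((u x - u y) - (v x - v y))]

theorem MemHHalf.const_mul {u : ℝ → ℝ} (hu : MemHHalf u) (c : ℝ) :
    MemHHalf (fun x => c * u x) := by
  refine ⟨hu.1.const_mul c, gagliardo_lt_top_of_le hu memHHalf_zero (p := fun _ => 0)
    MemLp.zero' (‖c‖₊ ^ 2) ?_⟩
  intro x y
  simp only [NNReal.coe_pow, coe_nnnorm, Real.norm_eq_abs, sq_abs]
  nlinarith

theorem MemHHalf.lipschitz_comp {u h : ℝ → ℝ} (hu : MemHHalf u) (hh : LipschitzWith 1 h)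
    (h0 : h 0 = 0) : MemHHalf (fun x => h (u x)) := by
  have hle : ∀ s t, |h s - h t| ≤ |s - t| := by
    intro s t
    simpa [Real.dist_eq] using hh.dist_le_mul s t
  refine ⟨?_, gagliardo_lt_top_of_le hu memHHalf_zero (p := fun _ => 0) MemLp.zero' 1 ?_⟩
  · refine hu.1.mono (hh.continuous.comp_aestronglyMeasurable hu.1.aestronglyMeasurable) ?_
    refine ae_of_all _ fun x => ?_
    simpa [h0] using hle (u x) 0
  · intro x y
    simp only [NNReal.coe_one, one_mul]
    have := pow_le_pow_left₀ (abs_nonneg _) (hle (u x) (u y)) 2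
    simpa using this

theorem MemHHalf.abs {u : ℝ → ℝ} (hu : MemHHalf u) : MemHHalf (fun x => |u x|) :=
  hu.lipschitz_comp (h := fun t => |t|) (lipschitzWith_one_norm (E := ℝ)) (by simp)

/-- Since `min 1 d² ≤ 2 d² / (1 + d²)`, a function that is bounded and Lipschitz has differences of
the shape required by `gagliardo_lt_top_of_le`. -/
theorem min_one_sq_le (d L : ℝ) {a : ℝ} (ha : 0 ≤ a) (h1 : a ≤ L)
    (h2 : a ≤ L * d) : a ^ 2 ≤ d ^ 2 / (1 + d ^ 2) * (2 * L ^ 2) := by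
  have e1 : a ^ 2 ≤ L ^ 2 := pow_le_pow_left₀ ha h1 2
  have e2 : a ^ 2 ≤ L ^ 2 * d ^ 2 := by
    have := pow_le_pow_left₀ ha h2 2
    rwa [mul_pow] at this
  rw [div_mul_eq_mul_div, le_div_iff₀ (by positivity)]
  nlinarith [mul_le_mul_of_nonneg_right e1 (sq_nonneg d)]

theorem MemHHalf.mul_lipschitz {u η : ℝ → ℝ} (hu : MemHHalf u) {L : ℝ} (hL : 1 ≤ L)
    (hηc : Continuous η) (hη : ∀ x y, |η x - η y| ≤ L * |x - y|) (hb : ∀ x, |η x| ≤ 1) :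
    MemHHalf (fun x => η x * u x) := by
  have hm : AEStronglyMeasurable (fun x => η x * u x) volume :=
    hηc.aestronglyMeasurable.mul hu.1.aestronglyMeasurable
  refine ⟨hu.1.mono hm (ae_of_all _ fun x => ?_), ?_⟩
  · rw [norm_mul]
    exact mul_le_of_le_one_left (norm_nonneg _) (hb x)
  · refine gagliardo_lt_top_of_le hu memHHalf_zero (p := fun x => 4 * L * u x)
      (hu.1.const_mul (4 * L)) 2 ?_
    intro x y
    have h1 : |η x - η y| ≤ 2 * L := by
      have := abs_sub (η x) (η y)
      linarith [hb x, hb y]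
    have h2 : |η x - η y| ≤ (2 * L) * |x - y| := by
      have := hη x y
      nlinarith [abs_nonneg (x - y), mul_nonneg (by linarith : 0 ≤ L) (abs_nonneg (x - y))]
    have h3 := min_one_sq_le |x - y| (2 * L) (abs_nonneg _) h1 h2
    set D := |x - y| ^ 2 / (1 + |x - y| ^ 2)
    have hD : 0 ≤ D := by positivity
    have h4 : (η x) ^ 2 ≤ 1 := by
      have := pow_le_pow_left₀ (abs_nonneg _) (hb x) 2
      simpa using this
    simp only [sq_abs] at h3 ⊢
    push_cast
    -- Discrete product rule. The second term contributes `2 · 2 (2L)² = (4L)²`, whence the choice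
    -- `p = 4 L u`.
    have e : η x * u x - η y * u y = η x * (u x - u y) + u y * (η x - η y) := by ring
    have f1 : (η x * (u x - u y)) ^ 2 ≤ (u x - u y) ^ 2 := by
      rw [mul_pow]; exact mul_le_of_le_one_left (sq_nonneg _) h4
    have f2 : (u y * (η x - η y)) ^ 2 ≤ u y ^ 2 * (D * (2 * (2 * L) ^ 2)) := by
      rw [mul_pow]; exact mul_le_mul_of_nonneg_left h3 (sq_nonneg _)
    have f3 : 0 ≤ D * (4 * L * u x) ^ 2 := by positivity
    rw [e]
    nlinarith [sq_nonneg (η x * (u x - u y) - u y * (η x - η y))]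

theorem memHHalf_of_lipschitz {χ : ℝ → ℝ} (hc : Continuous χ) (hs : HasCompactSupport χ) {L : ℝ}
    (hL : 1 ≤ L) (hχ : ∀ x y, |χ x - χ y| ≤ L * |x - y|) (hb : ∀ x, |χ x| ≤ L) : MemHHalf χ := by
  refine ⟨hc.memLp_of_hasCompactSupport hs, ?_⟩
  set B := tsupport χ
  have hB : IsCompact B := hs
  refine gagliardo_lt_top_of_le memHHalf_zero memHHalf_zero
    (p := B.indicator fun _ => 4 * L) ?_ 1 ?_
  · exact memLp_indicator_const 2 hB.measurableSet _ (Or.inr hB.measure_lt_top.ne)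
  · intro x y
    by_cases hx : x ∉ B ∧ y ∉ B
    · rw [image_eq_zero_of_notMem_tsupport hx.1, image_eq_zero_of_notMem_tsupport hx.2]
      simp [hx.1, hx.2]
    · have h1 : |χ x - χ y| ≤ 2 * L := by
        have := abs_sub (χ x) (χ y)
        linarith [hb x, hb y]
      have h2 : |χ x - χ y| ≤ (2 * L) * |x - y| := by
        have := hχ x y
        nlinarith [abs_nonneg (x - y), mul_nonneg (by linarith : 0 ≤ L) (abs_nonneg (x - y))]
      have h3 := min_one_sq_le |x - y| (2 * L) (abs_nonneg _) h1 h2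
      refine h3.trans ?_
      simp only [sub_self, abs_zero]
      have : (2 * (2 * L) ^ 2) ≤ (B.indicator (fun _ => 4 * L) x) ^ 2
          + (B.indicator (fun _ => 4 * L) y) ^ 2 := by
        by_cases hxB : x ∈ B
        · rw [indicator_of_mem hxB]
          nlinarith [sq_nonneg (B.indicator (fun _ => 4 * L) y)]
        · have hyB : y ∈ B := by tauto
          rw [indicator_of_mem hyB]
          nlinarith [sq_nonneg (B.indicator (fun _ => 4 * L) x)]
      have hD : 0 ≤ |x - y| ^ 2 / (1 + |x - y| ^ 2) := by positivity
      have := mul_le_mul_of_nonneg_left this hD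
      simpa using this

theorem memHHalf_of_contDiff {χ : ℝ → ℝ} (hc : ContDiff ℝ 1 χ) (hs : HasCompactSupport χ) :
    MemHHalf χ := by
  obtain ⟨C, hC⟩ := hc.lipschitzWith_of_hasCompactSupport hs (by simp)
  obtain ⟨M, hM⟩ := hs.exists_bound_of_continuous hc.continuous
  refine memHHalf_of_lipschitz hc.continuous hs (L := 1 + C + |M|) ?_ ?_ ?_
  · have := C.2; have := abs_nonneg M
    simp only [add_assoc, le_add_iff_nonneg_right]
    positivity
  · intro x y
    have := hC.dist_le_mul x y
    simp only [Real.dist_eq] at this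
    refine this.trans (mul_le_mul_of_nonneg_right ?_ (abs_nonneg _))
    linarith [abs_nonneg M]
  · intro x
    have := hM x
    simp only [Real.norm_eq_abs] at this
    have h2 := C.2
    have h3 : (0:ℝ) ≤ C := C.2
    linarith [le_abs_self M]

/-! ### Exponential integrability of functions in `H^{1/2}(ℝ)` -/

theorem sq_lintegral_le {α : Type*} [MeasurableSpace α] (μ : Measure α) {f : α → ℝ≥0∞}
    (hf : AEMeasurable f μ) : (∫⁻ a, f a ∂μ) ^ 2 ≤ μ univ * ∫⁻ a, f a ^ 2 ∂μ := by
  have h := ENNReal.lintegral_mul_le_Lp_mul_Lq μ Real.HolderConjugate.two_two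
    (aemeasurable_const (b := (1 : ℝ≥0∞))) hf
  simp only [Pi.mul_apply, one_mul, ENNReal.one_rpow, lintegral_const] at h
  have h2 := pow_le_pow_left' h 2
  rw [mul_pow] at h2
  refine h2.trans (le_of_eq ?_)
  simp only [← ENNReal.rpow_natCast, ← ENNReal.rpow_mul]
  norm_num

/-- The measure `|u(x)-u(y)|² / |x-y|² dx dy`. -/
def gagliardoMeasure (u : ℝ → ℝ) : Measure (ℝ × ℝ) :=
  (volume.prod volume).withDensity
    fun p => ENNReal.ofReal (|u p.1 - u p.2| ^ 2 / |p.1 - p.2| ^ 2)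

theorem MemHHalf.isFiniteMeasure {u : ℝ → ℝ} (hu : MemHHalf u) :
    IsFiniteMeasure (gagliardoMeasure u) := by
  refine isFiniteMeasure_withDensity ?_
  have := gagliardo_eq_lintegral_prod hu.aemeasurable
  exact (this ▸ hu.2 : _ < ∞).ne

/-- The measure is finite and its density vanishes on the diagonal, so continuity from above
applies. This smallness at fine scales yields exponential integrability for every exponent rather
than up to a critical one. -/
theorem MemHHalf.tendsto_gagliardoMeasure {u : ℝ → ℝ} (hu : MemHHalf u) :
    Tendsto (fun m : ℕ => gagliardoMeasure u {p : ℝ × ℝ | |p.1 - p.2| ≤ (2 ^ m)⁻¹})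
      atTop (𝓝 0) := by
  have := hu.isFiniteMeasure
  have hm : ∀ m : ℕ, MeasurableSet {p : ℝ × ℝ | |p.1 - p.2| ≤ (2 ^ m)⁻¹} := fun m =>
    measurableSet_le (by fun_prop) (by fun_prop)
  have h0 : gagliardoMeasure u (⋂ m : ℕ, {p : ℝ × ℝ | |p.1 - p.2| ≤ (2 ^ m)⁻¹}) = 0 := by
    rw [gagliardoMeasure, withDensity_apply _ (MeasurableSet.iInter hm)]
    refine setLIntegral_eq_zero (MeasurableSet.iInter hm) fun p hp => ?_
    have hp' : ∀ m : ℕ, |p.1 - p.2| ≤ (2 ^ m)⁻¹ := by simpa using hp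
    have : |p.1 - p.2| ≤ 0 := by
      refine ge_of_tendsto' (x := atTop) ?_ hp'
      exact tendsto_inv_atTop_zero.comp (tendsto_pow_atTop_atTop_of_one_lt (by norm_num))
    have h00 : |p.1 - p.2| = 0 := le_antisymm this (abs_nonneg _)
    simp [h00]
  rw [← h0]
  refine tendsto_measure_iInter_atTop (fun m => (hm m).nullMeasurableSet) ?_
    ⟨0, measure_ne_top _ _⟩
  intro m n hmn p hp
  have hp' : |p.1 - p.2| ≤ (2 ^ n)⁻¹ := hp
  exact le_trans hp' (inv_anti₀ (by positivity) (pow_le_pow_right₀ (by norm_num) hmn))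

/-! ### Dyadic means and the distribution function. -/

/-- The mean of `u` over `(x, x + r]`. -/
def mean (u : ℝ → ℝ) (r x : ℝ) : ℝ := r⁻¹ * ∫ y in Ioc x (x + r), u y

theorem MemHHalf.integrableOn {u : ℝ → ℝ} (hu : MemHHalf u) (a b : ℝ) :
    IntegrableOn u (Ioc a b) := by
  have h := hu.1.locallyIntegrable (by norm_num)
  exact (h.integrableOn_isCompact isCompact_Icc).mono_set Ioc_subset_Icc_self

/-- The difference is `(2r²)⁻¹` times the integral of `u(y) - u(z)` over the two adjacent intervals
of length `r`. Cauchy–Schwarz and `|y-z| ≤ 2r` then give constant exactly 1. -/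
theorem mean_sub_mean_sq_le {u : ℝ → ℝ} (hu : MemHHalf u) {r : ℝ} (hr : 0 < r) (x : ℝ) :
    ENNReal.ofReal ((mean u r x - mean u (2 * r) x) ^ 2)
      ≤ gagliardoMeasure u (Ioc x (x + r) ×ˢ Ioc (x + r) (x + 2 * r)) := by
  set μ : Measure ℝ := volume.restrict (Ioc x (x + r))
  set ν : Measure ℝ := volume.restrict (Ioc (x + r) (x + 2 * r))
  have hL := hu.integrableOn x (x + r)
  have hR := hu.integrableOn (x + r) (x + 2 * r)
  have hμ : μ.real univ = r := by simp [μ, Measure.real, hr.le]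
  have hν : ν.real univ = r := by
    simp [ν, Measure.real]; rw [ENNReal.toReal_ofReal] <;> linarith
  have hsplit : ∫ y in Ioc x (x + 2 * r), u y
      = (∫ y in Ioc x (x + r), u y) + ∫ y in Ioc (x + r) (x + 2 * r), u y := by
    rw [← setIntegral_union (Ioc_disjoint_Ioc_of_le le_rfl) measurableSet_Ioc hL hR,
      Ioc_union_Ioc_eq_Ioc (by linarith) (by linarith)]
  have hprod : ∫ p, (u p.1 - u p.2) ∂(μ.prod ν) = r * (∫ y, u y ∂μ) - r * ∫ y, u y ∂ν := by
    rw [integral_sub (hL.comp_fst ν) (hR.comp_snd μ)]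
    rw [integral_fun_fst, integral_fun_snd, hμ, hν]
    rfl
  have hdiff : mean u r x - mean u (2 * r) x
      = (2 * r ^ 2)⁻¹ * ∫ p, (u p.1 - u p.2) ∂(μ.prod ν) := by
    rw [hprod, mean, mean, hsplit]
    change r⁻¹ * (∫ y, u y ∂μ) - (2 * r)⁻¹ * ((∫ y, u y ∂μ) + ∫ y, u y ∂ν) = _
    field_simp
    ring
  have hm : AEMeasurable (fun p : ℝ × ℝ => ‖u p.1 - u p.2‖ₑ) (μ.prod ν) :=
    ((hL.aestronglyMeasurable.aemeasurable.comp_fst).sub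
      (hR.aestronglyMeasurable.aemeasurable.comp_snd)).enorm
  have hcs := sq_lintegral_le (μ.prod ν) hm
  have hun : (μ.prod ν) univ = ENNReal.ofReal (r ^ 2) := by
    rw [← univ_prod_univ, Measure.prod_prod]
    have e1 : μ univ = ENNReal.ofReal r := by simp [μ]
    have e2 : ν univ = ENNReal.ofReal r := by simp [ν]; congr 1; ring
    rw [e1, e2, ← ENNReal.ofReal_mul hr.le, sq]
  have hpr : μ.prod ν = (volume.prod volume).restrict
      (Ioc x (x + r) ×ˢ Ioc (x + r) (x + 2 * r)) := Measure.prod_restrict _ _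
  have hle : ∫⁻ p, ‖u p.1 - u p.2‖ₑ ^ 2 ∂(μ.prod ν) ≤ ENNReal.ofReal (4 * r ^ 2)
      * gagliardoMeasure u (Ioc x (x + r) ×ˢ Ioc (x + r) (x + 2 * r)) := by
    rw [gagliardoMeasure, withDensity_apply _ (measurableSet_Ioc.prod measurableSet_Ioc), hpr,
      ← lintegral_const_mul' _ _ ENNReal.ofReal_ne_top]
    refine setLIntegral_mono_ae' (measurableSet_Ioc.prod measurableSet_Ioc) (ae_of_all _ ?_)
    rintro ⟨y, z⟩ ⟨⟨hy1, hy2⟩, hz1, hz2⟩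
    simp only at hy1 hy2 hz1 hz2 ⊢
    rw [← ofReal_norm, ← ENNReal.ofReal_pow (norm_nonneg _),
      ← ENNReal.ofReal_mul (by positivity), Real.norm_eq_abs]
    apply ENNReal.ofReal_le_ofReal
    have hyz : |y - z| = z - y := by rw [abs_sub_comm]; exact abs_of_pos (by linarith)
    have hpos : 0 < z - y := by linarith
    have h3 : (z - y) ^ 2 ≤ 4 * r ^ 2 := by nlinarith
    rw [hyz, mul_div_assoc', le_div_iff₀ (by positivity), mul_comm]
    exact mul_le_mul_of_nonneg_right h3 (by positivity)
  have hintg : ENNReal.ofReal ((∫ p, (u p.1 - u p.2) ∂(μ.prod ν)) ^ 2)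
      ≤ (∫⁻ p, ‖u p.1 - u p.2‖ₑ ∂(μ.prod ν)) ^ 2 := by
    have h := enorm_integral_le_lintegral_enorm (μ := μ.prod ν)
      (fun p : ℝ × ℝ => u p.1 - u p.2)
    have h2 := pow_le_pow_left' h 2
    rwa [← ofReal_norm, ← ENNReal.ofReal_pow (norm_nonneg _), Real.norm_eq_abs,
      sq_abs] at h2
  rw [hdiff, mul_pow, ENNReal.ofReal_mul (by positivity)]
  calc ENNReal.ofReal ((2 * r ^ 2)⁻¹ ^ 2) * ENNReal.ofReal ((∫ p, (u p.1 - u p.2) ∂(μ.prod ν)) ^ 2)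
      ≤ ENNReal.ofReal ((2 * r ^ 2)⁻¹ ^ 2) * (ENNReal.ofReal (r ^ 2) *
        (ENNReal.ofReal (4 * r ^ 2)
          * gagliardoMeasure u (Ioc x (x + r) ×ˢ Ioc (x + r) (x + 2 * r)))) := by
        gcongr
        refine (hintg.trans hcs).trans ?_
        rw [hun]
        gcongr
    _ = gagliardoMeasure u (Ioc x (x + r) ×ˢ Ioc (x + r) (x + 2 * r)) := by
        rw [← mul_assoc, ← mul_assoc, ← ENNReal.ofReal_mul (by positivity),
          ← ENNReal.ofReal_mul (by positivity)]
        have : (2 * r ^ 2)⁻¹ ^ 2 * r ^ 2 * (4 * r ^ 2) = 1 := by field_simp; norm_num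
        rw [this]; simp

theorem two_mul_inv_two_pow_succ (k : ℕ) : 2 * ((2 : ℝ) ^ (k + 1))⁻¹ = (2 ^ k)⁻¹ := by
  rw [pow_succ]; field_simp

/-- The boxes are disjoint because their second factors are successive dyadic intervals to the right
of `x`, and all of them lie in the strip. -/
theorem sum_gagliardoMeasure_le (u : ℝ → ℝ) (m n : ℕ) (x : ℝ) :
    ∑ k ∈ Finset.Ico m n, gagliardoMeasure u (Ioc x (x + (2 ^ (k + 1))⁻¹) ×ˢ
        Ioc (x + (2 ^ (k + 1))⁻¹) (x + 2 * (2 ^ (k + 1))⁻¹))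
      ≤ gagliardoMeasure u {p : ℝ × ℝ | |p.1 - p.2| ≤ (2 ^ m)⁻¹} := by
  rw [← measure_biUnion_finset]
  · refine measure_mono ?_
    simp only [iUnion_subset_iff]
    rintro k hk ⟨y, z⟩ ⟨⟨hy1, hy2⟩, hz1, hz2⟩
    rw [two_mul_inv_two_pow_succ] at hz2
    simp only [Finset.mem_Ico] at hk
    simp only at hy1 hy2 hz1 hz2
    have : ((2 : ℝ) ^ k)⁻¹ ≤ (2 ^ m)⁻¹ :=
      inv_anti₀ (by positivity) (pow_le_pow_right₀ (by norm_num) hk.1)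
    simp only [mem_ofPred_eq]
    rw [abs_sub_comm, abs_of_pos (by linarith)]
    linarith
  · have key : ∀ j k : ℕ, j < k → Disjoint
        (Ioc x (x + (2 ^ (j + 1))⁻¹) ×ˢ Ioc (x + (2 ^ (j + 1))⁻¹) (x + 2 * (2 ^ (j + 1))⁻¹))
        (Ioc x (x + (2 ^ (k + 1))⁻¹) ×ˢ
          Ioc (x + (2 ^ (k + 1))⁻¹) (x + 2 * ((2 : ℝ) ^ (k + 1))⁻¹)) := by
      intro j k hjk
      refine Disjoint.set_prod_right ?_ _ _
      refine (Ioc_disjoint_Ioc_of_le ?_).symm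
      rw [two_mul_inv_two_pow_succ]
      have : ((2 : ℝ) ^ k)⁻¹ ≤ (2 ^ (j + 1))⁻¹ :=
        inv_anti₀ (by positivity) (pow_le_pow_right₀ (by norm_num) hjk)
      linarith
    intro j _ k _ hjk
    rcases lt_or_gt_of_ne hjk with h | h
    · exact key j k h
    · exact (key k j h).symm
  · intro k _
    exact measurableSet_Ioc.prod measurableSet_Ioc

/-- Telescope over the dyadic scales: the squared increments sum to at most `ε²`, and Cauchy–Schwarz
over at most `n` terms costs the factor `√n`. -/
theorem abs_mean_sub_mean_le {u : ℝ → ℝ} (hu : MemHHalf u) {m n : ℕ} (hmn : m ≤ n) {ε : ℝ}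
    (hε : 0 ≤ ε) (h : gagliardoMeasure u {p : ℝ × ℝ | |p.1 - p.2| ≤ (2 ^ m)⁻¹}
      ≤ ENNReal.ofReal (ε ^ 2)) (x : ℝ) :
    |mean u (2 ^ n)⁻¹ x - mean u (2 ^ m)⁻¹ x| ≤ ε * √n := by
  set d : ℕ → ℝ := fun k => mean u (2 ^ (k + 1))⁻¹ x - mean u (2 ^ k)⁻¹ x with hd
  have hsum : mean u (2 ^ n)⁻¹ x - mean u (2 ^ m)⁻¹ x = ∑ k ∈ Finset.Ico m n, d k :=
    (Finset.sum_Ico_sub (fun k => mean u (2 ^ k)⁻¹ x) hmn).symm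
  have hsq : ∑ k ∈ Finset.Ico m n, d k ^ 2 ≤ ε ^ 2 := by
    have h1 : ENNReal.ofReal (∑ k ∈ Finset.Ico m n, d k ^ 2) ≤ ENNReal.ofReal (ε ^ 2) := by
      rw [ENNReal.ofReal_sum_of_nonneg fun k _ => sq_nonneg _]
      refine le_trans (Finset.sum_le_sum fun k _ => ?_) ((sum_gagliardoMeasure_le u m n x).trans h)
      have := mean_sub_mean_sq_le hu (r := (2 ^ (k + 1))⁻¹) (by positivity) x
      rwa [show mean u (2 * (2 ^ (k + 1))⁻¹) x = mean u (2 ^ k)⁻¹ x by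
        rw [two_mul_inv_two_pow_succ]] at this
    exact (ENNReal.ofReal_le_ofReal_iff (sq_nonneg _)).1 h1
  rw [hsum]
  refine abs_le_of_sq_le_sq ?_ (by positivity)
  calc (∑ k ∈ Finset.Ico m n, d k) ^ 2
      ≤ (Finset.Ico m n).card * ∑ k ∈ Finset.Ico m n, d k ^ 2 := sq_sum_le_card_mul_sum_sq
    _ ≤ n * ε ^ 2 := by
        refine mul_le_mul ?_ hsq (Finset.sum_nonneg fun k _ => sq_nonneg _) (by positivity)
        simp
    _ = (ε * √n) ^ 2 := by rw [mul_pow, Real.sq_sqrt (by positivity)]; ring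

theorem MemHHalf.exists_abs_mean_le {u : ℝ → ℝ} (hu : MemHHalf u) (m : ℕ) :
    ∃ A : ℝ, 0 ≤ A ∧ ∀ x, |mean u (2 ^ m)⁻¹ x| ≤ A := by
  have hi := hu.1.integrable_sq
  refine ⟨2 ^ m * (1 + ∫ y, u y ^ 2), ?_, fun x => ?_⟩
  · have : 0 ≤ ∫ y, u y ^ 2 := integral_nonneg fun y => sq_nonneg _
    positivity
  · rw [mean, inv_inv, abs_mul, abs_of_pos (by positivity)]
    gcongr
    have hr : ((2 : ℝ) ^ m)⁻¹ ≤ 1 := inv_le_one_of_one_le₀ (one_le_pow₀ (by norm_num))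
    have hfin : IntegrableOn (fun _ : ℝ => (1 : ℝ)) (Ioc x (x + (2 ^ m)⁻¹)) :=
      integrableOn_const (by simp)
    calc |∫ y in Ioc x (x + (2 ^ m)⁻¹), u y| ≤ ∫ y in Ioc x (x + (2 ^ m)⁻¹), |u y| :=
          abs_integral_le_integral_abs
      _ ≤ ∫ y in Ioc x (x + (2 ^ m)⁻¹), (1 + u y ^ 2) := by
          refine integral_mono (hu.integrableOn _ _).abs (hfin.add hi.integrableOn) fun y => ?_
          simp only
          nlinarith [sq_nonneg (|u y| - 1), sq_abs (u y), abs_nonneg (u y)]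
      _ = (2 ^ m)⁻¹ + ∫ y in Ioc x (x + (2 ^ m)⁻¹), u y ^ 2 := by
          rw [integral_add hfin hi.integrableOn]
          simp [Measure.real]
      _ ≤ 1 + ∫ y, u y ^ 2 := by
          refine add_le_add hr (setIntegral_le_integral hi (ae_of_all _ fun y => sq_nonneg _))

theorem sub_mean_sq_le {u : ℝ → ℝ} (hu : MemHHalf u) {r : ℝ} (hr : 0 < r) (x : ℝ) :
    ENNReal.ofReal ((u x - mean u r x) ^ 2)
      ≤ ENNReal.ofReal r * ∫⁻ y, ENNReal.ofReal (|u x - u y| ^ 2 / |x - y| ^ 2) := by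
  set μ : Measure ℝ := volume.restrict (Ioc x (x + r))
  have hL := hu.integrableOn x (x + r)
  have hμ : μ.real univ = r := by simp [μ, Measure.real, hr.le]
  have hdiff : u x - mean u r x = r⁻¹ * ∫ y, (u x - u y) ∂μ := by
    rw [integral_sub (integrable_const _) hL, integral_const, hμ, mean]
    simp only [smul_eq_mul]
    field_simp
  have hm : AEMeasurable (fun y : ℝ => ‖u x - u y‖ₑ) μ :=
    (aemeasurable_const.sub hL.aestronglyMeasurable.aemeasurable).enorm
  have hcs := sq_lintegral_le μ hm
  have hun : μ univ = ENNReal.ofReal r := by simp [μ]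
  have hintg : ENNReal.ofReal ((∫ y, (u x - u y) ∂μ) ^ 2) ≤ (∫⁻ y, ‖u x - u y‖ₑ ∂μ) ^ 2 := by
    have h2 := pow_le_pow_left' (enorm_integral_le_lintegral_enorm (μ := μ)
      (fun y : ℝ => u x - u y)) 2
    rwa [← ofReal_norm, ← ENNReal.ofReal_pow (norm_nonneg _), Real.norm_eq_abs,
      sq_abs] at h2
  have hle : ∫⁻ y, ‖u x - u y‖ₑ ^ 2 ∂μ ≤ ENNReal.ofReal (r ^ 2)
      * ∫⁻ y, ENNReal.ofReal (|u x - u y| ^ 2 / |x - y| ^ 2) := by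
    rw [← lintegral_const_mul' _ _ ENNReal.ofReal_ne_top]
    refine le_trans ?_ (setLIntegral_le_lintegral (Ioc x (x + r)) _)
    refine setLIntegral_mono_ae' measurableSet_Ioc (ae_of_all _ ?_)
    rintro y ⟨hy1, hy2⟩
    rw [← ofReal_norm, ← ENNReal.ofReal_pow (norm_nonneg _),
      ← ENNReal.ofReal_mul (by positivity), Real.norm_eq_abs]
    apply ENNReal.ofReal_le_ofReal
    have hyz : |x - y| = y - x := by rw [abs_sub_comm]; exact abs_of_pos (by linarith)
    have hpos : 0 < y - x := by linarith
    have h3 : (y - x) ^ 2 ≤ r ^ 2 := by nlinarith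
    rw [hyz, mul_div_assoc', le_div_iff₀ (by positivity), mul_comm]
    exact mul_le_mul_of_nonneg_right h3 (by positivity)
  rw [hdiff, mul_pow, ENNReal.ofReal_mul (by positivity)]
  calc ENNReal.ofReal (r⁻¹ ^ 2) * ENNReal.ofReal ((∫ y, (u x - u y) ∂μ) ^ 2)
      ≤ ENNReal.ofReal (r⁻¹ ^ 2) * (ENNReal.ofReal r * (ENNReal.ofReal (r ^ 2)
          * ∫⁻ y, ENNReal.ofReal (|u x - u y| ^ 2 / |x - y| ^ 2))) := by
        gcongr
        refine (hintg.trans hcs).trans ?_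
        rw [hun]
        gcongr
    _ = _ := by
        rw [← mul_assoc, ← mul_assoc, ← ENNReal.ofReal_mul (by positivity),
          ← ENNReal.ofReal_mul (by positivity)]
        congr 2
        field_simp

/-- On the superlevel set `u` is at distance at least `1/2` from its mean, so this is Chebyshev's
inequality for `sub_mean_sq_le`. -/
theorem volume_lt_abs_le {u : ℝ → ℝ} (hu : MemHHalf u) {r lam : ℝ} (hr : 0 < r) (hlam : 1 ≤ lam)
    (h : ∀ x, |mean u r x| ≤ lam / 2) :
    volume {x | lam < |u x|} ≤ ENNReal.ofReal (4 * r) * gagliardo u := by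
  have hm : AEMeasurable (fun x => ENNReal.ofReal r *
      ∫⁻ y, ENNReal.ofReal (|u x - u y| ^ 2 / |x - y| ^ 2)) volume :=
    (aemeasurable_diff_quotient hu.aemeasurable).lintegral_prod_right'.const_mul _
  have h1 := mul_meas_ge_le_lintegral₀ hm (ENNReal.ofReal (1 / 4))
  have hsub : {x | lam < |u x|} ⊆ {x | ENNReal.ofReal (1 / 4) ≤ ENNReal.ofReal r *
      ∫⁻ y, ENNReal.ofReal (|u x - u y| ^ 2 / |x - y| ^ 2)} := by
    intro x hx
    refine le_trans (ENNReal.ofReal_le_ofReal ?_) (sub_mean_sq_le hu hr x)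
    have h2 : 1 / 2 ≤ |u x - mean u r x| := by
      have := abs_sub_abs_le_abs_sub (u x) (mean u r x)
      have := h x
      have hx' : lam < |u x| := hx
      linarith
    have := pow_le_pow_left₀ (by norm_num) h2 2
    rw [sq_abs] at this
    linarith
  have h3 : ENNReal.ofReal (1 / 4) * volume {x | lam < |u x|}
      ≤ ENNReal.ofReal r * gagliardo u := by
    refine (mul_le_mul_right (measure_mono hsub) _).trans (h1.trans (le_of_eq ?_))
    rw [lintegral_const_mul' _ _ ENNReal.ofReal_ne_top]
    rfl
  calc volume {x | lam < |u x|}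
      = ENNReal.ofReal 4 * (ENNReal.ofReal (1 / 4) * volume {x | lam < |u x|}) := by
        rw [← mul_assoc, ← ENNReal.ofReal_mul (by norm_num)]; norm_num
    _ ≤ ENNReal.ofReal 4 * (ENNReal.ofReal r * gagliardo u) := by gcongr
    _ = _ := by rw [← mul_assoc, ← ENNReal.ofReal_mul (by norm_num)]

theorem MemHHalf.volume_one_lt_abs {u : ℝ → ℝ} (hu : MemHHalf u) :
    volume {x | 1 < |u x|} < ∞ := by
  have h1 := mul_meas_ge_le_lintegral₀ (hu.aemeasurable.pow_const 2).ennreal_ofReal 1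
  rw [one_mul] at h1
  refine lt_of_le_of_lt (measure_mono ?_) (lt_of_le_of_lt h1 (lintegral_sq_lt_top hu.1))
  intro x hx
  have hx' : 1 < |u x| := hx
  have : 1 ≤ u x ^ 2 := by rw [← sq_abs]; nlinarith
  simpa using this

/-- The distribution function of a function in `H^{1/2}(ℝ)` has super-Gaussian decay. -/
theorem MemHHalf.volume_lt_abs_le_exp {u : ℝ → ℝ} (hu : MemHHalf u) {K : ℝ} (hK : 0 < K) :
    ∃ C : ℝ≥0∞, C < ∞ ∧ ∀ lam : ℝ, 1 ≤ lam →
      volume {x | lam < |u x|} ≤ C * ENNReal.ofReal (Real.exp (-(K * lam ^ 2))) := by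
  have hlog : 0 < Real.log 2 := Real.log_pos (by norm_num)
  -- Chosen so that `2⁻ⁿ` with `n ≈ lam² / (16 ε²)` is comparable to `exp (-K lam²)`.
  set ε : ℝ := √(Real.log 2 / (16 * K)) with hεdef
  have hε : 0 < ε := Real.sqrt_pos.2 (by positivity)
  have hε2 : ε ^ 2 = Real.log 2 / (16 * K) := Real.sq_sqrt (by positivity)
  obtain ⟨m, hm⟩ : ∃ m : ℕ, gagliardoMeasure u {p : ℝ × ℝ | |p.1 - p.2| ≤ (2 ^ m)⁻¹}
      ≤ ENNReal.ofReal (ε ^ 2) := by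
    have h := hu.tendsto_gagliardoMeasure.eventually_lt_const
      (u := ENNReal.ofReal (ε ^ 2)) (by simpa using by positivity)
    obtain ⟨m, hm⟩ := h.exists
    exact ⟨m, hm.le⟩
  obtain ⟨A, hA0, hA⟩ := hu.exists_abs_mean_le m
  -- Above this level both `A ≤ lam / 4` and `m ≤ n` hold; below it, the finite measure of `{1 <
  -- |u|}` suffices.
  set l0 : ℝ := 4 * A + 4 * ε * (m + 1) + 1 with hl0
  have hl0pos : 1 ≤ l0 := by rw [hl0]; have : 0 ≤ 4 * ε * (m + 1) := by positivity
                             linarith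
  have hfin := hu.volume_one_lt_abs
  set C1 : ℝ≥0∞ := ENNReal.ofReal 8 * gagliardo u
  set C2 : ℝ≥0∞ := volume {x | 1 < |u x|} * ENNReal.ofReal (Real.exp (K * l0 ^ 2))
  refine ⟨C1 + C2, ENNReal.add_lt_top.2 ⟨ENNReal.mul_lt_top ENNReal.ofReal_lt_top hu.2,
    ENNReal.mul_lt_top hfin ENNReal.ofReal_lt_top⟩, fun lam hlam => ?_⟩
  rw [add_mul]
  rcases le_or_gt l0 lam with hl | hl
  · refine le_trans ?_ le_self_add
    -- The finest scale at which the drift `ε √n` of the means is guaranteed to stay below `lam /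
    -- 4`.
    set n : ℕ := ⌊lam ^ 2 / (16 * ε ^ 2)⌋₊ with hn
    have hn1 : (n : ℝ) ≤ lam ^ 2 / (16 * ε ^ 2) := Nat.floor_le (by positivity)
    have hn2 : lam ^ 2 / (16 * ε ^ 2) < n + 1 := Nat.lt_floor_add_one _
    have hmn : m ≤ n := by
      refine Nat.le_floor ?_
      rw [le_div_iff₀ (by positivity)]
      have h1 : 4 * ε * (m + 1) ≤ lam := by linarith
      have h2 : (4 * ε * (m + 1)) ^ 2 ≤ lam ^ 2 := pow_le_pow_left₀ (by positivity) h1 2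
      have h3 : (m : ℝ) ≤ (m + 1) ^ 2 := by nlinarith [Nat.cast_nonneg (α := ℝ) m]
      calc (m : ℝ) * (16 * ε ^ 2) ≤ (m + 1) ^ 2 * (16 * ε ^ 2) := by gcongr
        _ = (4 * ε * (m + 1)) ^ 2 := by ring
        _ ≤ _ := h2
    have hmean : ∀ x, |mean u (2 ^ n)⁻¹ x| ≤ lam / 2 := by
      intro x
      have h1 := abs_mean_sub_mean_le hu hmn hε.le hm x
      have h2 := hA x
      have h3 : ε * √n ≤ lam / 4 := by
        refine le_of_sq_le_sq ?_ (by positivity)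
        rw [mul_pow, Real.sq_sqrt (Nat.cast_nonneg n)]
        rw [le_div_iff₀ (by positivity)] at hn1
        linarith
      have h4 : A ≤ lam / 4 := by
        have : 0 ≤ 4 * ε * (m + 1) := by positivity
        linarith
      have := abs_sub_abs_le_abs_sub (mean u (2 ^ n)⁻¹ x) (mean u (2 ^ m)⁻¹ x)
      linarith
    refine (volume_lt_abs_le hu (by positivity) hlam hmean).trans ?_
    rw [mul_right_comm, ← ENNReal.ofReal_mul (by norm_num)]
    refine mul_le_mul_left (ENNReal.ofReal_le_ofReal ?_) _
    have hpow : ((2 : ℝ) ^ n)⁻¹ = Real.exp (-(n * Real.log 2)) := by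
      rw [Real.exp_neg, mul_comm, Real.exp_mul, Real.exp_log (by norm_num), Real.rpow_natCast]
    have h2 : (2 : ℝ) = Real.exp (Real.log 2) := (Real.exp_log (by norm_num)).symm
    have h3 : ((2 : ℝ) ^ n)⁻¹ ≤ 2 * Real.exp (-(K * lam ^ 2)) := by
      rw [hpow]
      nth_rewrite 2 [h2]
      rw [← Real.exp_add]
      refine Real.exp_le_exp.2 ?_
      have h5 : lam ^ 2 / (16 * ε ^ 2) = K * lam ^ 2 / Real.log 2 := by
        rw [hε2]; field_simp
      rw [h5, div_lt_iff₀ hlog] at hn2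
      linarith
    linarith
  · refine le_trans ?_ le_add_self
    calc volume {x | lam < |u x|} ≤ volume {x | 1 < |u x|} :=
          measure_mono fun x hx => lt_of_le_of_lt hlam hx
      _ ≤ C2 * ENNReal.ofReal (Real.exp (-(K * lam ^ 2))) := by
          rw [mul_assoc, ← ENNReal.ofReal_mul (Real.exp_nonneg _), ← Real.exp_add]
          refine le_mul_of_one_le_right zero_le ?_
          rw [ENNReal.one_le_ofReal]
          refine Real.one_le_exp ?_
          have : lam ^ 2 ≤ l0 ^ 2 := pow_le_pow_left₀ (by linarith) hl.le 2
          nlinarith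

theorem MemHHalf.lintegral_exp_lt_top {u : ℝ → ℝ} (hu : MemHHalf u) {β : ℝ} (hβ : 0 ≤ β) :
    ∫⁻ x in {x | 1 < |u x|}, ENNReal.ofReal (Real.exp (β * u x ^ 2)) < ∞ := by
  -- On the layer `j + 1 < |u| ≤ j + 2` one has `β (j+2)² ≤ 4β (j+1)²`. The extra 1 leaves the
  -- summable factor `exp (-j)`.
  obtain ⟨C, hC, hdec⟩ := hu.volume_lt_abs_le_exp (K := 4 * β + 1) (by positivity)
  have habs : AEMeasurable (fun x => |u x|) volume := hu.aemeasurable.norm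
  have hs : ∀ l : ℝ, NullMeasurableSet {x | l < |u x|} volume := fun l =>
    nullMeasurableSet_lt aemeasurable_const habs
  set F : ℕ → ℝ → ℝ≥0∞ := fun j => {x | ((j + 1 : ℕ) : ℝ) < |u x|}.indicator
    fun _ => ENNReal.ofReal (Real.exp (β * ((j : ℝ) + 2) ^ 2))
  have hF : ∀ j, AEMeasurable (F j) volume := fun j =>
    aemeasurable_const.indicator₀ (hs _)
  have hle : ∫⁻ x in {x | 1 < |u x|}, ENNReal.ofReal (Real.exp (β * u x ^ 2))
      ≤ ∫⁻ x, ∑' j, F j x := by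
    rw [← lintegral_indicator₀ (hs 1)]
    refine lintegral_mono fun x => ?_
    by_cases hx : x ∈ {x | 1 < |u x|}
    · rw [indicator_of_mem hx]
      have hx' : 1 < |u x| := hx
      obtain ⟨j, hj⟩ : ∃ j : ℕ, ⌈|u x|⌉₊ = j + 2 := by
        have : 1 < ⌈|u x|⌉₊ := Nat.lt_ceil.2 (by simpa using hx')
        exact ⟨⌈|u x|⌉₊ - 2, by omega⟩
      have h1 : ((j + 1 : ℕ) : ℝ) < |u x| := Nat.lt_ceil.1 (by omega)
      have h2 : |u x| ≤ (j : ℝ) + 2 := by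
        have := Nat.le_ceil |u x|
        rw [hj] at this; push_cast at this; exact this
      refine le_trans ?_ (ENNReal.le_tsum j)
      simp only [F]
      rw [indicator_of_mem (by exact h1)]
      apply ENNReal.ofReal_le_ofReal
      refine Real.exp_le_exp.2 (mul_le_mul_of_nonneg_left ?_ hβ)
      rw [← sq_abs]
      exact pow_le_pow_left₀ (abs_nonneg _) h2 2
    · rw [indicator_of_notMem hx]; exact zero_le
  refine lt_of_le_of_lt hle ?_
  rw [lintegral_tsum hF]
  have hterm : ∀ j : ℕ, ∫⁻ x, F j x ≤ C * ENNReal.ofReal (Real.exp (-1) ^ j) := by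
    intro j
    simp only [F]
    rw [lintegral_indicator₀ (hs _), setLIntegral_const]
    have h1 := hdec ((j + 1 : ℕ) : ℝ) (by push_cast; linarith [Nat.cast_nonneg (α := ℝ) j])
    calc ENNReal.ofReal (Real.exp (β * ((j : ℝ) + 2) ^ 2)) * volume {x | ((j + 1 : ℕ) : ℝ) < |u x|}
        ≤ ENNReal.ofReal (Real.exp (β * ((j : ℝ) + 2) ^ 2)) * (C *
          ENNReal.ofReal (Real.exp (-((4 * β + 1) * ((j + 1 : ℕ) : ℝ) ^ 2)))) := by gcongr
      _ = C * ENNReal.ofReal (Real.exp (β * ((j : ℝ) + 2) ^ 2)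
          * Real.exp (-((4 * β + 1) * ((j + 1 : ℕ) : ℝ) ^ 2))) := by
          rw [ENNReal.ofReal_mul (Real.exp_nonneg _)]; ring
      _ ≤ _ := by
          gcongr
          rw [← Real.exp_add, ← Real.exp_nat_mul]
          refine Real.exp_le_exp.2 ?_
          push_cast
          have hj : (0 : ℝ) ≤ j := Nat.cast_nonneg j
          nlinarith [mul_nonneg hβ hj, mul_nonneg hβ (mul_nonneg hj hj)]
  refine lt_of_le_of_lt (ENNReal.tsum_le_tsum hterm) ?_
  rw [ENNReal.tsum_mul_left]
  refine ENNReal.mul_lt_top hC ?_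
  have hsum : Summable fun j : ℕ => Real.exp (-1) ^ j :=
    summable_geometric_of_lt_one (Real.exp_nonneg _) (by rw [Real.exp_lt_one_iff]; norm_num)
  rw [← ENNReal.ofReal_tsum_of_nonneg (fun j => by positivity) hsum]
  exact ENNReal.ofReal_lt_top

theorem MemHHalf.setLIntegral_exp_lt_top {u : ℝ → ℝ} (hu : MemHHalf u) {β : ℝ} (hβ : 0 ≤ β)
    {B : Set ℝ} (hB : volume B < ∞) :
    ∫⁻ x in B, ENNReal.ofReal (Real.exp (β * u x ^ 2)) < ∞ := by
  have habs : AEMeasurable (fun x => |u x|) volume := hu.aemeasurable.norm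
  have hs : NullMeasurableSet {x | 1 < |u x|} volume :=
    nullMeasurableSet_lt aemeasurable_const habs
  calc ∫⁻ x in B, ENNReal.ofReal (Real.exp (β * u x ^ 2))
      ≤ ∫⁻ x in B, (ENNReal.ofReal (Real.exp β) + {x | 1 < |u x|}.indicator
        (fun x => ENNReal.ofReal (Real.exp (β * u x ^ 2))) x) := by
        refine lintegral_mono fun x => ?_
        by_cases hx : x ∈ {x | 1 < |u x|}
        · simp only [indicator_of_mem hx]; exact le_add_self
        · refine le_trans (ENNReal.ofReal_le_ofReal (Real.exp_le_exp.2 ?_)) le_self_add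
          have : |u x| ≤ 1 := not_lt.1 hx
          have : u x ^ 2 ≤ 1 := by rw [← sq_abs]; exact pow_le_one₀ (abs_nonneg _) this
          nlinarith
    _ = ENNReal.ofReal (Real.exp β) * volume B + ∫⁻ x in B, {x | 1 < |u x|}.indicator
        (fun x => ENNReal.ofReal (Real.exp (β * u x ^ 2))) x := by
        rw [lintegral_add_left measurable_const, setLIntegral_const]
    _ < ∞ := by
        refine ENNReal.add_lt_top.2 ⟨ENNReal.mul_lt_top ENNReal.ofReal_lt_top hB, ?_⟩
        refine lt_of_le_of_lt (setLIntegral_le_lintegral _ _) ?_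
        rw [lintegral_indicator₀ hs]
        exact hu.lintegral_exp_lt_top hβ

/-! ### The fractional Laplacian on `H^{1/2}(ℝ)` -/

/-- The character `ξ ↦ exp (2 π i h ξ)`. -/
def character (h ξ : ℝ) : ℂ := Complex.exp (↑(2 * π * (h * ξ)) * Complex.I)

theorem continuous_character (h : ℝ) : Continuous (character h) := by
  unfold character; fun_prop

theorem norm_character (h ξ : ℝ) : ‖character h ξ‖ = 1 := Complex.norm_exp_ofReal_mul_I _

theorem memLp_character (h : ℝ) : MemLp (character h) ∞ (volume : Measure ℝ) :=
  memLp_top_of_bound (continuous_character h).aestronglyMeasurable 1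
    (ae_of_all _ fun ξ => (norm_character h ξ).le)

/-- Multiplication by a character on `L²`. -/
def mulCharacter (h : ℝ) : Lp ℂ 2 (volume : Measure ℝ) →L[ℂ] Lp ℂ 2 (volume : Measure ℝ) :=
  (ContinuousLinearMap.mul ℂ ℂ).holderL volume ∞ 2 2 ((memLp_character h).toLp _)

theorem coeFn_mulCharacter (h : ℝ) (U : Lp ℂ 2 (volume : Measure ℝ)) :
    mulCharacter h U =ᵐ[volume] fun ξ => character h ξ * U ξ := by
  have h1 := (ContinuousLinearMap.mul ℂ ℂ).coeFn_holder (r := 2)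
    ((memLp_character h).toLp (character h)) U
  have h2 := (memLp_character h).coeFn_toLp
  filter_upwards [h1, h2] with ξ e1 e2
  rw [← e2]
  exact e1

/-- Translation on `L²`. -/
def translate (h : ℝ) (U : Lp ℂ 2 (volume : Measure ℝ)) : Lp ℂ 2 (volume : Measure ℝ) :=
  Lp.compMeasurePreserving (fun x => x + h) (measurePreserving_add_right volume h) U

/-- Both sides are continuous in `U`, so the classical identity for Schwartz functions extends by
density. -/
theorem fourier_translate (h : ℝ) (U : Lp ℂ 2 (volume : Measure ℝ)) :
    𝓕 (translate h U) = mulCharacter h (𝓕 U) := by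
  refine DenseRange.induction_on (p := fun U : Lp ℂ 2 (volume : Measure ℝ) =>
      𝓕 (translate h U) = mulCharacter h (𝓕 U))
    (SchwartzMap.denseRange_toLpCLM (p := 2) (μ := volume) (E := ℝ) (F := ℂ)
      ENNReal.ofNat_ne_top) U ?_ ?_
  · refine isClosed_eq ?_ ?_
    · exact (Lp.fourierTransformₗᵢ ℝ ℂ).continuous.comp
        (Lp.isometry_compMeasurePreserving (measurePreserving_add_right volume h)).continuous
    · exact (mulCharacter h).continuous.comp (Lp.fourierTransformₗᵢ ℝ ℂ).continuous
  · intro f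
    rw [SchwartzMap.toLpCLM_apply]
    set f' : SchwartzMap ℝ ℂ := SchwartzMap.compSubConstCLM ℂ (-h) f
    have h1 : translate h (f.toLp 2) = f'.toLp 2 := by
      refine Lp.ext ?_
      have e1 := Lp.coeFn_compMeasurePreserving (f.toLp 2)
        (measurePreserving_add_right (volume : Measure ℝ) h)
      have e2 := (measurePreserving_add_right (volume : Measure ℝ) h).quasiMeasurePreserving.ae_eq_comp
        (f.coeFn_toLp 2)
      refine e1.trans (e2.trans ?_)
      filter_upwards [f'.coeFn_toLp 2] with x hx
      rw [hx]
      simp [f', SchwartzMap.compSubConstCLM_apply]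
    rw [h1, SchwartzMap.toLp_fourier_eq, SchwartzMap.toLp_fourier_eq]
    refine Lp.ext ?_
    filter_upwards [(𝓕 f').coeFn_toLp 2, (𝓕 f).coeFn_toLp 2,
      coeFn_mulCharacter h ((𝓕 f).toLp 2)] with ξ e1 e2 e3
    rw [e1, e3, e2, SchwartzMap.fourier_coe, SchwartzMap.fourier_coe]
    have h2 := congrFun (VectorFourier.fourierIntegral_comp_add_right Real.fourierChar
      (volume : Measure ℝ) (innerₗ ℝ) (f : ℝ → ℂ) h) ξ
    have h3 : (f' : ℝ → ℂ) = (f : ℝ → ℂ) ∘ fun v => v + h := by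
      ext x; simp [f', SchwartzMap.compSubConstCLM_apply]
    rw [h3]
    refine h2.trans ?_
    rw [Circle.smul_def, Real.fourierChar_apply, smul_eq_mul]
    congr 2
    simp [mul_comm]

theorem eLpNorm_two_sq {α E : Type*} [MeasurableSpace α] [NormedAddCommGroup E] (μ : Measure α)
    (f : α → E) : eLpNorm f 2 μ ^ 2 = ∫⁻ x, ‖f x‖ₑ ^ 2 ∂μ := by
  rw [eLpNorm_eq_lintegral_rpow_enorm_toReal (by norm_num) (by norm_num)]
  simp only [ENNReal.toReal_ofNat, ← ENNReal.rpow_natCast, ← ENNReal.rpow_mul]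
  norm_num

theorem toL2_of_memLp {f : ℝ → ℂ} (hf : MemLp f 2 volume) : toL2 f = hf.toLp f := by
  simp [toL2, hf]

theorem coeFn_toL2 {f : ℝ → ℂ} (hf : MemLp f 2 volume) : toL2 f =ᵐ[volume] f := by
  rw [toL2_of_memLp hf]; exact hf.coeFn_toLp

theorem memLp_ofReal {u : ℝ → ℝ} (hu : MemLp u 2 volume) :
    MemLp (fun y => (u y : ℂ)) 2 volume := hu.ofReal

/-- Plancherel applied to `u(· + h) - u`. -/
theorem modulus_eq_fourier {u : ℝ → ℝ} (hu : MemLp u 2 volume) (h : ℝ) :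
    modulus u h = ∫⁻ ξ, ‖character h ξ - 1‖ₑ ^ 2
      * ‖(𝓕 (toL2 fun y => (u y : ℂ)) : Lp ℂ 2 (volume : Measure ℝ)) ξ‖ₑ ^ 2 := by
  set U : Lp ℂ 2 (volume : Measure ℝ) := toL2 fun y => (u y : ℂ)
  have hU : U =ᵐ[volume] fun y => (u y : ℂ) := coeFn_toL2 (memLp_ofReal hu)
  set D : Lp ℂ 2 (volume : Measure ℝ) := translate h U - U
  have hD : D =ᵐ[volume] fun x => ((u (x + h) : ℂ) - (u x : ℂ)) := by
    have e1 := Lp.coeFn_compMeasurePreserving U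
      (measurePreserving_add_right (volume : Measure ℝ) h)
    have e2 := (measurePreserving_add_right (volume : Measure ℝ) h).quasiMeasurePreserving.ae_eq_comp
      hU
    filter_upwards [Lp.coeFn_sub (translate h U) U, e1.trans e2, hU] with x f1 f2 f3
    rw [f1, Pi.sub_apply, f3]
    congr 1
  have hFD : (𝓕 D : Lp ℂ 2 (volume : Measure ℝ)) =ᵐ[volume]
      fun ξ => (character h ξ - 1) * (𝓕 U : Lp ℂ 2 (volume : Measure ℝ)) ξ := by
    have e0 : (𝓕 D : Lp ℂ 2 (volume : Measure ℝ)) = mulCharacter h (𝓕 U) - 𝓕 U := by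
      rw [← fourier_translate]
      exact (Lp.fourierTransformₗᵢ ℝ ℂ).map_sub _ _
    rw [e0]
    filter_upwards [Lp.coeFn_sub (mulCharacter h (𝓕 U)) (𝓕 U), coeFn_mulCharacter h (𝓕 U)]
      with ξ f1 f2
    rw [f1, Pi.sub_apply, f2, sub_mul, one_mul]
  have hn : eLpNorm D 2 volume = eLpNorm (𝓕 D : Lp ℂ 2 (volume : Measure ℝ)) 2 volume := by
    rw [← Lp.enorm_def, ← Lp.enorm_def, ← ofReal_norm, ← ofReal_norm, Lp.norm_fourier_eq]
  have hn2 := congrArg (fun t => t ^ 2) hn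
  simp only [eLpNorm_two_sq] at hn2
  have l1 : ∫⁻ x, ‖D x‖ₑ ^ 2 = modulus u h := by
    refine lintegral_congr_ae ?_
    filter_upwards [hD] with x hx
    rw [hx, ← Complex.ofReal_sub, ← ofReal_norm, Complex.norm_real,
      ← ENNReal.ofReal_pow (norm_nonneg _), Real.norm_eq_abs]
  rw [← l1, hn2]
  refine lintegral_congr_ae ?_
  filter_upwards [hFD] with ξ hξ
  rw [hξ, enorm_mul, mul_pow]

theorem two_le_norm_character_sub_one {h ξ : ℝ} (h1 : 1 / 4 ≤ |h * ξ|) (h2 : |h * ξ| ≤ 1 / 2) :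
    2 ≤ ‖character h ξ - 1‖ ^ 2 := by
  have hcos : Real.cos (2 * π * (h * ξ)) ≤ 0 := by
    rw [← Real.cos_abs, abs_mul, abs_of_pos (by positivity : 0 < 2 * π)]
    refine Real.cos_nonpos_of_pi_div_two_le_of_le ?_ ?_
    · nlinarith [Real.pi_pos]
    · nlinarith [Real.pi_pos]
  rw [character, Complex.sq_norm, Complex.normSq_apply]
  simp only [Complex.sub_re, Complex.sub_im, Complex.exp_ofReal_mul_I_re,
    Complex.exp_ofReal_mul_I_im, Complex.one_re, Complex.one_im]
  nlinarith [Real.sin_sq_add_cos_sq (2 * π * (h * ξ))]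

theorem two_mul_abs_le_lintegral_character {ξ : ℝ} (hξ : ξ ≠ 0) :
    ENNReal.ofReal (2 * |ξ|)
      ≤ ∫⁻ h : ℝ, ‖character h ξ - 1‖ₑ ^ 2 * ENNReal.ofReal ((|h| ^ 2)⁻¹) := by
  have hx : 0 < |ξ| := abs_pos.2 hξ
  -- Only a lower bound is needed, so the integral is restricted to the `h` with `1/4 ≤ h|ξ| ≤ 1/2`,
  -- where the character stays away from 1.
  set J : Set ℝ := Ioc (1 / (4 * |ξ|)) (1 / (2 * |ξ|))
  calc ENNReal.ofReal (2 * |ξ|) = ENNReal.ofReal (8 * |ξ| ^ 2) * volume J := by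
        rw [Real.volume_Ioc, ← ENNReal.ofReal_mul (by positivity)]
        congr 1; field_simp; norm_num
    _ = ∫⁻ h in J, ENNReal.ofReal (8 * |ξ| ^ 2) := by rw [setLIntegral_const]
    _ ≤ ∫⁻ h in J, ‖character h ξ - 1‖ₑ ^ 2 * ENNReal.ofReal ((|h| ^ 2)⁻¹) := by
        refine setLIntegral_mono_ae' measurableSet_Ioc (ae_of_all _ ?_)
        rintro h ⟨hh1, hh2⟩
        have hpos : 0 < h := lt_trans (by positivity) hh1
        rw [← ofReal_norm, ← ENNReal.ofReal_pow (norm_nonneg _),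
          ← ENNReal.ofReal_mul (by positivity)]
        apply ENNReal.ofReal_le_ofReal
        rw [div_lt_iff₀ (by positivity)] at hh1
        rw [le_div_iff₀ (by positivity)] at hh2
        have e := two_le_norm_character_sub_one (h := h) (ξ := ξ)
          (by rw [abs_mul, abs_of_pos hpos]; linarith)
          (by rw [abs_mul, abs_of_pos hpos]; linarith)
        rw [← div_eq_mul_inv, le_div_iff₀ (by positivity), sq_abs h]
        have e2 : (2 * |ξ| * h) ^ 2 ≤ 1 := pow_le_one₀ (by positivity) (by linarith)
        nlinarith
    _ ≤ _ := setLIntegral_le_lintegral _ _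

theorem lintegral_abs_mul_fourier_le {u : ℝ → ℝ} (hu : MemLp u 2 volume) :
    ∫⁻ ξ : ℝ, ENNReal.ofReal (2 * |ξ|)
      * ‖(𝓕 (toL2 fun y => (u y : ℂ)) : Lp ℂ 2 (volume : Measure ℝ)) ξ‖ₑ ^ 2 ≤ gagliardo u := by
  set W : Lp ℂ 2 (volume : Measure ℝ) := 𝓕 (toL2 fun y => (u y : ℂ))
  have hW : AEMeasurable (fun ξ => ‖W ξ‖ₑ ^ 2) volume :=
    ((Lp.aestronglyMeasurable W).enorm).pow_const 2
  rw [gagliardo_eq_lintegral_modulus hu.aestronglyMeasurable.aemeasurable]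
  have e1 : ∀ h : ℝ, modulus u h * ENNReal.ofReal ((|h| ^ 2)⁻¹)
      = ∫⁻ ξ, ‖character h ξ - 1‖ₑ ^ 2 * ENNReal.ofReal ((|h| ^ 2)⁻¹) * ‖W ξ‖ₑ ^ 2 := by
    intro h
    rw [modulus_eq_fourier hu, ← lintegral_mul_const' _ _ ENNReal.ofReal_ne_top]
    exact lintegral_congr fun ξ => by ring
  simp_rw [e1]
  rw [lintegral_lintegral_swap]
  · refine lintegral_mono_ae ?_
    filter_upwards [Measure.ae_ne volume (0 : ℝ)] with ξ hξ
    rw [lintegral_mul_const' _ _ (by finiteness)]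
    gcongr
    exact two_mul_abs_le_lintegral_character hξ
  · refine AEMeasurable.mul ?_ hW.comp_snd
    refine Measurable.aemeasurable ?_
    have hc : Continuous (fun p : ℝ × ℝ => character p.1 p.2 - 1) := by
      unfold character; fun_prop
    exact (hc.measurable.enorm.pow_const 2).mul (by fun_prop)

/-- The symbol of `(-Δ)^{1/4}` times the Fourier transform of `u`. -/
def symbolMul (u : ℝ → ℝ) : ℝ → ℂ := fun ξ => ((|2 * π * ξ| ^ (1 / 2 : ℝ) : ℝ) : ℂ) *
      (𝓕 (toL2 fun y => (u y : ℂ)) : Lp ℂ 2 (volume : Measure ℝ)) ξ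

/-- On `H^{1/2}` the outer `toL2` in `quarterLaplacian` is therefore never the default value 0; the
linearity of `quarterLaplacian` rests on this. -/
theorem MemHHalf.memLp_symbolMul {u : ℝ → ℝ} (hu : MemHHalf u) :
    MemLp (symbolMul u) 2 volume := by
  set W : Lp ℂ 2 (volume : Measure ℝ) := 𝓕 (toL2 fun y => (u y : ℂ)) with hWdef
  have hm : AEStronglyMeasurable (symbolMul u) volume := by
    refine AEStronglyMeasurable.mul ?_ (Lp.aestronglyMeasurable W)
    refine Measurable.aestronglyMeasurable ?_
    fun_prop
  refine ⟨hm, ?_⟩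
  have h2 : eLpNorm (symbolMul u) 2 volume ^ 2 < ∞ := by
    rw [eLpNorm_two_sq]
    have e : ∀ ξ, ‖symbolMul u ξ‖ₑ ^ 2
        = ENNReal.ofReal π * (ENNReal.ofReal (2 * |ξ|) * ‖W ξ‖ₑ ^ 2) := by
      intro ξ
      rw [symbolMul, enorm_mul, mul_pow, ← mul_assoc]
      congr 1
      rw [← ofReal_norm, Complex.norm_real, ← ENNReal.ofReal_pow (norm_nonneg _),
        ← ENNReal.ofReal_mul Real.pi_pos.le, Real.norm_eq_abs, sq_abs, ← Real.sqrt_eq_rpow,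
        Real.sq_sqrt (abs_nonneg _), abs_mul, abs_of_pos (by positivity : 0 < 2 * π)]
      congr 1; ring
    simp_rw [e]
    rw [lintegral_const_mul' _ _ ENNReal.ofReal_ne_top]
    exact ENNReal.mul_lt_top ENNReal.ofReal_lt_top
      (lt_of_le_of_lt (lintegral_abs_mul_fourier_le hu.1) hu.2)
  by_contra hcon
  rw [not_lt, top_le_iff] at hcon
  rw [hcon] at h2
  simp at h2

/-! ### Linearity of `(-Δ)^{1/4}`. -/

theorem toL2_congr {f g : ℝ → ℂ} (h : f =ᵐ[volume] g) : toL2 f = toL2 g := by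
  by_cases hf : MemLp f 2 volume
  · have hg : MemLp g 2 volume := hf.ae_eq h
    rw [toL2_of_memLp hf, toL2_of_memLp hg]
    exact (MemLp.toLp_eq_toLp_iff hf hg).2 h
  · have hg : ¬ MemLp g 2 volume := fun hg => hf (hg.ae_eq h.symm)
    simp [toL2, hf, hg]

theorem toL2_add {f g : ℝ → ℂ} (hf : MemLp f 2 volume) (hg : MemLp g 2 volume) :
    toL2 (fun x => f x + g x) = toL2 f + toL2 g := by
  rw [toL2_of_memLp hf, toL2_of_memLp hg, toL2_of_memLp (f := fun x => f x + g x) (hf.add hg)]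
  exact MemLp.toLp_add hf hg

theorem toL2_const_mul {f : ℝ → ℂ} (hf : MemLp f 2 volume) (c : ℂ) :
    toL2 (fun x => c * f x) = c • toL2 f := by
  rw [toL2_of_memLp hf, toL2_of_memLp (hf.const_mul c)]
  exact MemLp.toLp_const_smul c hf

theorem quarterLaplacian_congr {u v : ℝ → ℝ} (h : u =ᵐ[volume] v) :
    quarterLaplacian u = quarterLaplacian v := by
  have : (toL2 fun y => (u y : ℂ)) = toL2 fun y => (v y : ℂ) := by
    refine toL2_congr ?_
    filter_upwards [h] with x hx
    rw [hx]
  unfold quarterLaplacian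
  rw [this]

theorem quarterLaplacian_add {u v : ℝ → ℝ} (hu : MemHHalf u) (hv : MemHHalf v) :
    quarterLaplacian (fun x => u x + v x)
      =ᵐ[volume] fun x => quarterLaplacian u x + quarterLaplacian v x := by
  have e1 : (toL2 fun y => ((u y + v y : ℝ) : ℂ))
      = (toL2 fun y => (u y : ℂ)) + toL2 fun y => (v y : ℂ) := by
    simp_rw [Complex.ofReal_add]
    exact toL2_add (memLp_ofReal hu.1) (memLp_ofReal hv.1)
  have e2 : toL2 (symbolMul fun x => u x + v x) = toL2 (symbolMul u) + toL2 (symbolMul v) := by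
    rw [← toL2_add hu.memLp_symbolMul hv.memLp_symbolMul]
    refine toL2_congr ?_
    have e3 : (𝓕 (toL2 fun y => ((u y + v y : ℝ) : ℂ)) : Lp ℂ 2 (volume : Measure ℝ))
        = 𝓕 (toL2 fun y => (u y : ℂ)) + 𝓕 (toL2 fun y => (v y : ℂ)) := by
      rw [e1]; exact (Lp.fourierTransformₗᵢ ℝ ℂ).map_add _ _
    unfold symbolMul
    rw [e3]
    filter_upwards [Lp.coeFn_add (𝓕 (toL2 fun y => (u y : ℂ)) : Lp ℂ 2 (volume : Measure ℝ))
      (𝓕 (toL2 fun y => (v y : ℂ)))] with ξ hξ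
    rw [hξ, Pi.add_apply, mul_add]
  have e4 : (𝓕⁻ (toL2 (symbolMul fun x => u x + v x)) : Lp ℂ 2 (volume : Measure ℝ))
      = 𝓕⁻ (toL2 (symbolMul u)) + 𝓕⁻ (toL2 (symbolMul v)) := by
    rw [e2]; exact (Lp.fourierTransformₗᵢ ℝ ℂ).symm.map_add _ _
  change (fun x => ((𝓕⁻ (toL2 (symbolMul fun x => u x + v x)) : Lp ℂ 2 (volume : Measure ℝ)) x).re)
    =ᵐ[volume] fun x => ((𝓕⁻ (toL2 (symbolMul u)) : Lp ℂ 2 (volume : Measure ℝ)) x).re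
      + ((𝓕⁻ (toL2 (symbolMul v)) : Lp ℂ 2 (volume : Measure ℝ)) x).re
  rw [e4]
  filter_upwards [Lp.coeFn_add (𝓕⁻ (toL2 (symbolMul u)) : Lp ℂ 2 (volume : Measure ℝ))
    (𝓕⁻ (toL2 (symbolMul v)))] with x hx
  rw [hx, Pi.add_apply, Complex.add_re]

theorem quarterLaplacian_const_mul {u : ℝ → ℝ} (hu : MemHHalf u) (c : ℝ) :
    quarterLaplacian (fun x => c * u x) =ᵐ[volume] fun x => c * quarterLaplacian u x := by
  have e1 : (toL2 fun y => ((c * u y : ℝ) : ℂ)) = (c : ℂ) • toL2 fun y => (u y : ℂ) := by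
    simp_rw [Complex.ofReal_mul]
    exact toL2_const_mul (memLp_ofReal hu.1) _
  have e2 : toL2 (symbolMul fun x => c * u x) = (c : ℂ) • toL2 (symbolMul u) := by
    rw [← toL2_const_mul hu.memLp_symbolMul]
    refine toL2_congr ?_
    have e3 : (𝓕 (toL2 fun y => ((c * u y : ℝ) : ℂ)) : Lp ℂ 2 (volume : Measure ℝ))
        = (c : ℂ) • 𝓕 (toL2 fun y => (u y : ℂ)) := by
      rw [e1]; exact (Lp.fourierTransformₗᵢ ℝ ℂ).map_smul _ _
    unfold symbolMul
    rw [e3]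
    filter_upwards [Lp.coeFn_smul (c : ℂ)
      (𝓕 (toL2 fun y => (u y : ℂ)) : Lp ℂ 2 (volume : Measure ℝ))] with ξ hξ
    rw [hξ, Pi.smul_apply, smul_eq_mul]
    ring
  have e4 : (𝓕⁻ (toL2 (symbolMul fun x => c * u x)) : Lp ℂ 2 (volume : Measure ℝ))
      = (c : ℂ) • 𝓕⁻ (toL2 (symbolMul u)) := by
    rw [e2]; exact (Lp.fourierTransformₗᵢ ℝ ℂ).symm.map_smul _ _
  change (fun x => ((𝓕⁻ (toL2 (symbolMul fun x => c * u x)) : Lp ℂ 2 (volume : Measure ℝ)) x).re)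
    =ᵐ[volume] fun x => c * ((𝓕⁻ (toL2 (symbolMul u)) : Lp ℂ 2 (volume : Measure ℝ)) x).re
  rw [e4]
  filter_upwards [Lp.coeFn_smul (c : ℂ)
    (𝓕⁻ (toL2 (symbolMul u)) : Lp ℂ 2 (volume : Measure ℝ))] with x hx
  rw [hx, Pi.smul_apply, smul_eq_mul, Complex.re_ofReal_mul]

theorem memLp_quarterLaplacian (u : ℝ → ℝ) : MemLp (quarterLaplacian u) 2 volume :=
  (Lp.memLp (𝓕⁻ (toL2 (symbolMul u)) : Lp ℂ 2 (volume : Measure ℝ))).re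

/-! ### Functions in `H^{1/2}(ℝ)` have no gaps in their range -/

/-- Differences of indicator values lie in `{-1, 0, 1}`, so their squares equal their absolute
values and satisfy the triangle inequality without the usual factor 2. This is the one property that
rules out jumps. -/
theorem indicator_one_sq_le (A : Set ℝ) (x y z : ℝ) :
    |A.indicator (fun _ => (1 : ℝ)) x - A.indicator (fun _ => 1) z| ^ 2
      ≤ |A.indicator (fun _ => (1 : ℝ)) x - A.indicator (fun _ => 1) y| ^ 2
        + |A.indicator (fun _ => (1 : ℝ)) y - A.indicator (fun _ => 1) z| ^ 2 := by
  by_cases hx : x ∈ A <;> by_cases hy : y ∈ A <;> by_cases hz : z ∈ A <;> simp [hx, hy, hz]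

theorem modulus_indicator_two_mul_le {A : Set ℝ} (hA : NullMeasurableSet A volume) (h : ℝ) :
    modulus (A.indicator fun _ => 1) (2 * h) ≤ 2 * modulus (A.indicator fun _ => 1) h := by
  set v : ℝ → ℝ := A.indicator fun _ => 1 with hv
  have hvm : AEMeasurable v volume := aemeasurable_const.indicator₀ hA
  have hvs : AEMeasurable (fun x => v (x + h)) volume :=
    hvm.comp_quasiMeasurePreserving (measurePreserving_add_right volume h).quasiMeasurePreserving
  have hm : AEMeasurable (fun x => ENNReal.ofReal (|v (x + h) - v x| ^ 2)) volume :=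
    (((hvs.sub hvm).norm).pow_const 2).ennreal_ofReal
  calc modulus v (2 * h) ≤ ∫⁻ x, (ENNReal.ofReal (|v (x + h) - v x| ^ 2)
        + ENNReal.ofReal (|v (x + h + h) - v (x + h)| ^ 2)) := by
        refine lintegral_mono fun x => ?_
        rw [← ENNReal.ofReal_add (by positivity) (by positivity)]
        apply ENNReal.ofReal_le_ofReal
        have := indicator_one_sq_le A (x + 2 * h) (x + h) x
        rw [show x + h + h = x + 2 * h by ring]
        linarith
    _ = modulus v h + modulus v h := by
        rw [lintegral_add_left' hm,
          lintegral_add_right_eq_self (fun x => ENNReal.ofReal (|v (x + h) - v x| ^ 2)) h]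
        rfl
    _ = _ := (two_mul _).symm

theorem setLIntegral_Ioc_two_mul (F : ℝ → ℝ≥0∞) (T : ℝ) :
    ∫⁻ h in Ioc 0 (2 * T), F h = 2 * ∫⁻ h in Ioc 0 T, F (2 * h) := by
  rw [← lintegral_indicator measurableSet_Ioc, ← lintegral_indicator measurableSet_Ioc]
  conv_lhs => rw [← Real.smul_map_volume_mul_left (a := 2) (by norm_num)]
  have hme : MeasurableEmbedding (fun x : ℝ => 2 * x) :=
    (Homeomorph.mulLeft₀ (2 : ℝ) (by norm_num)).measurableEmbedding
  rw [lintegral_smul_measure, hme.lintegral_map]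
  simp only [abs_two, ENNReal.ofReal_ofNat, smul_eq_mul]
  congr 1
  refine lintegral_congr fun x => ?_
  have : (2 * x ∈ Ioc 0 (2 * T)) ↔ x ∈ Ioc 0 T := by
    simp only [mem_Ioc]
    constructor <;> rintro ⟨h1, h2⟩ <;> constructor <;> linarith
  by_cases hx : x ∈ Ioc 0 T
  · rw [indicator_of_mem hx, indicator_of_mem (this.2 hx)]
  · rw [indicator_of_notMem hx, indicator_of_notMem (fun h => hx (this.1 h))]

/-- A set of finite measure whose indicator function is in `W^{1/2,2}` is negligible. -/
theorem volume_eq_zero_of_gagliardo_indicator {A : Set ℝ} (hA : NullMeasurableSet A volume)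
    (hfin : volume A < ∞) (hg : gagliardo (A.indicator fun _ => 1) < ∞) : volume A = 0 := by
  set v : ℝ → ℝ := A.indicator fun _ => 1 with hv
  have hvm : AEMeasurable v volume := aemeasurable_const.indicator₀ hA
  set F : ℝ → ℝ≥0∞ := fun h => modulus v h * ENNReal.ofReal ((|h| ^ 2)⁻¹) with hF
  have hFfin : ∫⁻ h, F h ≠ ∞ := by
    rw [gagliardo_eq_lintegral_modulus hvm] at hg
    exact hg.ne
  -- Scaling by 2 gives one factor 2 from `dh`, one from `modulus_indicator_two_mul_le` and `1/4`
  -- from the kernel, hence no gain. Iterating pushes all the mass to `h = 0`, where a finite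
  -- integral has none.
  have hstep : ∀ T : ℝ, ∫⁻ h in Ioc 0 (2 * T), F h ≤ ∫⁻ h in Ioc 0 T, F h := by
    intro T
    rw [setLIntegral_Ioc_two_mul, ← lintegral_const_mul' _ _ (by norm_num)]
    refine lintegral_mono fun h => ?_
    simp only [hF]
    calc 2 * (modulus v (2 * h) * ENNReal.ofReal ((|2 * h| ^ 2)⁻¹))
        ≤ 2 * ((2 * modulus v h) * ENNReal.ofReal ((|2 * h| ^ 2)⁻¹)) := by
          gcongr; exact modulus_indicator_two_mul_le hA h
      _ = modulus v h * (ENNReal.ofReal 4 * ENNReal.ofReal ((|2 * h| ^ 2)⁻¹)) := by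
          rw [show ENNReal.ofReal 4 = 2 * 2 by norm_num]; ring
      _ = modulus v h * ENNReal.ofReal ((|h| ^ 2)⁻¹) := by
          rw [← ENNReal.ofReal_mul (by norm_num), abs_mul, mul_pow, mul_inv, ← mul_assoc]
          norm_num
  have hiter : ∀ (T : ℝ) (n : ℕ), ∫⁻ h in Ioc 0 T, F h ≤ ∫⁻ h in Ioc 0 (T / 2 ^ n), F h := by
    intro T n
    induction n with
    | zero => simp
    | succ n ih =>
      refine ih.trans ?_
      have := hstep (T / 2 ^ (n + 1))
      rwa [show 2 * (T / 2 ^ (n + 1)) = T / 2 ^ n by rw [pow_succ]; field_simp] at this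
  have hzero : ∀ T : ℝ, ∫⁻ h in Ioc 0 T, F h = 0 := by
    intro T
    have ht : Tendsto (fun n : ℕ => ∫⁻ h in Ioc 0 (T / 2 ^ n), F h) atTop (𝓝 0) := by
      refine tendsto_setLIntegral_zero hFfin ?_
      have h1 : Tendsto (fun n : ℕ => T / 2 ^ n) atTop (𝓝 0) :=
        Tendsto.const_div_atTop (tendsto_pow_atTop_atTop_of_one_lt (by norm_num)) T
      simpa [Function.comp_def, Real.volume_Ioc] using ENNReal.tendsto_ofReal h1
    exact le_antisymm (ge_of_tendsto' ht (hiter T)) zero_le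
  have hpos : ∫⁻ h in Ioi (0 : ℝ), F h = 0 := by
    have hU : (Ioi (0 : ℝ)) = ⋃ n : ℕ, Ioc (0 : ℝ) n := by
      ext x
      simp only [mem_Ioi, mem_iUnion, mem_Ioc]
      exact ⟨fun h => let ⟨n, hn⟩ := exists_nat_ge x; ⟨n, h, hn⟩, fun ⟨_, h, _⟩ => h⟩
    refine le_antisymm ?_ zero_le
    rw [hU]
    refine (lintegral_iUnion_le _ _).trans ?_
    simp [hzero]
  have hFm : AEMeasurable F volume := (aemeasurable_modulus hvm).mul
    (Measurable.aemeasurable (by fun_prop))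
  have hmod : ∫⁻ h in Ioi (0 : ℝ), modulus v h = 0 := by
    rw [lintegral_eq_zero_iff' hFm.restrict] at hpos
    rw [lintegral_eq_zero_iff' (aemeasurable_modulus hvm).restrict]
    filter_upwards [hpos, ae_restrict_mem measurableSet_Ioi] with h h1 h2
    have h2' : 0 < h := h2
    simp only [hF, Pi.zero_apply, mul_eq_zero, ENNReal.ofReal_eq_zero] at h1
    rcases h1 with h1 | h1
    · exact h1
    · exact absurd h1 (not_le.2 (by positivity))
  have hpm : AEMeasurable (fun p : ℝ × ℝ => ENNReal.ofReal (|v (p.1 + p.2) - v p.1| ^ 2))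
      (volume.prod (volume.restrict (Ioi (0 : ℝ)))) := by
    refine (aemeasurable_shift_sub hvm).mono_ac ?_
    exact Measure.AbsolutelyContinuous.prod (by rfl) Measure.restrict_le_self.absolutelyContinuous
  have hswap : ∫⁻ x, ∫⁻ h in Ioi (0 : ℝ), ENNReal.ofReal (|v (x + h) - v x| ^ 2) = 0 := by
    rw [lintegral_lintegral_swap hpm]
    exact hmod
  rw [lintegral_eq_zero_iff' hpm.lintegral_prod_right'] at hswap
  by_contra hAne
  -- From such a point almost the whole half-line to the right lies in `A`, contradicting the finite
  -- measure.
  obtain ⟨x, hxA, hx⟩ : ∃ x ∈ A, ∫⁻ h in Ioi (0 : ℝ), ENNReal.ofReal (|v (x + h) - v x| ^ 2) = 0 := by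
    have h1 : ∃ᵐ x ∂volume, x ∈ A := frequently_ae_iff.2 hAne
    obtain ⟨x, h2, h3⟩ := (h1.and_eventually hswap).exists
    exact ⟨x, h2, h3⟩
  have hsm : AEMeasurable (fun h => ENNReal.ofReal (|v (x + h) - v x| ^ 2)) volume := by
    have hvs : AEMeasurable (fun h => v (x + h)) volume :=
      hvm.comp_quasiMeasurePreserving (measurePreserving_add_left volume x).quasiMeasurePreserving
    exact (((hvs.sub aemeasurable_const).norm).pow_const 2).ennreal_ofReal
  rw [lintegral_eq_zero_iff' hsm.restrict] at hx
  have hmem : ∀ᵐ h ∂(volume.restrict (Ioi (0 : ℝ))), x + h ∈ A := by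
    filter_upwards [hx] with h hh
    by_contra hcon
    simp [hv, hxA, hcon] at hh
  have htop : volume (Ioi (0 : ℝ)) ≤ volume ((fun h => x + h) ⁻¹' A) := by
    refine measure_mono_ae ?_
    rw [ae_restrict_iff' measurableSet_Ioi] at hmem
    exact hmem
  rw [measure_preimage_add, Real.volume_Ioi] at htop
  exact absurd hfin (not_lt.2 htop)

/-- A function in `H^{1/2}(ℝ)` with values in a closed symmetric set without interior vanishes. -/
theorem MemHHalf.ae_eq_zero_of_mem {u : ℝ → ℝ} (hu : MemHHalf u) {Z : Set ℝ} (hZ : IsClosed Z)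
    (hZi : interior Z = ∅) (hsymm : ∀ t ∈ Z, -t ∈ Z) (h : ∀ᵐ x, u x ∈ Z) :
    u =ᵐ[volume] fun _ => 0 := by
  by_contra hne
  have habs : AEMeasurable (fun x => |u x|) volume := hu.aemeasurable.norm
  obtain ⟨n, hn⟩ : ∃ n : ℕ, volume {x | 1 / ((n : ℝ) + 1) < |u x|} ≠ 0 := by
    by_contra! hcon
    apply hne
    have h1 : volume (⋃ n : ℕ, {x | 1 / ((n : ℝ) + 1) < |u x|}) = 0 := measure_iUnion_null hcon
    refine measure_mono_null (fun x hx => ?_) h1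
    have hx' : u x ≠ 0 := hx
    obtain ⟨n, hn⟩ := exists_nat_one_div_lt (abs_pos.2 hx')
    exact mem_iUnion.2 ⟨n, hn⟩
  set c : ℝ := 1 / ((n : ℝ) + 1)
  have hc : 0 < c := by positivity
  -- A level omitted by `|u|` together with a neighbourhood of radius `ε`. Crossing it costs `|u x -
  -- u y| ≥ ε`, so the indicator of `{s < |u|}` has seminorm controlled by that of `u`.
  obtain ⟨s, hsZ, hs0, hsc⟩ : ∃ s ∈ Zᶜ, 0 < s ∧ s < c := by
    obtain ⟨s, h1, h2⟩ := (interior_eq_empty_iff_dense_compl.1 hZi).exists_between hc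
    exact ⟨s, h1, h2⟩
  obtain ⟨ε, hε, hball⟩ := Metric.isOpen_iff.1 hZ.isOpen_compl s hsZ
  set A : Set ℝ := {x | s < |u x|}
  have hA : NullMeasurableSet A volume := nullMeasurableSet_lt aemeasurable_const habs
  have hAfin : volume A < ∞ := by
    have h1 := mul_meas_ge_le_lintegral₀ (hu.aemeasurable.pow_const 2).ennreal_ofReal
      (ENNReal.ofReal (s ^ 2))
    have h2 := lt_of_le_of_lt h1 (lintegral_sq_lt_top hu.1)
    have h3 := ENNReal.lt_top_of_mul_ne_top_right h2.ne (by simpa using by positivity)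
    refine lt_of_le_of_lt (measure_mono fun x hx => ?_) h3
    have hx' : s < |u x| := hx
    refine ENNReal.ofReal_le_ofReal ?_
    rw [← sq_abs (u x)]
    exact pow_le_pow_left₀ hs0.le hx'.le 2
  have habsZ : ∀ᵐ x, |u x| ∈ Z := by
    filter_upwards [h] with x hx
    rcases abs_choice (u x) with h1 | h1 <;> rw [h1]
    · exact hx
    · exact hsymm _ hx
  have hgap : ∀ x y, |u x| ∈ Z → |u y| ∈ Z → x ∈ A → y ∉ A → ε ≤ |u x - u y| := by
    intro x y hx hy hxA hyA
    have h1 : s < |u x| := hxA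
    have h2 : |u y| ≤ s := not_lt.1 hyA
    have h3 : s + ε ≤ |u x| := by
      by_contra hlt
      have hmem : |u x| ∈ Metric.ball s ε := by
        rw [Metric.mem_ball, Real.dist_eq, abs_lt]
        constructor <;> linarith
      exact hball hmem hx
    have := abs_sub_abs_le_abs_sub (u x) (u y)
    linarith
  have hgA : gagliardo (A.indicator fun _ => 1) < ∞ := by
    have hle : gagliardo (A.indicator fun _ => 1) ≤ ENNReal.ofReal ((ε ^ 2)⁻¹) * gagliardo u := by
      unfold gagliardo
      rw [← lintegral_const_mul' _ _ ENNReal.ofReal_ne_top]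
      refine lintegral_mono_ae ?_
      filter_upwards [habsZ] with x hx
      rw [← lintegral_const_mul' _ _ ENNReal.ofReal_ne_top]
      refine lintegral_mono_ae ?_
      filter_upwards [habsZ] with y hy
      rw [← ENNReal.ofReal_mul (by positivity)]
      apply ENNReal.ofReal_le_ofReal
      rw [mul_div_assoc']
      refine div_le_div_of_nonneg_right ?_ (by positivity)
      rw [inv_mul_eq_div, le_div_iff₀ (by positivity)]
      by_cases hxA : x ∈ A <;> by_cases hyA : y ∈ A
      · simp [hxA, hyA]; positivity
      · have := hgap x y hx hy hxA hyA
        have := pow_le_pow_left₀ hε.le this 2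
        simpa [hxA, hyA] using this
      · have := hgap y x hy hx hyA hxA
        have := pow_le_pow_left₀ hε.le this 2
        rw [abs_sub_comm] at this
        simpa [hxA, hyA] using this
      · simp [hxA, hyA]; positivity
    exact lt_of_le_of_lt hle (ENNReal.mul_lt_top ENNReal.ofReal_lt_top hu.2)
  have h0 := volume_eq_zero_of_gagliardo_indicator hA hAfin hgA
  exact hn (measure_mono_null (fun x hx => lt_trans hsc hx) h0)

/-! ### The logarithmic energy -/

/-- For `0 < |s| ≤ 1` the logarithm is at most `4 |s|^(-1/4)`, whose square is integrable near 0. -/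
theorem lintegral_posLog_sq_lt_top :
    ∫⁻ s : ℝ, ENNReal.ofReal (Real.posLog (1 / |s|) ^ 2) < ∞ := by
  set p : ℝ → ℝ := (Ioc (0 : ℝ) 1).indicator fun s => s ^ (-(1 / 2) : ℝ) with hp
  have hpint : Integrable p := by
    have h := intervalIntegral.intervalIntegrable_rpow' (a := 0) (b := 1)
      (r := -(1 / 2)) (by norm_num)
    rw [intervalIntegrable_iff_integrableOn_Ioc_of_le (by norm_num)] at h
    exact (integrable_indicator_iff measurableSet_Ioc).2 h
  have hp0 : ∀ s, 0 ≤ p s := fun s => by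
    refine indicator_nonneg (fun x hx => ?_) s
    exact Real.rpow_nonneg hx.1.le _
  have hintg : Integrable fun s => 16 * (p s + p (-s)) := (hpint.add hpint.comp_neg).const_mul 16
  have hbound : ∀ s : ℝ, Real.posLog (1 / |s|) ^ 2 ≤ 16 * (p s + p (-s)) := by
    intro s
    have hnn : 0 ≤ 16 * (p s + p (-s)) := by have := hp0 s; have := hp0 (-s); positivity
    rcases eq_or_ne s 0 with rfl | hs
    · simpa using hnn
    have hs' : 0 < |s| := abs_pos.2 hs
    rcases le_or_gt |s| 1 with h1 | h1
    · have hlog : Real.posLog (1 / |s|) ≤ 4 * |s| ^ (-(1 / 4) : ℝ) := by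
        rw [Real.posLog_apply, max_le_iff]
        refine ⟨by positivity, ?_⟩
        have := Real.log_le_rpow_div (x := 1 / |s|) (ε := 1 / 4) (by positivity) (by norm_num)
        rw [one_div |s|, Real.inv_rpow hs'.le, ← Real.rpow_neg hs'.le] at this
        rw [one_div |s|]
        linarith
      have hsq : Real.posLog (1 / |s|) ^ 2 ≤ 16 * |s| ^ (-(1 / 2) : ℝ) := by
        have := pow_le_pow_left₀ Real.posLog_nonneg hlog 2
        rw [mul_pow, ← Real.rpow_natCast (|s| ^ (-(1 / 4) : ℝ)), ← Real.rpow_mul hs'.le] at this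
        norm_num at this ⊢
        exact this
      refine hsq.trans (mul_le_mul_of_nonneg_left ?_ (by norm_num))
      rcases lt_or_gt_of_ne hs with hneg | hpos
      · have : p (-s) = |s| ^ (-(1 / 2) : ℝ) := by
          rw [abs_of_neg hneg] at h1 ⊢
          rw [hp, indicator_of_mem]
          exact ⟨by linarith, h1⟩
        rw [this]; linarith [hp0 s]
      · have : p s = |s| ^ (-(1 / 2) : ℝ) := by
          rw [abs_of_pos hpos] at h1 ⊢
          rw [hp, indicator_of_mem]
          exact ⟨hpos, h1⟩
        rw [this]; linarith [hp0 (-s)]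
    · have : Real.posLog (1 / |s|) = 0 := by
        rw [Real.posLog_eq_zero_iff, abs_of_pos (by positivity)]
        rw [div_le_one hs']; exact h1.le
      rw [this]; simpa using hnn
  have h2 := hintg.hasFiniteIntegral
  rw [hasFiniteIntegral_iff_ofReal (ae_of_all _ fun s => by
    have := hp0 s; have := hp0 (-s); positivity)] at h2
  exact lt_of_le_of_lt (lintegral_mono fun s => ENNReal.ofReal_le_ofReal (hbound s)) h2

/-- The logarithmic weight controlling the kernel at infinity. -/
def logWeight (y : ℝ) : ℝ := Real.log (2 + |y|)

theorem log_two_le_logWeight (y : ℝ) : Real.log 2 ≤ logWeight y :=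
  Real.log_le_log (by norm_num) (by linarith [abs_nonneg y])

theorem logWeight_pos (y : ℝ) : 0 < logWeight y :=
  lt_of_lt_of_le (Real.log_pos (by norm_num)) (log_two_le_logWeight y)

theorem measurable_logWeight : Measurable logWeight := by
  unfold logWeight; fun_prop

/-- The reason is `|x - y| ≤ (2 + |x|)(2 + |y|)`. It separates the variables in the unbounded part
of the kernel. -/
theorem posLog_abs_sub_le (x y : ℝ) : Real.posLog |x - y| ≤ logWeight x + logWeight y := by
  have h1 := logWeight_pos x
  have h2 := logWeight_pos y
  rw [Real.posLog_apply, max_le_iff]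
  refine ⟨by positivity, ?_⟩
  rcases eq_or_ne x y with rfl | hxy
  · simp; linarith
  · rw [logWeight, logWeight, ← Real.log_mul (by positivity) (by positivity)]
    refine Real.log_le_log (abs_pos.2 (sub_ne_zero.2 hxy)) ?_
    have := abs_sub x y
    nlinarith [abs_nonneg x, abs_nonneg y, mul_nonneg (abs_nonneg x) (abs_nonneg y)]

/-- The logarithmic kernel. -/
def logKernel (x y : ℝ) : ℝ := Real.log (1 / |x - y|)

theorem logKernel_comm (x y : ℝ) : logKernel x y = logKernel y x := by
  rw [logKernel, logKernel, abs_sub_comm]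

theorem measurable_logKernel : Measurable fun p : ℝ × ℝ => logKernel p.1 p.2 := by
  unfold logKernel; fun_prop

theorem logKernel_eq (x y : ℝ) :
    logKernel x y = Real.posLog (1 / |x - y|) - Real.posLog |x - y| := by
  have := Real.posLog_sub_posLog_inv (x := 1 / |x - y|)
  rw [logKernel, ← this]; simp

theorem abs_logKernel_le (x y : ℝ) :
    |logKernel x y| ≤ Real.posLog (1 / |x - y|) + (logWeight x + logWeight y) := by
  rw [logKernel_eq]
  have h1 := posLog_abs_sub_le x y
  have h2 : 0 ≤ Real.posLog (1 / |x - y|) := Real.posLog_nonneg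
  have h3 : 0 ≤ Real.posLog |x - y| := Real.posLog_nonneg
  rw [abs_le]; constructor <;> linarith

/-- Densities for which the logarithmic energy converges absolutely. -/
structure LogAdmissible (μ : Measure ℝ) (F : ℝ → ℝ) : Prop where
  memLp : MemLp F 2 μ
  integrable : Integrable (fun y => logWeight y * F y) μ

theorem LogAdmissible.mono {μ : Measure ℝ} {F H : ℝ → ℝ} (hH : LogAdmissible μ H)
    (hF : AEStronglyMeasurable F μ) (h : ∀ᵐ x ∂μ, |F x| ≤ |H x|) : LogAdmissible μ F := by
  refine ⟨hH.memLp.mono hF h, hH.integrable.mono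
    (measurable_logWeight.aestronglyMeasurable.mul hF) ?_⟩
  filter_upwards [h] with x hx
  rw [norm_mul, norm_mul]
  exact mul_le_mul_of_nonneg_left hx (norm_nonneg _)

theorem LogAdmissible.add {μ : Measure ℝ} {F H : ℝ → ℝ} (hF : LogAdmissible μ F)
    (hH : LogAdmissible μ H) : LogAdmissible μ (fun x => F x + H x) := by
  refine ⟨hF.memLp.add hH.memLp, ?_⟩
  simp_rw [mul_add]
  exact hF.integrable.add hH.integrable

theorem LogAdmissible.const_mul {μ : Measure ℝ} {F : ℝ → ℝ} (hF : LogAdmissible μ F) (c : ℝ) :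
    LogAdmissible μ (fun x => c * F x) := by
  refine ⟨hF.memLp.const_mul c, ?_⟩
  simp_rw [mul_left_comm]
  exact hF.integrable.const_mul c

theorem LogAdmissible.abs {μ : Measure ℝ} {F : ℝ → ℝ} (hF : LogAdmissible μ F) :
    LogAdmissible μ (fun x => |F x|) :=
  hF.mono hF.memLp.aestronglyMeasurable.norm (ae_of_all _ fun x => by simp)

/-- The singular part of the kernel is in `L²` uniformly in `x` and is paired with `F ∈ L²` by `ab ≤
a² + b²`; the far part is controlled by the weighted integral of `F`. Constants are absorbed using
`logWeight ≥ log 2`. -/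
theorem LogAdmissible.exists_potential_le {S : Set ℝ} {F : ℝ → ℝ}
    (hF : LogAdmissible (volume.restrict S) F) :
    ∃ C : ℝ, 0 ≤ C ∧ ∀ x, ∫⁻ y in S, ENNReal.ofReal (|logKernel x y| * |F y|)
      ≤ ENNReal.ofReal (C * logWeight x) := by
  have hlog : 0 < Real.log 2 := Real.log_pos (by norm_num)
  set κ : ℝ := (∫⁻ s : ℝ, ENNReal.ofReal (Real.posLog (1 / |s|) ^ 2)).toReal
  have hκ : ∫⁻ s : ℝ, ENNReal.ofReal (Real.posLog (1 / |s|) ^ 2) = ENNReal.ofReal κ :=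
    (ENNReal.ofReal_toReal lintegral_posLog_sq_lt_top.ne).symm
  have hκ0 : 0 ≤ κ := ENNReal.toReal_nonneg
  set A : ℝ := ∫ y in S, F y ^ 2
  have hA : ∫⁻ y in S, ENNReal.ofReal (F y ^ 2) = ENNReal.ofReal A :=
    (ofReal_integral_eq_lintegral_ofReal hF.memLp.integrable_sq
      (ae_of_all _ fun y => sq_nonneg _)).symm
  have hA0 : 0 ≤ A := integral_nonneg fun y => sq_nonneg _
  set N : ℝ := ∫ y in S, |logWeight y * F y|
  have hN : ∫⁻ y in S, ENNReal.ofReal |logWeight y * F y| = ENNReal.ofReal N :=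
    (ofReal_integral_eq_lintegral_ofReal hF.integrable.abs
      (ae_of_all _ fun y => abs_nonneg _)).symm
  have hN0 : 0 ≤ N := integral_nonneg fun y => abs_nonneg _
  refine ⟨(κ + A + N) / Real.log 2 + N / Real.log 2, by positivity, fun x => ?_⟩
  have hlx := logWeight_pos x
  have hpt : ∀ y, ENNReal.ofReal (|logKernel x y| * |F y|)
      ≤ ENNReal.ofReal (Real.posLog (1 / |x - y|) ^ 2) + (ENNReal.ofReal (F y ^ 2)
        + ENNReal.ofReal (logWeight x / Real.log 2 + 1) * ENNReal.ofReal |logWeight y * F y|) := by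
    intro y
    rw [← ENNReal.ofReal_mul (by positivity), ← ENNReal.ofReal_add (by positivity) (by positivity),
      ← ENNReal.ofReal_add (by positivity) (by positivity)]
    apply ENNReal.ofReal_le_ofReal
    have hly := log_two_le_logWeight y
    have hly0 := logWeight_pos y
    have h1 := mul_le_mul_of_nonneg_right (abs_logKernel_le x y) (abs_nonneg (F y))
    rw [abs_mul, abs_of_pos hly0]
    have h2 : Real.posLog (1 / |x - y|) * |F y| ≤ Real.posLog (1 / |x - y|) ^ 2 + F y ^ 2 := by
      rw [← sq_abs (F y)]
      nlinarith [sq_nonneg (Real.posLog (1 / |x - y|) - |F y|), sq_nonneg |F y|,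
        sq_nonneg (Real.posLog (1 / |x - y|))]
    have h3 : logWeight x * |F y| ≤ logWeight x / Real.log 2 * (logWeight y * |F y|) := by
      rw [div_mul_eq_mul_div, le_div_iff₀ hlog]
      have := mul_le_mul_of_nonneg_left hly (mul_nonneg hlx.le (abs_nonneg (F y)))
      nlinarith
    nlinarith
  have hm1 : Measurable fun y : ℝ => ENNReal.ofReal (Real.posLog (1 / |x - y|) ^ 2) := by
    simp only [Real.posLog_apply]
    fun_prop
  have hm2 : AEMeasurable (fun y => ENNReal.ofReal (F y ^ 2)) (volume.restrict S) :=
    (hF.memLp.aestronglyMeasurable.aemeasurable.pow_const 2).ennreal_ofReal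
  refine (lintegral_mono hpt).trans ?_
  rw [lintegral_add_left hm1, lintegral_add_left' hm2,
    lintegral_const_mul' _ _ ENNReal.ofReal_ne_top, hA, hN]
  have hk : ∫⁻ y in S, ENNReal.ofReal (Real.posLog (1 / |x - y|) ^ 2) ≤ ENNReal.ofReal κ := by
    refine (setLIntegral_le_lintegral _ _).trans (le_of_eq ?_)
    rw [lintegral_sub_left_eq_self (fun s : ℝ => ENNReal.ofReal (Real.posLog (1 / |s|) ^ 2)) x, hκ]
  refine (add_le_add_left hk _).trans ?_
  rw [← ENNReal.ofReal_mul (by positivity), ← ENNReal.ofReal_add (by positivity) (by positivity),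
    ← ENNReal.ofReal_add (by positivity) (by positivity)]
  apply ENNReal.ofReal_le_ofReal
  have h5 := log_two_le_logWeight x
  have h6 : 1 ≤ logWeight x / Real.log 2 := by rwa [le_div_iff₀ hlog, one_mul]
  have h7 : ((κ + A + N) / Real.log 2 + N / Real.log 2) * logWeight x
      = (κ + A + N) * (logWeight x / Real.log 2) + N * (logWeight x / Real.log 2) := by ring
  rw [h7]
  nlinarith [mul_le_mul_of_nonneg_left h6 (by positivity : 0 ≤ κ + A + N)]

/-- The potential of `|H|` grows at most like `logWeight`, against which `F` is integrable. -/
theorem LogAdmissible.integrable_prod {S : Set ℝ} {F H : ℝ → ℝ}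
    (hF : LogAdmissible (volume.restrict S) F) (hH : LogAdmissible (volume.restrict S) H) :
    Integrable (fun p : ℝ × ℝ => logKernel p.1 p.2 * F p.1 * H p.2)
      ((volume.restrict S).prod (volume.restrict S)) := by
  have hm : AEStronglyMeasurable (fun p : ℝ × ℝ => logKernel p.1 p.2 * F p.1 * H p.2)
      ((volume.restrict S).prod (volume.restrict S)) :=
    (measurable_logKernel.aestronglyMeasurable.mul hF.memLp.aestronglyMeasurable.comp_fst).mul
      hH.memLp.aestronglyMeasurable.comp_snd
  refine ⟨hm, ?_⟩
  obtain ⟨C, hC0, hC⟩ := hH.exists_potential_le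
  rw [hasFiniteIntegral_iff_norm, lintegral_prod _ hm.norm.aemeasurable.ennreal_ofReal]
  have hle : ∀ x, ∫⁻ y in S, ENNReal.ofReal ‖logKernel x y * F x * H y‖
      ≤ ENNReal.ofReal (C * |logWeight x * F x|) := by
    intro x
    have e : ∀ y, ENNReal.ofReal ‖logKernel x y * F x * H y‖
        = ENNReal.ofReal |F x| * ENNReal.ofReal (|logKernel x y| * |H y|) := by
      intro y
      rw [← ENNReal.ofReal_mul (abs_nonneg _), Real.norm_eq_abs, abs_mul, abs_mul]
      congr 1; ring
    simp_rw [e]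
    rw [lintegral_const_mul' _ _ ENNReal.ofReal_ne_top]
    refine (mul_le_mul_right (hC x) _).trans (le_of_eq ?_)
    rw [← ENNReal.ofReal_mul (abs_nonneg _), abs_mul, abs_of_pos (logWeight_pos x)]
    congr 1; ring
  refine lt_of_le_of_lt (lintegral_mono hle) ?_
  have hi := (hF.integrable.abs.const_mul C).hasFiniteIntegral
  rwa [hasFiniteIntegral_iff_ofReal (ae_of_all _ fun x => by positivity)] at hi

/-- The bilinear form of the logarithmic energy. -/
def logForm (S : Set ℝ) (F H : ℝ → ℝ) : ℝ :=
  ∫ p : ℝ × ℝ, logKernel p.1 p.2 * F p.1 * H p.2 ∂((volume.restrict S).prod (volume.restrict S))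

theorem logForm_comm (S : Set ℝ) (F H : ℝ → ℝ) : logForm S F H = logForm S H F := by
  unfold logForm
  rw [← integral_prod_swap]
  refine integral_congr_ae (ae_of_all _ fun p => ?_)
  simp only [Prod.fst_swap, Prod.snd_swap]
  rw [logKernel_comm]; ring

theorem logForm_add_right {S : Set ℝ} {F H H' : ℝ → ℝ} (hF : LogAdmissible (volume.restrict S) F)
    (hH : LogAdmissible (volume.restrict S) H) (hH' : LogAdmissible (volume.restrict S) H') :
    logForm S F (fun x => H x + H' x) = logForm S F H + logForm S F H' := by
  unfold logForm
  rw [← integral_add (hF.integrable_prod hH) (hF.integrable_prod hH')]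
  refine integral_congr_ae (ae_of_all _ fun p => ?_)
  simp only; ring

theorem logForm_const_mul_right (S : Set ℝ) (F H : ℝ → ℝ) (c : ℝ) :
    logForm S F (fun x => c * H x) = c * logForm S F H := by
  unfold logForm
  rw [← integral_const_mul]
  refine integral_congr_ae (ae_of_all _ fun p => ?_)
  simp only; ring

theorem logForm_add_self {S : Set ℝ} {F H : ℝ → ℝ} (hF : LogAdmissible (volume.restrict S) F)
    (hH : LogAdmissible (volume.restrict S) H) :
    logForm S (fun x => F x + H x) (fun x => F x + H x)
      = logForm S F F + 2 * logForm S F H + logForm S H H := by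
  rw [logForm_add_right (hF.add hH) hF hH, logForm_comm S _ F, logForm_comm S _ H,
    logForm_add_right hF hF hH, logForm_add_right hH hF hH, logForm_comm S H F]
  ring

theorem LogAdmissible.potential_integrable {S : Set ℝ} {F : ℝ → ℝ}
    (hF : LogAdmissible (volume.restrict S) F) (x : ℝ) :
    IntegrableOn (fun y => logKernel x y * F y) S := by
  obtain ⟨C, -, hC⟩ := hF.exists_potential_le
  have hk : Measurable fun y => logKernel x y := measurable_logKernel.comp measurable_prodMk_left
  refine ⟨hk.aestronglyMeasurable.mul hF.memLp.aestronglyMeasurable, ?_⟩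
  rw [hasFiniteIntegral_iff_norm]
  refine lt_of_le_of_lt ?_ (lt_of_le_of_lt (hC x) ENNReal.ofReal_lt_top)
  refine lintegral_mono fun y => ENNReal.ofReal_le_ofReal ?_
  rw [norm_mul]; rfl

theorem LogAdmissible.integrable_potential_mul {S : Set ℝ} {F H : ℝ → ℝ}
    (hF : LogAdmissible (volume.restrict S) F) (hH : LogAdmissible (volume.restrict S) H) :
    IntegrableOn (fun x => (∫ y in S, logKernel x y * F y) * H x) S := by
  refine (hH.integrable_prod hF).integral_prod_left.congr (ae_of_all _ fun x => ?_)
  simp only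
  rw [← integral_mul_const]
  exact integral_congr_ae (ae_of_all _ fun y => by simp only; ring)

theorem logForm_eq_integral_potential {S : Set ℝ} {F H : ℝ → ℝ}
    (hF : LogAdmissible (volume.restrict S) F) (hH : LogAdmissible (volume.restrict S) H) :
    logForm S F H = ∫ x in S, (∫ y in S, logKernel x y * F y) * H x := by
  rw [logForm_comm, logForm, integral_prod _ (hH.integrable_prod hF)]
  refine integral_congr_ae (ae_of_all _ fun x => ?_)
  simp only
  rw [← integral_mul_const]
  exact integral_congr_ae (ae_of_all _ fun y => by simp only; ring)

/-- `ENNReal.ofReal` truncates at 0, which identifies `energyPos` and `energyNeg` with the positive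
and negative parts of one integrand. -/
theorem ofReal_log_mul {r a : ℝ} (ha : 0 ≤ a) :
    ENNReal.ofReal (Real.log r * a) = ENNReal.ofReal (Real.posLog r * a) := by
  rw [Real.posLog_apply]
  rcases le_total 0 (Real.log r) with h | h
  · rw [max_eq_right h]
  · rw [max_eq_left h, ENNReal.ofReal_of_nonpos (mul_nonpos_of_nonpos_of_nonneg h ha)]
    simp

/-- The energy is given by the bilinear form on admissible densities. -/
theorem energy_eq_logForm {S : Set ℝ} {G w : ℝ → ℝ} (hG : ∀ t, 0 ≤ G t)
    (hw : LogAdmissible (volume.restrict S) fun x => G (w x)) :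
    energy S G w = ((logForm S (fun x => G (w x)) (fun x => G (w x)) : ℝ) : EReal) := by
  have hintg := hw.integrable_prod hw
  have hpos : energyPos S G w = ∫⁻ p : ℝ × ℝ,
      ENNReal.ofReal (logKernel p.1 p.2 * G (w p.1) * G (w p.2))
        ∂((volume.restrict S).prod (volume.restrict S)) := by
    rw [lintegral_prod _ hintg.aestronglyMeasurable.aemeasurable.ennreal_ofReal]
    refine lintegral_congr fun x => lintegral_congr fun y => ?_
    rw [mul_assoc, mul_assoc, logKernel, ofReal_log_mul (mul_nonneg (hG _) (hG _))]
  have hneg : energyNeg S G w = ∫⁻ p : ℝ × ℝ,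
      ENNReal.ofReal (-(logKernel p.1 p.2 * G (w p.1) * G (w p.2)))
        ∂((volume.restrict S).prod (volume.restrict S)) := by
    have hm : AEMeasurable (fun p : ℝ × ℝ =>
        ENNReal.ofReal (-(logKernel p.1 p.2 * G (w p.1) * G (w p.2))))
        ((volume.restrict S).prod (volume.restrict S)) :=
      hintg.neg.aestronglyMeasurable.aemeasurable.ennreal_ofReal
    rw [lintegral_prod _ hm]
    refine lintegral_congr fun x => lintegral_congr fun y => ?_
    have : -(logKernel x y * G (w x) * G (w y)) = Real.log |x - y| * (G (w x) * G (w y)) := by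
      rw [logKernel, one_div, Real.log_inv]; ring
    rw [this, ofReal_log_mul (mul_nonneg (hG _) (hG _)), mul_assoc]
  have h1 : energyPos S G w ≠ ∞ := by
    rw [hpos]
    refine ne_top_of_le_ne_top (hasFiniteIntegral_iff_norm _ |>.1 hintg.hasFiniteIntegral).ne ?_
    exact lintegral_mono fun p => ENNReal.ofReal_le_ofReal (le_abs_self _)
  have h2 : energyNeg S G w ≠ ∞ := by
    rw [hneg]
    refine ne_top_of_le_ne_top (hasFiniteIntegral_iff_norm _ |>.1 hintg.hasFiniteIntegral).ne ?_
    exact lintegral_mono fun p => ENNReal.ofReal_le_ofReal (neg_le_abs _)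
  rw [energy, ← EReal.coe_ennreal_toReal h1, ← EReal.coe_ennreal_toReal h2, ← EReal.coe_sub,
    logForm, integral_eq_lintegral_pos_part_sub_lintegral_neg_part hintg, hpos, hneg]

theorem tendsto_logForm {ι : Type*} {l : Filter ι} [l.IsCountablyGenerated] {S : Set ℝ}
    {F M : ℝ → ℝ} {H : ι → ℝ → ℝ} {H₀ : ℝ → ℝ} (hF : LogAdmissible (volume.restrict S) F)
    (hM : LogAdmissible (volume.restrict S) M)
    (hm : ∀ᶠ i in l, AEStronglyMeasurable (H i) (volume.restrict S))
    (hle : ∀ᶠ i in l, ∀ x, |H i x| ≤ M x) (hlim : ∀ x, Tendsto (fun i => H i x) l (𝓝 (H₀ x))) :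
    Tendsto (fun i => logForm S F (H i)) l (𝓝 (logForm S F H₀)) := by
  refine tendsto_integral_filter_of_dominated_convergence
    (fun p => |logKernel p.1 p.2 * F p.1 * M p.2|) ?_ ?_ (hF.integrable_prod hM).abs ?_
  · filter_upwards [hm] with i hi
    exact (measurable_logKernel.aestronglyMeasurable.mul
      hF.memLp.aestronglyMeasurable.comp_fst).mul hi.comp_snd
  · filter_upwards [hle] with i hi
    refine ae_of_all _ fun p => ?_
    rw [norm_mul, abs_mul _ (M p.2)]
    exact mul_le_mul_of_nonneg_left ((hi p.2).trans (le_abs_self _)) (norm_nonneg _)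
  · exact ae_of_all _ fun p => (hlim p.2).const_mul _

theorem tendsto_logForm_self {ι : Type*} {l : Filter ι} [l.IsCountablyGenerated] {S : Set ℝ}
    {M : ℝ → ℝ} {H : ι → ℝ → ℝ} {H₀ : ℝ → ℝ}
    (hM : LogAdmissible (volume.restrict S) M)
    (hm : ∀ᶠ i in l, AEStronglyMeasurable (H i) (volume.restrict S))
    (hle : ∀ᶠ i in l, ∀ x, |H i x| ≤ M x) (hlim : ∀ x, Tendsto (fun i => H i x) l (𝓝 (H₀ x))) :
    Tendsto (fun i => logForm S (H i) (H i)) l (𝓝 (logForm S H₀ H₀)) := by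
  refine tendsto_integral_filter_of_dominated_convergence
    (fun p => |logKernel p.1 p.2 * M p.1 * M p.2|) ?_ ?_ (hM.integrable_prod hM).abs ?_
  · filter_upwards [hm] with i hi
    exact (measurable_logKernel.aestronglyMeasurable.mul hi.comp_fst).mul hi.comp_snd
  · filter_upwards [hle] with i hi
    refine ae_of_all _ fun p => ?_
    rw [norm_mul, norm_mul, abs_mul, abs_mul]
    refine mul_le_mul (mul_le_mul_of_nonneg_left ((hi p.1).trans (le_abs_self _)) (norm_nonneg _))
      ((hi p.2).trans (le_abs_self _)) (norm_nonneg _) (by positivity)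
  · exact ae_of_all _ fun p => ((hlim p.1).const_mul _).mul (hlim p.2)

theorem logAdmissible_of_bounded_support {μ : Measure ℝ} (hμ : μ ≤ volume) {F : ℝ → ℝ} {R : ℝ}
    (hF : MemLp F 2 μ) (h0 : ∀ᵐ x ∂μ, R < |x| → F x = 0) : LogAdmissible μ F := by
  refine ⟨hF, ?_⟩
  have hfin : μ (Icc (-R) R) < ∞ := lt_of_le_of_lt (hμ _) measure_Icc_lt_top
  have h1 : Integrable ((Icc (-R) R).indicator fun _ => (1 : ℝ)) μ :=
    (integrable_indicator_iff measurableSet_Icc).2 (integrableOn_const hfin.ne)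
  refine ((h1.add hF.integrable_sq).const_mul (logWeight R)).mono'
    (measurable_logWeight.aestronglyMeasurable.mul hF.aestronglyMeasurable) ?_
  filter_upwards [h0] with x hx
  have hR := logWeight_pos R
  simp only [Pi.add_apply]
  by_cases hxR : R < |x|
  · rw [hx hxR]
    have : 0 ≤ (Icc (-R) R).indicator (fun _ => (1 : ℝ)) x :=
      indicator_nonneg (fun _ _ => zero_le_one) x
    simp only [mul_zero, norm_zero]
    positivity
  · have hxR' : |x| ≤ R := not_lt.1 hxR
    rw [indicator_of_mem (mem_Icc.2 (abs_le.1 hxR')), norm_mul, Real.norm_eq_abs, Real.norm_eq_abs,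
      abs_of_pos (logWeight_pos x)]
    refine mul_le_mul ?_ ?_ (abs_nonneg _) hR.le
    · refine Real.log_le_log (by positivity) ?_
      linarith [le_abs_self R]
    · rw [← sq_abs (F x)]
      nlinarith [sq_nonneg (|F x| - 1), abs_nonneg (F x)]

/-- Functions with bounded support and exponential growth in a function of `H^{1/2}(ℝ)` are
admissible. -/
theorem MemHHalf.logAdmissible_of_le_exp {P : ℝ → ℝ} (hP : MemHHalf P) {S : Set ℝ} {F : ℝ → ℝ}
    {C β R : ℝ} (hβ : 0 ≤ β) (hF : AEStronglyMeasurable F (volume.restrict S))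
    (hle : ∀ x, |F x| ≤ C * Real.exp (β * P x ^ 2))
    (h0 : ∀ᵐ x ∂(volume.restrict S), R < |x| → F x = 0) :
    LogAdmissible (volume.restrict S) F := by
  refine logAdmissible_of_bounded_support Measure.restrict_le_self ⟨hF, ?_⟩ h0
  have h2 : eLpNorm F 2 (volume.restrict S) ^ 2 < ∞ := by
    rw [eLpNorm_two_sq]
    have hB : volume (Icc (-R) R) < ∞ := measure_Icc_lt_top
    have hexp := hP.setLIntegral_exp_lt_top (β := 2 * β) (by positivity) hB
    calc ∫⁻ x in S, ‖F x‖ₑ ^ 2 ≤ ∫⁻ x in S, (Icc (-R) R).indicator (fun x =>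
          ENNReal.ofReal (C ^ 2) * ENNReal.ofReal (Real.exp (2 * β * P x ^ 2))) x := by
          refine lintegral_mono_ae ?_
          filter_upwards [h0] with x hx
          by_cases hxR : R < |x|
          · rw [hx hxR]; simp
          · rw [indicator_of_mem (mem_Icc.2 (abs_le.1 (not_lt.1 hxR))), ← ofReal_norm,
              ← ENNReal.ofReal_pow (norm_nonneg _), ← ENNReal.ofReal_mul (by positivity)]
            apply ENNReal.ofReal_le_ofReal
            have := pow_le_pow_left₀ (abs_nonneg _) (hle x) 2
            rw [mul_pow, ← Real.exp_nat_mul] at this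
            rw [Real.norm_eq_abs]
            refine this.trans (le_of_eq ?_)
            push_cast; ring_nf
      _ ≤ ∫⁻ x, (Icc (-R) R).indicator (fun x =>
          ENNReal.ofReal (C ^ 2) * ENNReal.ofReal (Real.exp (2 * β * P x ^ 2))) x :=
          setLIntegral_le_lintegral _ _
      _ < ∞ := by
          rw [lintegral_indicator measurableSet_Icc,
            lintegral_const_mul' _ _ ENNReal.ofReal_ne_top]
          exact ENNReal.mul_lt_top ENNReal.ofReal_lt_top hexp
  by_contra hcon
  rw [not_lt, top_le_iff] at hcon
  rw [hcon] at h2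
  simp at h2

/-! ### The nonlinearity -/

/-- `G` is continuously differentiable, satisfies (A), and its derivative is bounded by
`c exp (α t²)`. -/
structure GrowthBound (G : ℝ → ℝ) (c α : ℝ) : Prop where
  contDiff : ContDiff ℝ 1 G
  condA : CondA G
  c_pos : 0 < c
  α_pos : 0 < α
  abs_deriv_le : ∀ t, |deriv G t| ≤ c * Real.exp (α * t ^ 2)

theorem CondA.deriv_neg {G : ℝ → ℝ} (hA : CondA G) (t : ℝ) : deriv G (-t) = -deriv G t := by
  have h1 : (fun s => G (-s)) = G := funext hA.even
  have h2 := deriv_comp_neg G t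
  rw [h1] at h2
  linarith

theorem CondA.deriv_zero {G : ℝ → ℝ} (hA : CondA G) : deriv G 0 = 0 := by
  have := hA.deriv_neg 0
  rw [neg_zero] at this
  linarith

/-- The derivative of an even function is odd, so the one-sided bound is two-sided. -/
theorem growthBound_of_deriv_le {G : ℝ → ℝ} (hG : ContDiff ℝ 1 G) (hA : CondA G) {c α : ℝ}
    (hc : 0 < c) (hα : 0 < α) (h : ∀ t, deriv G t ≤ c * Real.exp (α * t ^ 2)) :
    GrowthBound G c α := by
  refine ⟨hG, hA, hc, hα, fun t => abs_le.2 ⟨?_, h t⟩⟩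
  have := h (-t)
  rw [hA.deriv_neg, neg_sq] at this
  linarith

theorem CondA.deriv_nonneg {G : ℝ → ℝ} (hA : CondA G) {t : ℝ} (ht : 0 ≤ t) : 0 ≤ deriv G t := by
  rcases ht.eq_or_lt with rfl | ht
  · exact hA.deriv_zero.ge
  · have h := (hA.strictMonoOn.monotoneOn).derivWithin_nonneg (x := t)
    rwa [derivWithin_of_mem_nhds (Ici_mem_nhds ht)] at h

theorem GrowthBound.differentiable {G : ℝ → ℝ} {c α : ℝ} (hG : GrowthBound G c α) :
    Differentiable ℝ G := hG.contDiff.differentiable (by norm_num)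

theorem GrowthBound.continuous_deriv {G : ℝ → ℝ} {c α : ℝ} (hG : GrowthBound G c α) :
    Continuous (deriv G) := hG.contDiff.continuous_deriv (by norm_num)

/-- On an interval of critical points `G` would be constant, against strict monotonicity; negative
points are reflected. -/
theorem GrowthBound.interior_critical {G : ℝ → ℝ} {c α : ℝ} (hG : GrowthBound G c α) :
    interior {t | deriv G t = 0} = ∅ := by
  rw [eq_empty_iff_forall_notMem]
  intro t ht
  obtain ⟨ε, hε, hball⟩ := Metric.isOpen_iff.1 isOpen_interior t ht
  have hZ : ∀ s, |s - t| < ε → deriv G s = 0 := fun s hs => by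
    have hs' : s ∈ {t | deriv G t = 0} :=
      interior_subset (hball (by rwa [Metric.mem_ball, Real.dist_eq]))
    exact hs'
  have key : ∀ a b, a < b → |a - t| < ε → |b - t| < ε → G a = G b := by
    intro a b hab ha hb
    obtain ⟨s, hs, hs'⟩ := exists_deriv_eq_slope G hab hG.differentiable.continuous.continuousOn
      hG.differentiable.differentiableOn
    rw [hZ s] at hs'
    · have : b - a ≠ 0 := by linarith
      field_simp at hs'
      linarith
    · rw [abs_lt] at ha hb ⊢
      constructor <;> linarith [hs.1, hs.2]
  rcases le_or_gt 0 t with h0 | h0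
  · have h1 := key t (t + ε / 2) (by linarith) (by simpa) (by
      rw [add_sub_cancel_left, abs_of_pos (by positivity)]; linarith)
    have h2 := hG.condA.strictMonoOn (mem_Ici.2 h0) (mem_Ici.2 (by linarith : 0 ≤ t + ε / 2))
      (by linarith)
    linarith
  · have h1 := key (t - ε / 2) t (by linarith) (by
      rw [sub_sub_cancel_left, abs_neg, abs_of_pos (by positivity)]; linarith) (by simpa)
    have h2 := hG.condA.strictMonoOn (mem_Ici.2 (by linarith : 0 ≤ -t))
      (mem_Ici.2 (by linarith : 0 ≤ -(t - ε / 2))) (by linarith)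
    rw [hG.condA.even, hG.condA.even] at h2
    linarith

theorem GrowthBound.isClosed_critical {G : ℝ → ℝ} {c α : ℝ} (hG : GrowthBound G c α) :
    IsClosed {t | deriv G t = 0} := isClosed_eq hG.continuous_deriv continuous_const

theorem GrowthBound.abs_sub_le {G : ℝ → ℝ} {c α : ℝ} (hG : GrowthBound G c α) {a b P : ℝ}
    (ha : |a| ≤ P) (hb : |b| ≤ P) : |G a - G b| ≤ c * Real.exp (α * P ^ 2) * |a - b| := by
  have h := Convex.norm_image_sub_le_of_norm_deriv_le (f := G) (s := Icc (-P) P) (x := b) (y := a)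
    (C := c * Real.exp (α * P ^ 2)) (fun x _ => hG.differentiable x) ?_ (convex_Icc _ _)
    (mem_Icc.2 (abs_le.1 hb)) (mem_Icc.2 (abs_le.1 ha))
  · exact h
  · intro x hx
    refine (hG.abs_deriv_le x).trans ?_
    have : x ^ 2 ≤ P ^ 2 := sq_le_sq' hx.1 hx.2
    have h1 := hG.c_pos
    have h2 := hG.α_pos
    gcongr

/-! ### Variations of the energy -/

/-- The increment `G (u + t φ + t² ψ) - G u`. -/
def increment (G u φ ψ : ℝ → ℝ) (t x : ℝ) : ℝ := G (u x + (t * φ x + t ^ 2 * ψ x)) - G (u x)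

/-- A bound for the difference quotients of the increment. -/
def majorant (c α : ℝ) (u φ ψ : ℝ → ℝ) (x : ℝ) : ℝ :=
  (|φ x| + |ψ x|) * (c * Real.exp (α * (|u x| + |φ x| + |ψ x|) ^ 2))

theorem GrowthBound.abs_increment_le {G : ℝ → ℝ} {c α : ℝ} (hG : GrowthBound G c α)
    (u φ ψ : ℝ → ℝ) {t : ℝ} (ht : |t| ≤ 1) (x : ℝ) :
    |increment G u φ ψ t x| ≤ |t| * majorant c α u φ ψ x := by
  have hd : |t * φ x + t ^ 2 * ψ x| ≤ |t| * (|φ x| + |ψ x|) := by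
    refine (abs_add_le _ _).trans ?_
    rw [abs_mul, abs_mul, abs_pow, mul_add]
    gcongr
    rw [sq]
    exact mul_le_of_le_one_left (abs_nonneg t) ht
  have hd' : |t * φ x + t ^ 2 * ψ x| ≤ |φ x| + |ψ x| :=
    hd.trans (mul_le_of_le_one_left (by positivity) ht)
  have h := hG.abs_sub_le (a := u x + (t * φ x + t ^ 2 * ψ x)) (b := u x)
    (P := |u x| + |φ x| + |ψ x|) (by have := abs_add_le (u x) (t * φ x + t ^ 2 * ψ x); linarith)
    (by linarith [abs_nonneg (φ x), abs_nonneg (ψ x)])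
  refine h.trans ?_
  rw [add_sub_cancel_left, majorant]
  have hc := hG.c_pos
  calc c * Real.exp (α * (|u x| + |φ x| + |ψ x|) ^ 2) * |t * φ x + t ^ 2 * ψ x|
      ≤ c * Real.exp (α * (|u x| + |φ x| + |ψ x|) ^ 2) * (|t| * (|φ x| + |ψ x|)) := by gcongr
    _ = _ := by ring

theorem GrowthBound.tendsto_increment_div {G : ℝ → ℝ} {c α : ℝ} (hG : GrowthBound G c α)
    (u φ ψ : ℝ → ℝ) (x : ℝ) :
    Tendsto (fun t => t⁻¹ * increment G u φ ψ t x) (𝓝[≠] 0) (𝓝 (deriv G (u x) * φ x)) := by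
  have hin : HasDerivAt (fun t : ℝ => u x + (t * φ x + t ^ 2 * ψ x)) (φ x) 0 := by
    have h1 : HasDerivAt (fun t : ℝ => t * φ x) (φ x) 0 := by
      simpa using (hasDerivAt_id (0 : ℝ)).mul_const (φ x)
    have h2 : HasDerivAt (fun t : ℝ => t ^ 2 * ψ x) 0 0 := by
      simpa using (hasDerivAt_pow 2 (0 : ℝ)).mul_const (ψ x)
    simpa using (h1.add h2).const_add (u x)
  have hG' : HasDerivAt G (deriv G (u x)) (u x + (0 * φ x + 0 ^ 2 * ψ x)) := by
    simpa using (hG.differentiable (u x)).hasDerivAt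
  have h := (HasDerivAt.comp (0 : ℝ) hG' hin).tendsto_slope
  refine h.congr fun t => ?_
  simp [slope, increment]

/-- The test functions of the variational problem on `S`. -/
structure IsTest (S : Set ℝ) (φ : ℝ → ℝ) : Prop where
  memHHalf : MemHHalf φ
  bounded : HasBoundedSupport φ
  vanish : ∀ᵐ x : ℝ, x ∉ S → φ x = 0

theorem IsTest.comb {S : Set ℝ} {φ ψ : ℝ → ℝ} (hφ : IsTest S φ) (hψ : IsTest S ψ) (a b : ℝ) :
    IsTest S (fun x => a * φ x + b * ψ x) := by
  refine ⟨(hφ.memHHalf.const_mul a).add (hψ.memHHalf.const_mul b), ?_, ?_⟩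
  · obtain ⟨R, hR⟩ := hφ.bounded
    obtain ⟨R', hR'⟩ := hψ.bounded
    refine ⟨max R R', ?_⟩
    filter_upwards [hR, hR'] with x h1 h2 h3
    rw [h1 (lt_of_le_of_lt (le_max_left _ _) h3), h2 (lt_of_le_of_lt (le_max_right _ _) h3)]
    ring
  · filter_upwards [hφ.vanish, hψ.vanish] with x h1 h2 h3
    rw [h1 h3, h2 h3]; ring

theorem GrowthBound.aestronglyMeasurable_increment {G : ℝ → ℝ} {c α : ℝ} (hG : GrowthBound G c α)
    {S : Set ℝ} {u φ ψ : ℝ → ℝ} (hu : MemHHalf u) (hφ : MemHHalf φ) (hψ : MemHHalf ψ) (t : ℝ) :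
    AEStronglyMeasurable (increment G u φ ψ t) (volume.restrict S) := by
  have hc := hG.differentiable.continuous
  have h1 := hu.1.aestronglyMeasurable
  have h2 := h1.add ((hφ.1.aestronglyMeasurable.const_mul t).add
    (hψ.1.aestronglyMeasurable.const_mul (t ^ 2)))
  exact ((hc.comp_aestronglyMeasurable h2).sub (hc.comp_aestronglyMeasurable h1)).restrict

theorem GrowthBound.logAdmissible_majorant {G : ℝ → ℝ} {c α : ℝ} (hG : GrowthBound G c α)
    {S : Set ℝ} {u φ ψ : ℝ → ℝ} (hu : MemHHalf u) (hφ : IsTest S φ) (hψ : IsTest S ψ) :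
    LogAdmissible (volume.restrict S) (majorant c α u φ ψ) := by
  have hc := hG.c_pos
  have hP : MemHHalf (fun x => |u x| + |φ x| + |ψ x|) :=
    (hu.abs.add hφ.memHHalf.abs).add hψ.memHHalf.abs
  obtain ⟨R, hR⟩ := hφ.bounded
  obtain ⟨R', hR'⟩ := hψ.bounded
  -- The extra 1 in the exponent absorbs the factor `|φ| + |ψ| ≤ exp (P²)`.
  refine hP.logAdmissible_of_le_exp (C := c) (β := 1 + α) (R := max R R')
    (by have := hG.α_pos; positivity) ?_ ?_ ?_
  · have h1 : AEMeasurable (fun x => |u x|) volume := hu.aemeasurable.norm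
    have h2 : AEMeasurable (fun x => |φ x|) volume := hφ.memHHalf.aemeasurable.norm
    have h3 : AEMeasurable (fun x => |ψ x|) volume := hψ.memHHalf.aemeasurable.norm
    refine AEMeasurable.aestronglyMeasurable (AEMeasurable.restrict ?_)
    exact (h2.add h3).mul ((((((h1.add h2).add h3).pow_const 2).const_mul α).exp).const_mul c)
  · intro x
    have hm : 0 ≤ majorant c α u φ ψ x := by unfold majorant; positivity
    rw [abs_of_nonneg hm, majorant]
    set P := |u x| + |φ x| + |ψ x| with hPdef
    have h1 : |φ x| + |ψ x| ≤ Real.exp (P ^ 2) := by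
      have h2 : |φ x| + |ψ x| ≤ P := by rw [hPdef]; linarith [abs_nonneg (u x)]
      have h3 := Real.add_one_le_exp (P ^ 2)
      nlinarith [sq_nonneg (P - 1), sq_nonneg P]
    calc (|φ x| + |ψ x|) * (c * Real.exp (α * P ^ 2))
        ≤ Real.exp (P ^ 2) * (c * Real.exp (α * P ^ 2)) := by gcongr
      _ = c * Real.exp ((1 + α) * P ^ 2) := by rw [add_mul, one_mul, Real.exp_add]; ring
  · refine ae_restrict_of_ae ?_
    filter_upwards [hR, hR'] with x h1 h2 h3
    rw [majorant, h1 (lt_of_le_of_lt (le_max_left _ _) h3),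
      h2 (lt_of_le_of_lt (le_max_right _ _) h3)]
    simp

theorem isTest_zero (S : Set ℝ) : IsTest S (fun _ => 0) :=
  ⟨memHHalf_zero, ⟨0, ae_of_all _ fun _ _ => rfl⟩, ae_of_all _ fun _ _ => rfl⟩

theorem GrowthBound.logAdmissible_deriv_mul {G : ℝ → ℝ} {c α : ℝ} (hG : GrowthBound G c α)
    {S : Set ℝ} {u φ : ℝ → ℝ} (hu : MemHHalf u) (hφ : IsTest S φ) :
    LogAdmissible (volume.restrict S) (fun x => deriv G (u x) * φ x) := by
  refine (hG.logAdmissible_majorant hu hφ (isTest_zero S)).mono ?_ (ae_of_all _ fun x => ?_)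
  · exact ((hG.continuous_deriv.comp_aestronglyMeasurable hu.1.aestronglyMeasurable).mul
      hφ.memHHalf.1.aestronglyMeasurable).restrict
  · refine le_trans ?_ (le_abs_self _)
    rw [abs_mul, mul_comm, majorant]
    simp only [abs_zero, add_zero]
    refine mul_le_mul_of_nonneg_left ((hG.abs_deriv_le (u x)).trans ?_) (abs_nonneg _)
    have h1 := hG.c_pos
    have h2 := hG.α_pos
    have h3 : u x ^ 2 ≤ (|u x| + |φ x|) ^ 2 := by
      rw [← sq_abs (u x)]
      exact pow_le_pow_left₀ (abs_nonneg _) (by linarith [abs_nonneg (φ x)]) 2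
    gcongr

/-- `u` is a maximizer of the energy under a quadratic constraint: `q₀ + 2 q φ + N φ` is the
value of the constraint at `u + φ`. -/
structure IsConstrainedMax (S : Set ℝ) (G u : ℝ → ℝ) (q N : (ℝ → ℝ) → ℝ) (q₀ : ℝ) : Prop where
  memHHalf : MemHHalf u
  vanish : ∀ᵐ x : ℝ, x ∉ S → u x = 0
  logAdmissible : LogAdmissible (volume.restrict S) fun x => G (u x)
  q_comb : ∀ φ ψ, IsTest S φ → IsTest S ψ → ∀ a b,
    q (fun x => a * φ x + b * ψ x) = a * q φ + b * q ψ
  N_comb : ∀ φ ψ, IsTest S φ → IsTest S ψ → ∀ a b,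
    N (fun x => a * φ x + b * ψ x) ≤ 2 * a ^ 2 * N φ + 2 * b ^ 2 * N ψ
  q₀_le : q₀ ≤ 1
  energy_le : ∀ φ, IsTest S φ → q₀ + 2 * q φ + N φ ≤ 1 →
    energy S G (fun x => u x + φ x) ≤ energy S G u

/-- The derivative of (half of) the energy at `u`. -/
def energyDeriv (S : Set ℝ) (G u φ : ℝ → ℝ) : ℝ :=
  logForm S (fun x => G (u x)) (fun x => deriv G (u x) * φ x)

section

variable {S : Set ℝ} {G u : ℝ → ℝ} {q N : (ℝ → ℝ) → ℝ} {q₀ c α : ℝ}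

/-- The energy is exactly quadratic in the density `G(u)`, so its change is these two terms without
remainder. -/
theorem IsConstrainedMax.variation_nonpos (h : IsConstrainedMax S G u q N q₀)
    (hG : GrowthBound G c α) {φ ψ : ℝ → ℝ} (hφ : IsTest S φ) (hψ : IsTest S ψ) {t : ℝ}
    (ht : |t| ≤ 1)
    (hq : q₀ + 2 * (t * q φ + t ^ 2 * q ψ) + (2 * t ^ 2 * N φ + 2 * (t ^ 2) ^ 2 * N ψ) ≤ 1) :
    2 * logForm S (fun x => G (u x)) (increment G u φ ψ t)
      + logForm S (increment G u φ ψ t) (increment G u φ ψ t) ≤ 0 := by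
  set δ := increment G u φ ψ t with hδ
  have hM := (hG.logAdmissible_majorant h.memHHalf hφ hψ).const_mul |t|
  have hδa : LogAdmissible (volume.restrict S) δ := by
    refine hM.mono (hG.aestronglyMeasurable_increment h.memHHalf hφ.memHHalf hψ.memHHalf t)
      (ae_of_all _ fun x => ?_)
    exact (hG.abs_increment_le u φ ψ ht x).trans (le_abs_self _)
  have hle := h.energy_le _ (hφ.comb hψ t (t ^ 2)) (by
    rw [h.q_comb φ ψ hφ hψ]
    have := h.N_comb φ ψ hφ hψ t (t ^ 2)
    linarith)
  have hw : (fun x => G (u x + (t * φ x + t ^ 2 * ψ x))) = fun x => G (u x) + δ x := by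
    ext x; simp [hδ, increment]
  have hwa := h.logAdmissible.add hδa
  rw [energy_eq_logForm hG.condA.nonneg (by rw [hw]; exact hwa),
    energy_eq_logForm hG.condA.nonneg h.logAdmissible, EReal.coe_le_coe_iff, hw,
    logForm_add_self h.logAdmissible hδa] at hle
  linarith

theorem tendsto_logForm_increment (hG : GrowthBound G c α) (hu : MemHHalf u)
    (hf : LogAdmissible (volume.restrict S) fun x => G (u x))
    {φ ψ : ℝ → ℝ} (hφ : IsTest S φ) (hψ : IsTest S ψ) :
    Tendsto (fun t => logForm S (fun x => G (u x)) (fun x => t⁻¹ * increment G u φ ψ t x)) (𝓝[≠] 0)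
        (𝓝 (energyDeriv S G u φ)) ∧
      Tendsto (fun t => logForm S (fun x => t⁻¹ * increment G u φ ψ t x)
        (fun x => t⁻¹ * increment G u φ ψ t x)) (𝓝[≠] 0)
        (𝓝 (logForm S (fun x => deriv G (u x) * φ x) (fun x => deriv G (u x) * φ x))) := by
  have hM := hG.logAdmissible_majorant hu hφ hψ
  have hm : ∀ᶠ t in 𝓝[≠] (0 : ℝ), AEStronglyMeasurable (fun x => t⁻¹ * increment G u φ ψ t x)
      (volume.restrict S) := Eventually.of_forall fun t =>
    (hG.aestronglyMeasurable_increment hu hφ.memHHalf hψ.memHHalf t).const_mul _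
  have hle : ∀ᶠ t in 𝓝[≠] (0 : ℝ), ∀ x, |t⁻¹ * increment G u φ ψ t x| ≤ majorant c α u φ ψ x := by
    have h1 : ∀ᶠ t in 𝓝[≠] (0 : ℝ), |t| ≤ 1 :=
      eventually_nhdsWithin_of_eventually_nhds
        (continuous_abs.tendsto' (0 : ℝ) 0 (by simp) |>.eventually_le_const one_pos)
    filter_upwards [h1, self_mem_nhdsWithin] with t ht ht0 x
    have ht0' : 0 < |t| := abs_pos.2 ht0
    rw [abs_mul, abs_inv, inv_mul_le_iff₀ ht0']
    exact hG.abs_increment_le u φ ψ ht x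
  exact ⟨tendsto_logForm hf hM hm hle (hG.tendsto_increment_div u φ ψ),
    tendsto_logForm_self hM hm hle (hG.tendsto_increment_div u φ ψ)⟩

theorem logForm_self_const_mul (S : Set ℝ) (F : ℝ → ℝ) (a : ℝ) :
    logForm S (fun x => a * F x) (fun x => a * F x) = a ^ 2 * logForm S F F := by
  rw [logForm_const_mul_right, logForm_comm, logForm_const_mul_right]; ring

/-- Divide the variation inequality by `t > 0` and let `t → 0`. The constraint holds for small `t`
either because it decreases to first order or because it has slack at `u`. -/
theorem IsConstrainedMax.energyDeriv_nonpos (h : IsConstrainedMax S G u q N q₀)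
    (hG : GrowthBound G c α) {φ : ℝ → ℝ} (hφ : IsTest S φ) (hq : q φ < 0 ∨ q₀ < 1) :
    energyDeriv S G u φ ≤ 0 := by
  have h0 := isTest_zero S
  obtain ⟨l1, l2⟩ := tendsto_logForm_increment hG h.memHHalf h.logAdmissible hφ h0
  have hid : Tendsto (fun t : ℝ => t) (𝓝[>] 0) (𝓝 0) := nhdsWithin_le_nhds
  have hsub : 𝓝[>] (0 : ℝ) ≤ 𝓝[≠] 0 := nhdsWithin_mono _ fun x hx => (ne_of_gt hx)
  have hlim := ((l1.mono_left hsub).const_mul 2).add (hid.mul (l2.mono_left hsub))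
  rw [zero_mul, add_zero] at hlim
  have hadm : ∀ᶠ t in 𝓝[>] (0 : ℝ), q₀ + 2 * (t * q φ + t ^ 2 * q fun _ => 0)
      + (2 * t ^ 2 * N φ + 2 * (t ^ 2) ^ 2 * N fun _ => 0) ≤ 1 := by
    rcases hq with hq | hq
    · have hc : Tendsto (fun t : ℝ => 2 * (q φ + t * q fun _ => 0)
          + (2 * t * N φ + 2 * t * t ^ 2 * N fun _ => 0)) (𝓝[>] 0) (𝓝 (2 * q φ)) := by
        refine Tendsto.mono_left ?_ nhdsWithin_le_nhds
        exact Continuous.tendsto' (by fun_prop) _ _ (by simp)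
      filter_upwards [hc.eventually_lt_const (by linarith : 2 * q φ < 0), self_mem_nhdsWithin]
        with t ht ht0
      have := mul_nonpos_of_nonneg_of_nonpos (le_of_lt ht0) ht.le
      have := h.q₀_le
      nlinarith
    · have hc : Tendsto (fun t : ℝ => q₀ + 2 * (t * q φ + t ^ 2 * q fun _ => 0)
          + (2 * t ^ 2 * N φ + 2 * (t ^ 2) ^ 2 * N fun _ => 0)) (𝓝[>] 0) (𝓝 q₀) := by
        refine Tendsto.mono_left ?_ nhdsWithin_le_nhds
        exact Continuous.tendsto' (by fun_prop) _ _ (by simp)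
      exact hc.eventually_le_const hq
  have hle : ∀ᶠ t in 𝓝[>] (0 : ℝ),
      2 * logForm S (fun x => G (u x)) (fun x => t⁻¹ * increment G u φ (fun _ => 0) t x)
      + t * logForm S (fun x => t⁻¹ * increment G u φ (fun _ => 0) t x)
        (fun x => t⁻¹ * increment G u φ (fun _ => 0) t x) ≤ 0 := by
    filter_upwards [hadm, self_mem_nhdsWithin, hid.eventually_le_const one_pos] with t ht ht0 ht1
    have ht0' : 0 < t := ht0
    have := h.variation_nonpos hG hφ h0 (by rwa [abs_of_pos ht0']) ht
    rw [logForm_const_mul_right, logForm_self_const_mul]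
    have e : 2 * (t⁻¹ * logForm S (fun x => G (u x)) (increment G u φ (fun _ => 0) t))
        + t * (t⁻¹ ^ 2 * logForm S (increment G u φ (fun _ => 0) t)
          (increment G u φ (fun _ => 0) t))
        = t⁻¹ * (2 * logForm S (fun x => G (u x)) (increment G u φ (fun _ => 0) t)
          + logForm S (increment G u φ (fun _ => 0) t) (increment G u φ (fun _ => 0) t)) := by
      field_simp
    rw [e]
    exact mul_nonpos_of_nonneg_of_nonpos (inv_nonneg.2 ht0'.le) this
  have := le_of_tendsto hlim hle
  linarith

theorem energyDeriv_comb (hG : GrowthBound G c α) (hu : MemHHalf u)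
    (hf : LogAdmissible (volume.restrict S) fun x => G (u x))
    {φ ψ : ℝ → ℝ} (hφ : IsTest S φ) (hψ : IsTest S ψ) (a b : ℝ) :
    energyDeriv S G u (fun x => a * φ x + b * ψ x)
      = a * energyDeriv S G u φ + b * energyDeriv S G u ψ := by
  unfold energyDeriv
  have e : (fun x => deriv G (u x) * (a * φ x + b * ψ x))
      = fun x => a * (deriv G (u x) * φ x) + b * (deriv G (u x) * ψ x) := by
    ext x; ring
  rw [e, logForm_add_right hf ((hG.logAdmissible_deriv_mul hu hφ).const_mul a)
    ((hG.logAdmissible_deriv_mul hu hψ).const_mul b), logForm_const_mul_right,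
    logForm_const_mul_right]

end

/-! ### The multiplier is positive -/

theorem isTest_of_contDiff {S : Set ℝ} {χ : ℝ → ℝ} (hc : ContDiff ℝ 1 χ)
    (hs : HasCompactSupport χ) (hS : tsupport χ ⊆ S) : IsTest S χ := by
  refine ⟨memHHalf_of_contDiff hc hs, ?_, ae_of_all _ fun x hx =>
    image_eq_zero_of_notMem_tsupport fun h => hx (hS h)⟩
  obtain ⟨R, hR⟩ := hs.isBounded.subset_closedBall 0
  refine ⟨R, ae_of_all _ fun x hx => image_eq_zero_of_notMem_tsupport fun h => ?_⟩
  have := hR h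
  rw [mem_closedBall_zero_iff, Real.norm_eq_abs] at this
  linarith

theorem energyDeriv_eq_integral {S : Set ℝ} {G u φ : ℝ → ℝ} {c α : ℝ} (hG : GrowthBound G c α)
    (hu : MemHHalf u) (hf : LogAdmissible (volume.restrict S) fun x => G (u x))
    (hφ : IsTest S φ) :
    energyDeriv S G u φ = ∫ x in S, logPotential S G u x * deriv G (u x) * φ x := by
  rw [energyDeriv, logForm_eq_integral_potential hf (hG.logAdmissible_deriv_mul hu hφ)]
  refine integral_congr_ae (ae_of_all _ fun x => ?_)
  simp only [mul_assoc]
  rfl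

theorem integrable_potential_deriv {S : Set ℝ} {G u φ : ℝ → ℝ} {c α : ℝ} (hG : GrowthBound G c α)
    (hu : MemHHalf u) (hf : LogAdmissible (volume.restrict S) fun x => G (u x))
    (hφ : IsTest S φ) :
    IntegrableOn (fun x => logPotential S G u x * deriv G (u x) * φ x) S := by
  refine (hf.integrable_potential_mul (hG.logAdmissible_deriv_mul hu hφ)).congr
    (ae_of_all _ fun x => ?_)
  simp only [mul_assoc]
  rfl

theorem locallyIntegrableOn_potential_deriv {S : Set ℝ} {G u : ℝ → ℝ} {c α : ℝ}
    (hG : GrowthBound G c α) (hu : MemHHalf u)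
    (hf : LogAdmissible (volume.restrict S) fun x => G (u x)) (hS : IsOpen S) :
    LocallyIntegrableOn (fun x => logPotential S G u x * deriv G (u x)) S volume := by
  rw [locallyIntegrableOn_iff hS.isLocallyClosed]
  intro k hkS hk
  obtain ⟨R, hR⟩ := hk.isBounded.subset_closedBall 0
  have hH : LogAdmissible (volume.restrict S) (k.indicator fun x => deriv G (u x)) := by
    refine hu.logAdmissible_of_le_exp (C := c) (β := α) (R := R) hG.α_pos.le ?_ ?_ ?_
    · exact ((hG.continuous_deriv.comp_aestronglyMeasurable
        hu.1.aestronglyMeasurable).indicator hk.measurableSet).restrict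
    · intro x
      refine le_trans ?_ (hG.abs_deriv_le (u x))
      by_cases hx : x ∈ k
      · rw [indicator_of_mem hx]
      · rw [indicator_of_notMem hx]; simp
    · refine ae_of_all _ fun x hx => indicator_of_notMem (fun hxk => ?_) _
      have := hR hxk
      rw [mem_closedBall_zero_iff, Real.norm_eq_abs] at this
      linarith
  have h1 := (hf.integrable_potential_mul hH).mono_set hkS
  refine h1.congr_fun (fun x hx => ?_) hk.measurableSet
  simp only [indicator_of_mem hx]
  rfl

/-- The fundamental lemma of the calculus of variations, tested with smooth functions compactly
supported in `S`. -/
theorem ae_potential_deriv_eq_zero {S : Set ℝ} {G u : ℝ → ℝ} {c α : ℝ}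
    (hG : GrowthBound G c α) (hu : MemHHalf u)
    (hf : LogAdmissible (volume.restrict S) fun x => G (u x)) (hS : IsOpen S)
    (h0 : ∀ φ, IsTest S φ → energyDeriv S G u φ = 0) :
    ∀ᵐ x ∂(volume.restrict S), logPotential S G u x * deriv G (u x) = 0 := by
  rw [ae_restrict_iff' hS.measurableSet]
  refine hS.ae_eq_zero_of_integral_contDiff_smul_eq_zero
    (locallyIntegrableOn_potential_deriv hG hu hf hS) fun χ hχ hs hsub => ?_
  have ht : IsTest S χ := isTest_of_contDiff (hχ.of_le (by norm_cast)) hs hsub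
  have h1 := h0 χ ht
  rw [energyDeriv_eq_integral hG hu hf ht] at h1
  rw [← h1, ← integral_indicator hS.measurableSet]
  refine integral_congr_ae (ae_of_all _ fun x => ?_)
  by_cases hx : x ∈ S
  · simp only [indicator_of_mem hx, smul_eq_mul]; ring
  · simp only [indicator_of_notMem hx]
    rw [image_eq_zero_of_notMem_tsupport fun h => hx (hsub h), zero_smul]

/-- The signed distance to a set containing `0`. -/
def signedDist (Z : Set ℝ) (t : ℝ) : ℝ :=
  if 0 ≤ t then Metric.infDist t Z else -Metric.infDist t Z

/-- For arguments of opposite sign the two distances add up, but each is at most the distance to `0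
∈ Z`, and `|s| + |t| = |s - t|`. -/
theorem lipschitzWith_signedDist {Z : Set ℝ} (h0 : (0 : ℝ) ∈ Z) :
    LipschitzWith 1 (signedDist Z) := by
  refine LipschitzWith.of_dist_le_mul fun s t => ?_
  have hd : ∀ s t : ℝ, |Metric.infDist s Z - Metric.infDist t Z| ≤ |s - t| := fun s t => by
    simpa [Real.dist_eq] using (Metric.lipschitz_infDist_pt Z).dist_le_mul s t
  have hz : ∀ t : ℝ, Metric.infDist t Z ≤ |t| := fun t => by
    simpa [Real.dist_eq] using Metric.infDist_le_dist_of_mem (x := t) h0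
  have hn : ∀ t : ℝ, 0 ≤ Metric.infDist t Z := fun t => Metric.infDist_nonneg
  rw [Real.dist_eq, Real.dist_eq, NNReal.coe_one, one_mul]
  unfold signedDist
  split_ifs with hs ht ht
  · exact hd s t
  · have h1 := hz s
    have h2 := hz t
    rw [abs_of_nonneg hs] at h1
    rw [abs_of_neg (not_le.1 ht)] at h2
    rw [abs_of_nonneg (by linarith [hn s, hn t]), abs_of_nonneg (by linarith [not_le.1 ht])]
    linarith
  · have h1 := hz s
    have h2 := hz t
    rw [abs_of_neg (not_le.1 hs)] at h1
    rw [abs_of_nonneg ht] at h2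
    rw [abs_of_nonpos (by linarith [hn s, hn t]), abs_of_nonpos (by linarith [not_le.1 hs])]
    linarith
  · rw [neg_sub_neg, abs_sub_comm]
    exact hd s t

theorem signedDist_of_mem {Z : Set ℝ} {t : ℝ} (h : t ∈ Z) : signedDist Z t = 0 := by
  simp [signedDist, Metric.infDist_zero_of_mem h]

theorem abs_signedDist_pos {Z : Set ℝ} (hZ : IsClosed Z) (h0 : (0 : ℝ) ∈ Z) {t : ℝ} (h : t ∉ Z) :
    0 < |signedDist Z t| := by
  have : 0 < Metric.infDist t Z := (hZ.notMem_iff_infDist_pos ⟨0, h0⟩).1 h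
  unfold signedDist
  split_ifs
  · rwa [abs_of_pos this]
  · rwa [abs_neg, abs_of_pos this]

theorem CondA.deriv_mul_signedDist_nonneg {G : ℝ → ℝ} (hA : CondA G) (Z : Set ℝ) (t : ℝ) :
    0 ≤ deriv G t * signedDist Z t := by
  unfold signedDist
  split_ifs with ht
  · exact mul_nonneg (hA.deriv_nonneg ht) Metric.infDist_nonneg
  · have h1 := hA.deriv_nonneg (t := -t) (by linarith)
    rw [hA.deriv_neg] at h1
    nlinarith [Metric.infDist_nonneg (x := t) (s := Z)]

/-- The logarithmic form is positive on nonnegative densities with small support. -/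
theorem logForm_self_pos {S : Set ℝ} {F : ℝ → ℝ} (hF : LogAdmissible (volume.restrict S) F)
    (hpos : ∀ x, 0 ≤ F x) {x₀ : ℝ} (hsupp : ∀ x, F x ≠ 0 → |x - x₀| < 1 / 4)
    (hne : ¬ F =ᵐ[volume.restrict S] fun _ => 0) : 0 < logForm S F F := by
  have hk : ∀ x y, x ≠ y → F x ≠ 0 → F y ≠ 0 → 0 < logKernel x y := by
    intro x y hxy hx hy
    have h1 := hsupp x hx
    have h2 := hsupp y hy
    have h3 : |x - y| < 1 := by
      rw [abs_lt] at h1 h2 ⊢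
      constructor <;> linarith
    refine Real.log_pos ?_
    rw [lt_div_iff₀ (abs_pos.2 (sub_ne_zero.2 hxy)), one_mul]
    exact h3
  have hnn : ∀ p : ℝ × ℝ, 0 ≤ logKernel p.1 p.2 * F p.1 * F p.2 := by
    intro p
    by_cases hx : F p.1 = 0
    · simp [hx]
    by_cases hy : F p.2 = 0
    · simp [hy]
    rcases eq_or_ne p.1 p.2 with hp | hp
    · simp [logKernel, hp]
    · exact mul_nonneg (mul_nonneg (hk _ _ hp hx hy).le (hpos _)) (hpos _)
  refine lt_of_le_of_ne (integral_nonneg hnn) fun h0 => hne ?_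
  have h1 := (integral_eq_zero_iff_of_nonneg hnn (hF.integrable_prod hF)).1 h0.symm
  have h2 := Measure.ae_ae_of_ae_prod h1
  have h3 : ∃ᵐ x ∂(volume.restrict S), F x ≠ 0 := fun hc =>
    hne (hc.mono fun x hx => not_not.1 hx)
  obtain ⟨x, hx, hxae⟩ := (h3.and_eventually h2).exists
  have hxne : ∀ᵐ y ∂(volume.restrict S), y ≠ x := ae_restrict_of_ae (Measure.ae_ne volume x)
  filter_upwards [hxae, hxne] with y hy hyx
  by_contra hFy
  have := hk x y hyx.symm hx hFy
  simp only [Pi.zero_apply, mul_eq_zero] at hy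
  rcases hy with (hy | hy) | hy
  · exact this.ne' hy
  · exact hx hy
  · exact hFy hy

/-- A nonzero `u` admits a variation which is supported where `G'(u) ≠ 0` and along which the
energy is strictly convex. -/
theorem exists_isTest_logForm_pos {S : Set ℝ} {G u : ℝ → ℝ} {c α : ℝ} (hG : GrowthBound G c α)
    (hu : MemHHalf u) (hS : MeasurableSet S) (hv : ∀ᵐ x : ℝ, x ∉ S → u x = 0)
    (hne : ¬ u =ᵐ[volume] fun _ => 0) :
    ∃ φ, IsTest S φ ∧ (∀ x, deriv G (u x) = 0 → φ x = 0) ∧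
      0 < logForm S (fun x => deriv G (u x) * φ x) (fun x => deriv G (u x) * φ x) := by
  set Z : Set ℝ := {t | deriv G t = 0} with hZdef
  have hZ0 : (0 : ℝ) ∈ Z := hG.condA.deriv_zero
  have hZc : IsClosed Z := hG.isClosed_critical
  have hZpos : volume {x | u x ∉ Z} ≠ 0 := by
    intro h0
    refine hne (hu.ae_eq_zero_of_mem hZc hG.interior_critical (fun t ht => ?_) ?_)
    · have ht' : deriv G t = 0 := ht
      change deriv G (-t) = 0
      rw [hG.condA.deriv_neg, ht', neg_zero]
    · exact ae_iff.2 h0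
  -- Every neighbourhood of `x₀` meets the set where `G'(u) ≠ 0` in positive measure, so localizing
  -- to radius `1/4` loses nothing essential.
  obtain ⟨x₀, -, hx₀⟩ := exists_mem_forall_mem_nhdsWithin_pos_measure hZpos
  have hW := hx₀ ({x | u x ∉ Z} ∩ Metric.ball x₀ (1 / 4))
    (inter_mem_nhdsWithin _ (Metric.ball_mem_nhds x₀ (by norm_num)))
  set η : ℝ → ℝ := fun x => max 0 (1 / 4 - |x - x₀|) with hη
  have hηc : Continuous η := by fun_prop
  have hηpos : ∀ x, 0 ≤ η x := fun x => le_max_left _ _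
  have hηsupp : ∀ x, η x ≠ 0 → |x - x₀| < 1 / 4 := by
    intro x hx
    by_contra hcon
    exact hx (max_eq_left (by linarith))
  have hηle : ∀ x, |η x| ≤ 1 := by
    intro x
    rw [abs_of_nonneg (hηpos x)]
    exact max_le (by norm_num) (by linarith [abs_nonneg (x - x₀)])
  have hηlip : ∀ x y, |η x - η y| ≤ 1 * |x - y| := by
    intro x y
    rw [one_mul]
    refine (abs_max_sub_max_le_max 0 (1 / 4 - |x - x₀|) 0 (1 / 4 - |y - x₀|)).trans ?_
    rw [sub_self, abs_zero, max_eq_right (abs_nonneg _)]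
    have := abs_abs_sub_abs_le_abs_sub (y - x₀) (x - x₀)
    rw [show 1 / 4 - |x - x₀| - (1 / 4 - |y - x₀|) = |y - x₀| - |x - x₀| by ring]
    refine this.trans (le_of_eq ?_)
    rw [abs_sub_comm]; congr 1; ring
  -- The signed distance replaces `G'(u)`: it has compatible sign and the same zeros, but being
  -- Lipschitz it keeps the composition in `H^{1/2}`. Since `0 ∈ Z`, it also vanishes where `u`
  -- does.
  set φ : ℝ → ℝ := fun x => η x * signedDist Z (u x) with hφdef
  have hsd := hu.lipschitz_comp (lipschitzWith_signedDist hZ0) (signedDist_of_mem hZ0)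
  have hφ : IsTest S φ := by
    refine ⟨hsd.mul_lipschitz le_rfl hηc hηlip hηle, ⟨|x₀| + 1, ae_of_all _ fun x hx => ?_⟩, ?_⟩
    · have : η x = 0 := by
        by_contra hcon
        have h1 := hηsupp x hcon
        have h2 := abs_sub_abs_le_abs_sub x x₀
        linarith
      simp [hφdef, this]
    · filter_upwards [hv] with x hx hxS
      simp [hφdef, hx hxS, signedDist_of_mem hZ0]
  refine ⟨φ, hφ, fun x hx => ?_, ?_⟩
  · simp only [hφdef]
    rw [signedDist_of_mem (by exact hx), mul_zero]
  · refine logForm_self_pos (hG.logAdmissible_deriv_mul hu hφ) (fun x => ?_) (x₀ := x₀)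
      (fun x hx => ?_) fun hzero => ?_
    · have := mul_nonneg (hηpos x) (hG.condA.deriv_mul_signedDist_nonneg Z (u x))
      simp only [hφdef]
      linarith
    · refine hηsupp x fun h => hx ?_
      simp [hφdef, h]
    · refine hW.ne' ?_
      rw [EventuallyEq, ae_restrict_iff' hS] at hzero
      have hall : ∀ᵐ x, ¬ (u x ∉ Z ∧ x ∈ Metric.ball x₀ (1 / 4)) := by
        filter_upwards [hzero, hv] with x h1 h2
        rintro ⟨h3, h4⟩
        have hxS : x ∈ S := by
          by_contra hcon
          exact h3 (by rw [h2 hcon]; exact hZ0)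
        rw [Metric.mem_ball, Real.dist_eq] at h4
        have hη0 : 0 < η x := lt_max_of_lt_right (by linarith)
        have hs := abs_signedDist_pos hZc hZ0 h3
        have h5 := h1 hxS
        simp only [hφdef, mul_eq_zero] at h5
        rcases h5 with h5 | h5 | h5
        · exact h3 h5
        · exact hη0.ne' h5
        · rw [h5] at hs; simp at hs
      have := ae_iff.1 hall
      simp only [not_not] at this
      exact this

section

variable {S : Set ℝ} {G u : ℝ → ℝ} {q N : (ℝ → ℝ) → ℝ} {q₀ c α : ℝ}

/-- If the first variation vanishes, then the mixed term of the expansion of the energy is of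
lower order along variations supported where `G'(u) ≠ 0`. -/
theorem tendsto_logForm_increment_sq (hG : GrowthBound G c α) (hu : MemHHalf u)
    (hf : LogAdmissible (volume.restrict S) fun x => G (u x)) {φ ψ : ℝ → ℝ}
    (hφ : IsTest S φ) (hψ : IsTest S ψ) (hφ0 : ∀ x, deriv G (u x) = 0 → φ x = 0)
    (h0 : ∀ᵐ x ∂(volume.restrict S), logPotential S G u x * deriv G (u x) = 0) :
    Tendsto (fun t => logForm S (fun x => G (u x)) (fun x => (t ^ 2)⁻¹ * increment G u φ ψ t x))
      (𝓝[≠] 0) (𝓝 0) := by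
  have hM := hG.logAdmissible_majorant hu hφ hψ
  have h1 : ∀ᶠ t in 𝓝[≠] (0 : ℝ), |t| ≤ 1 :=
    eventually_nhdsWithin_of_eventually_nhds
      (continuous_abs.tendsto' (0 : ℝ) 0 (by simp) |>.eventually_le_const one_pos)
  have hadm : ∀ t : ℝ, |t| ≤ 1 → LogAdmissible (volume.restrict S)
      (fun x => (t ^ 2)⁻¹ * increment G u φ ψ t x) := by
    intro t ht
    refine LogAdmissible.const_mul ((hM.const_mul |t|).mono
      (hG.aestronglyMeasurable_increment hu hφ.memHHalf hψ.memHHalf t)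
      (ae_of_all _ fun x => ?_)) _
    exact (hG.abs_increment_le u φ ψ ht x).trans (le_abs_self _)
  -- Where `φ = 0` the variation is `t² ψ`, so dividing by `t²` gives an ordinary difference
  -- quotient, with limit `G'(u) ψ`.
  have heq : ∀ t x, φ x = 0 → increment G u φ ψ t x = increment G u ψ (fun _ => 0) (t ^ 2) x := by
    intro t x hx
    simp [increment, hx]
  have hVM := (hf.integrable_potential_mul hM).abs
  have key : Tendsto (fun t => ∫ x in S, (∫ y in S, logKernel x y * G (u y)) *
      ((t ^ 2)⁻¹ * increment G u φ ψ t x)) (𝓝[≠] 0) (𝓝 (∫ x in S, (0 : ℝ))) := by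
    refine tendsto_integral_filter_of_dominated_convergence _ ?_ ?_ hVM ?_
    · filter_upwards [h1] with t ht
      exact (hf.integrable_potential_mul (hadm t ht)).aestronglyMeasurable
    · filter_upwards [h1, self_mem_nhdsWithin] with t ht ht0
      filter_upwards [h0] with x hx
      rcases mul_eq_zero.1 hx with hV | hg
      · have hV' : (∫ y in S, logKernel x y * G (u y)) = 0 := hV
        simp [hV']
      · have hx0 := hφ0 x hg
        rw [norm_mul, abs_mul, heq t x hx0]
        refine mul_le_mul_of_nonneg_left ?_ (norm_nonneg _)
        have ht0' : t ≠ 0 := ht0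
        have ht2 : 0 < t ^ 2 := by positivity
        have h2 : |t ^ 2| ≤ 1 := by rw [abs_pow]; exact pow_le_one₀ (abs_nonneg _) ht
        have h3 := hG.abs_increment_le u ψ (fun _ => 0) h2 x
        rw [abs_of_pos ht2] at h3
        rw [norm_mul, norm_inv, Real.norm_eq_abs, abs_of_pos ht2, inv_mul_le_iff₀ ht2]
        refine h3.trans (mul_le_mul_of_nonneg_left ((le_of_eq ?_).trans (le_abs_self _)) ht2.le)
        simp [majorant, hx0]
    · filter_upwards [h0] with x hx
      rcases mul_eq_zero.1 hx with hV | hg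
      · have hV' : (∫ y in S, logKernel x y * G (u y)) = 0 := hV
        simp [hV']
      · have hx0 := hφ0 x hg
        have hl := hG.tendsto_increment_div u ψ (fun _ => 0) x
        rw [hg, zero_mul] at hl
        have hsq : Tendsto (fun t : ℝ => t ^ 2) (𝓝[≠] 0) (𝓝[≠] 0) := by
          refine tendsto_nhdsWithin_iff.2 ⟨?_, ?_⟩
          · refine Tendsto.mono_left ?_ nhdsWithin_le_nhds
            exact Continuous.tendsto' (by fun_prop) _ _ (by simp)
          · filter_upwards [self_mem_nhdsWithin] with t ht
            exact pow_ne_zero 2 ht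
        have h4 := (hl.comp hsq).const_mul (∫ y in S, logKernel x y * G (u y))
        rw [mul_zero] at h4
        refine h4.congr fun t => ?_
        simp only [Function.comp_apply]
        rw [heq t x hx0]
  rw [integral_zero] at key
  refine key.congr' ?_
  filter_upwards [h1] with t ht
  rw [logForm_eq_integral_potential hf (hadm t ht)]

/-- The second-order argument: if the first variation vanished identically, the energy would
increase strictly along `u + tφ + t²ψ` while the correction `t²ψ` keeps the constraint satisfied. -/
theorem IsConstrainedMax.exists_energyDeriv_ne_zero (h : IsConstrainedMax S G u q N q₀)
    (hG : GrowthBound G c α) (hS : IsOpen S) {φ₀ : ℝ → ℝ} (hφ₀ : IsTest S φ₀) (hq : q φ₀ < 0)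
    (hne : ¬ u =ᵐ[volume] fun _ => 0) : ∃ φ, IsTest S φ ∧ energyDeriv S G u φ ≠ 0 := by
  by_contra! hcon
  have hVg := ae_potential_deriv_eq_zero hG h.memHHalf h.logAdmissible hS hcon
  obtain ⟨φ, hφ, hφ0, hφpos, hqφ⟩ : ∃ φ, IsTest S φ ∧ (∀ x, deriv G (u x) = 0 → φ x = 0) ∧
      0 < logForm S (fun x => deriv G (u x) * φ x) (fun x => deriv G (u x) * φ x) ∧ q φ ≤ 0 := by
    obtain ⟨φ, h1, h2, h3⟩ := exists_isTest_logForm_pos hG h.memHHalf hS.measurableSet h.vanish hne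
    rcases le_or_gt (q φ) 0 with h4 | h4
    · exact ⟨φ, h1, h2, h3, h4⟩
    -- The quadratic form is even, so the sign of `φ` may be flipped to get `q φ ≤ 0`. The zero term
    -- only brings `-φ` into the form of `IsTest.comb`.
    · refine ⟨fun x => (-1) * φ x + 0 * φ x, h1.comb h1 _ _, fun x hx => by simp [h2 x hx], ?_, ?_⟩
      · have e : (fun x => deriv G (u x) * (-1 * φ x + 0 * φ x))
            = fun x => (-1) * (deriv G (u x) * φ x) := by ext x; ring
        rw [e, logForm_self_const_mul]
        linarith
      · rw [h.q_comb φ φ h1 h1]; linarith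
  -- Makes the `t²` coefficient `2 q ψ + 2 N φ` of the bound on the constraint negative; the `t`
  -- term is harmless since `q φ ≤ 0`.
  obtain ⟨C, hC⟩ : ∃ C : ℝ, C * q φ₀ + N φ < 0 :=
    ⟨(N φ + 1) / (-q φ₀), by
      have : q φ₀ ≠ 0 := hq.ne
      have e : (N φ + 1) / (-q φ₀) * q φ₀ = -(N φ + 1) := by field_simp
      rw [e]; linarith⟩
  set ψ : ℝ → ℝ := fun x => C * φ₀ x + 0 * φ₀ x
  have hψ : IsTest S ψ := hφ₀.comb hφ₀ C 0
  have hqψ : q ψ = C * q φ₀ := by rw [h.q_comb φ₀ φ₀ hφ₀ hφ₀]; ring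
  have l1 := tendsto_logForm_increment_sq hG h.memHHalf h.logAdmissible hφ hψ hφ0 hVg
  have l2 := (tendsto_logForm_increment hG h.memHHalf h.logAdmissible hφ hψ).2
  have hid : Tendsto (fun t : ℝ => t) (𝓝[>] 0) (𝓝 0) := nhdsWithin_le_nhds
  have hsub : 𝓝[>] (0 : ℝ) ≤ 𝓝[≠] 0 := nhdsWithin_mono _ fun x hx => (ne_of_gt hx)
  have hlim := ((l1.mono_left hsub).const_mul 2).add (l2.mono_left hsub)
  rw [mul_zero, zero_add] at hlim
  have hev : ∀ᶠ t in 𝓝[>] (0 : ℝ), 2 * q ψ + (2 * N φ + 2 * t ^ 2 * N ψ) < 0 := by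
    have hc : Tendsto (fun t : ℝ => 2 * q ψ + (2 * N φ + 2 * t ^ 2 * N ψ)) (𝓝[>] 0)
        (𝓝 (2 * q ψ + 2 * N φ)) := by
      refine Tendsto.mono_left ?_ nhdsWithin_le_nhds
      exact Continuous.tendsto' (by fun_prop) _ _ (by simp)
    exact hc.eventually_lt_const (by rw [hqψ]; linarith)
  have hle : ∀ᶠ t in 𝓝[>] (0 : ℝ),
      2 * logForm S (fun x => G (u x)) (fun x => (t ^ 2)⁻¹ * increment G u φ ψ t x)
        + logForm S (fun x => t⁻¹ * increment G u φ ψ t x)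
          (fun x => t⁻¹ * increment G u φ ψ t x) ≤ 0 := by
    filter_upwards [hev, self_mem_nhdsWithin, hid.eventually_le_const one_pos] with t ht ht0 ht1
    have ht0' : 0 < t := ht0
    have hadm : q₀ + 2 * (t * q φ + t ^ 2 * q ψ) + (2 * t ^ 2 * N φ + 2 * (t ^ 2) ^ 2 * N ψ)
        ≤ 1 := by
      have h1 := mul_nonpos_of_nonneg_of_nonpos ht0'.le hqφ
      have h2 := mul_nonpos_of_nonneg_of_nonpos (sq_nonneg t) ht.le
      have h3 := h.q₀_le
      nlinarith
    have := h.variation_nonpos hG hφ hψ (by rwa [abs_of_pos ht0']) hadm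
    rw [logForm_const_mul_right, logForm_self_const_mul, inv_pow]
    have h4 := mul_nonpos_of_nonneg_of_nonpos (inv_nonneg.2 (sq_nonneg t)) this
    linarith
  have := le_of_tendsto hlim hle
  linarith

/-- The Euler–Lagrange equation with a positive multiplier. -/
theorem IsConstrainedMax.exists_multiplier (h : IsConstrainedMax S G u q N q₀)
    (hG : GrowthBound G c α) (hS : IsOpen S) {φ₀ : ℝ → ℝ} (hφ₀ : IsTest S φ₀) (hq : q φ₀ ≠ 0)
    (hne : ¬ u =ᵐ[volume] fun _ => 0) :
    ∃ θ : ℝ, 0 < θ ∧ ∀ φ, IsTest S φ → q φ = θ * energyDeriv S G u φ := by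
  obtain ⟨ψ, hψ, hqψ⟩ : ∃ ψ, IsTest S ψ ∧ q ψ = -1 := by
    refine ⟨fun x => (-(q φ₀)⁻¹) * φ₀ x + 0 * φ₀ x, hφ₀.comb hφ₀ _ _, ?_⟩
    rw [h.q_comb φ₀ φ₀ hφ₀ hφ₀]
    field_simp
    ring
  set L := energyDeriv S G u
  -- On the kernel of `q`, perturbing by `ε ψ` makes the constraint strictly decreasing; `ε → 0`
  -- gives `L ≤ 0` there. Projecting along `ψ` and using both `φ` and `-φ` gives equality.
  have hL : ∀ φ, IsTest S φ → L φ = -q φ * L ψ := by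
    have hker : ∀ φ, IsTest S φ → q φ = 0 → L φ ≤ 0 := by
      intro φ hφ hφq
      have hε : ∀ ε : ℝ, 0 < ε → L φ + ε * L ψ ≤ 0 := by
        intro ε hε
        have h1 := h.energyDeriv_nonpos hG (hφ.comb hψ 1 ε) (Or.inl (by
          rw [h.q_comb φ ψ hφ hψ, hφq, hqψ]; linarith))
        rw [energyDeriv_comb hG h.memHHalf h.logAdmissible hφ hψ] at h1
        linarith
      have hlim : Tendsto (fun ε : ℝ => L φ + ε * L ψ) (𝓝[>] 0) (𝓝 (L φ)) := by
        refine Tendsto.mono_left ?_ nhdsWithin_le_nhds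
        exact Continuous.tendsto' (by fun_prop) _ _ (by simp)
      refine le_of_tendsto hlim ?_
      filter_upwards [self_mem_nhdsWithin] with ε hε'
      exact hε ε hε'
    have hle : ∀ φ, IsTest S φ → L φ + q φ * L ψ ≤ 0 := by
      intro φ hφ
      have h1 := hker _ (hφ.comb hψ 1 (q φ)) (by rw [h.q_comb φ ψ hφ hψ, hqψ]; ring)
      simp only [L] at h1 ⊢
      rw [energyDeriv_comb hG h.memHHalf h.logAdmissible hφ hψ] at h1
      linarith
    intro φ hφ
    have h1 := hle φ hφ
    have h2 := hle _ (hφ.comb hφ (-1) 0)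
    simp only [L] at h1 h2 ⊢
    rw [h.q_comb φ φ hφ hφ, energyDeriv_comb hG h.memHHalf h.logAdmissible hφ hφ] at h2
    linarith
  have hψle : L ψ ≤ 0 := h.energyDeriv_nonpos hG hψ (Or.inl (by rw [hqψ]; norm_num))
  obtain ⟨φ₁, hφ₁, hLφ₁⟩ := h.exists_energyDeriv_ne_zero hG hS hψ (by rw [hqψ]; norm_num) hne
  have hψne : L ψ ≠ 0 := by
    intro h0
    apply hLφ₁
    have := hL φ₁ hφ₁
    rw [h0, mul_zero] at this
    exact this
  have hψlt : L ψ < 0 := lt_of_le_of_ne hψle hψne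
  refine ⟨(-L ψ)⁻¹, inv_pos.2 (by linarith), fun φ hφ => ?_⟩
  rw [hL φ hφ]
  field_simp

end

/-! ### The quadratic constraints -/

/-- The bilinear form `∫_D (-Δ)^{1/4}v (-Δ)^{1/4}w + κ ∫ v w`. -/
def halfForm (κ : ℝ) (D : Set ℝ) (v w : ℝ → ℝ) : ℝ :=
  (∫ x in D, quarterLaplacian v x * quarterLaplacian w x) + κ * ∫ x, v x * w x

theorem halfForm_comm (κ : ℝ) (D : Set ℝ) (v w : ℝ → ℝ) :
    halfForm κ D v w = halfForm κ D w v := by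
  simp only [halfForm, mul_comm]

theorem integrable_quarterLaplacian_mul (v w : ℝ → ℝ) :
    Integrable fun x => quarterLaplacian v x * quarterLaplacian w x :=
  (memLp_quarterLaplacian v).integrable_mul (memLp_quarterLaplacian w)

theorem quarterLaplacian_comb {v w : ℝ → ℝ} (hv : MemHHalf v) (hw : MemHHalf w) (a b : ℝ) :
    quarterLaplacian (fun x => a * v x + b * w x)
      =ᵐ[volume] fun x => a * quarterLaplacian v x + b * quarterLaplacian w x := by
  filter_upwards [quarterLaplacian_add (hv.const_mul a) (hw.const_mul b),
    quarterLaplacian_const_mul hv a, quarterLaplacian_const_mul hw b] with x h1 h2 h3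
  rw [h1, h2, h3]

theorem halfForm_comb_right (κ : ℝ) (D : Set ℝ) {z v w : ℝ → ℝ} (hz : MemHHalf z)
    (hv : MemHHalf v) (hw : MemHHalf w) (a b : ℝ) :
    halfForm κ D z (fun x => a * v x + b * w x)
      = a * halfForm κ D z v + b * halfForm κ D z w := by
  have e1 : ∫ x in D, quarterLaplacian z x * quarterLaplacian (fun x => a * v x + b * w x) x
      = a * (∫ x in D, quarterLaplacian z x * quarterLaplacian v x)
        + b * ∫ x in D, quarterLaplacian z x * quarterLaplacian w x := by
    rw [← integral_const_mul, ← integral_const_mul, ← integral_add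
      ((integrable_quarterLaplacian_mul z v).integrableOn.const_mul a)
      ((integrable_quarterLaplacian_mul z w).integrableOn.const_mul b)]
    refine integral_congr_ae (ae_restrict_of_ae ?_)
    filter_upwards [quarterLaplacian_comb hv hw a b] with x hx
    rw [hx]; ring
  have e2 : ∫ x, z x * (a * v x + b * w x) = a * (∫ x, z x * v x) + b * ∫ x, z x * w x := by
    have h1 : Integrable fun x => z x * v x := hz.1.integrable_mul hv.1
    have h2 : Integrable fun x => z x * w x := hz.1.integrable_mul hw.1
    rw [← integral_const_mul, ← integral_const_mul,
      ← integral_add (h1.const_mul a) (h2.const_mul b)]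
    exact integral_congr_ae (ae_of_all _ fun x => by simp only; ring)
  rw [halfForm, e1, e2, halfForm, halfForm]; ring

theorem halfForm_comb_self (κ : ℝ) (D : Set ℝ) {v w : ℝ → ℝ} (hv : MemHHalf v)
    (hw : MemHHalf w) (a b : ℝ) :
    halfForm κ D (fun x => a * v x + b * w x) (fun x => a * v x + b * w x)
      = a ^ 2 * halfForm κ D v v + 2 * a * b * halfForm κ D v w + b ^ 2 * halfForm κ D w w := by
  have hc := (hv.const_mul a).add (hw.const_mul b)
  rw [halfForm_comb_right κ D hc hv hw, halfForm_comm κ D _ v, halfForm_comm κ D _ w,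
    halfForm_comb_right κ D hv hv hw, halfForm_comb_right κ D hw hv hw, halfForm_comm κ D w v]
  ring

theorem halfForm_self_nonneg {κ : ℝ} (hκ : 0 ≤ κ) (D : Set ℝ) (v : ℝ → ℝ) :
    0 ≤ halfForm κ D v v := by
  have h1 : 0 ≤ ∫ x in D, quarterLaplacian v x * quarterLaplacian v x :=
    integral_nonneg fun x => mul_self_nonneg _
  have h2 : 0 ≤ ∫ x, v x * v x := integral_nonneg fun x => mul_self_nonneg _
  unfold halfForm
  positivity

theorem halfForm_eq_zero_of_ae (κ : ℝ) (D : Set ℝ) {u : ℝ → ℝ} (h : u =ᵐ[volume] fun _ => 0)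
    (v : ℝ → ℝ) : halfForm κ D u v = 0 := by
  have h0 : quarterLaplacian u =ᵐ[volume] fun _ => 0 := by
    rw [quarterLaplacian_congr h]
    have := quarterLaplacian_const_mul memHHalf_zero 0
    simpa using this
  have e1 : ∫ x in D, quarterLaplacian u x * quarterLaplacian v x = 0 := by
    refine integral_eq_zero_of_ae (ae_restrict_of_ae ?_)
    filter_upwards [h0] with x hx
    simp [hx]
  have e2 : ∫ x, u x * v x = 0 := by
    refine integral_eq_zero_of_ae ?_
    filter_upwards [h] with x hx
    simp [hx]
  rw [halfForm, e1, e2]; ring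

theorem eLpNorm_two_sq_eq_ofReal {μ : Measure ℝ} {f : ℝ → ℝ} (hf : MemLp f 2 μ) :
    eLpNorm f 2 μ ^ 2 = ENNReal.ofReal (∫ x, f x * f x ∂μ) := by
  rw [eLpNorm_two_sq]
  have hi : Integrable (fun x => f x * f x) μ := hf.integrable_mul hf
  rw [ofReal_integral_eq_lintegral_ofReal hi (ae_of_all _ fun x => mul_self_nonneg _)]
  refine lintegral_congr fun x => ?_
  rw [← ofReal_norm, ← ENNReal.ofReal_pow (norm_nonneg _), Real.norm_eq_abs, sq_abs, sq]

theorem mem_unitSet_iff {I D : Set ℝ} {w : ℝ → ℝ} :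
    w ∈ unitSet I D ↔ MemHHalfZero I w ∧ halfForm 0 D w w ≤ 1 := by
  have h : eLpNorm (quarterLaplacian w) 2 (volume.restrict D) ≤ 1 ↔ halfForm 0 D w w ≤ 1 := by
    rw [← pow_le_one_iff (n := 2) (by norm_num),
      eLpNorm_two_sq_eq_ofReal ((memLp_quarterLaplacian w).restrict D), ENNReal.ofReal_le_one,
      halfForm, zero_mul, add_zero]
  exact and_congr_right fun _ => h

theorem mem_unitSetInfty_iff {w : ℝ → ℝ} :
    w ∈ unitSetInfty ↔ MemHHalf w ∧ halfForm 1 univ w w ≤ 1 := by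
  refine and_congr_right fun hw => ?_
  rw [normHHalf, eLpNorm_two_sq_eq_ofReal (memLp_quarterLaplacian w),
    eLpNorm_two_sq_eq_ofReal hw.1,
    ← ENNReal.ofReal_add (integral_nonneg fun x => mul_self_nonneg _)
      (integral_nonneg fun x => mul_self_nonneg _), halfForm, one_mul, Measure.restrict_univ]
  rw [← ENNReal.ofReal_le_one]
  conv_lhs => rw [← ENNReal.one_rpow (1 / 2)]
  exact ENNReal.rpow_le_rpow_iff (by norm_num)

theorem isConstrainedMax_halfForm {S D : Set ℝ} {G u : ℝ → ℝ} {κ : ℝ} (hκ : 0 ≤ κ)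
    (hu : MemHHalf u) (hv : ∀ᵐ x : ℝ, x ∉ S → u x = 0)
    (hf : LogAdmissible (volume.restrict S) fun x => G (u x)) (h1 : halfForm κ D u u ≤ 1)
    (hmax : ∀ φ, IsTest S φ → halfForm κ D (fun x => u x + φ x) (fun x => u x + φ x) ≤ 1 →
      energy S G (fun x => u x + φ x) ≤ energy S G u) :
    IsConstrainedMax S G u (halfForm κ D u) (fun φ => halfForm κ D φ φ) (halfForm κ D u u) where
  memHHalf := hu
  vanish := hv
  logAdmissible := hf
  q_comb φ ψ hφ hψ a b := halfForm_comb_right κ D hu hφ.memHHalf hψ.memHHalf a b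
  N_comb φ ψ hφ hψ a b := by
    rw [halfForm_comb_self κ D hφ.memHHalf hψ.memHHalf a b]
    -- Parallelogram identity: the form at `aφ + bψ` plus the form at `aφ - bψ` equals the claimed
    -- bound.
    have h2 := halfForm_self_nonneg hκ D (fun x => a * φ x + (-b) * ψ x)
    rw [halfForm_comb_self κ D hφ.memHHalf hψ.memHHalf a (-b)] at h2
    linarith
  q₀_le := h1
  energy_le φ hφ hq := by
    refine hmax φ hφ ?_
    have h2 := halfForm_comb_self κ D hu hφ.memHHalf 1 1
    simp only [one_mul, one_pow, mul_one] at h2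
    rw [h2]; linarith

/-! ### Admissibility of the maximizers -/

theorem CondA.logAdmissible_Ioo {G : ℝ → ℝ} (hA : CondA G) {u : ℝ → ℝ} (hu : MemHHalf u)
    (a b : ℝ) : LogAdmissible (volume.restrict (Ioo a b)) fun x => G (u x) := by
  obtain ⟨α, hα, c, -, hle⟩ := hA.growth
  refine hu.logAdmissible_of_le_exp (C := c) (β := α) (R := max |a| |b|) hα.le
    (hA.continuous.comp_aestronglyMeasurable hu.1.aestronglyMeasurable).restrict
    (fun x => by rw [abs_of_nonneg (hA.nonneg _)]; exact hle _) ?_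
  filter_upwards [ae_restrict_mem measurableSet_Ioo] with x hx hx'
  exact absurd (abs_le_max_abs_abs hx.1.le hx.2.le) (not_le.2 hx')

theorem CondA1.map_zero {G : ℝ → ℝ} (hA : CondA1 G) : G 0 = 0 := by
  obtain ⟨C, hC⟩ := hA.isBigO.bound
  simpa using hC.self_of_nhds

/-- Away from 0 monotonicity gives `G t ≤ G 1 ≤ (G 1 / δ) |t|`, which extends the linear bound to
`|t| ≤ 1`. -/
theorem CondA1.exists_le_mul_abs {G : ℝ → ℝ} (hA : CondA1 G) :
    ∃ C : ℝ, 0 ≤ C ∧ ∀ t, |t| ≤ 1 → G t ≤ C * |t| := by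
  obtain ⟨C, hC⟩ := hA.isBigO.bound
  obtain ⟨δ, hδ, hball⟩ := Metric.eventually_nhds_iff.1 hC
  have hG1 := hA.nonneg 1
  have habs : ∀ t, G |t| = G t := fun t => by
    rcases abs_choice t with h | h <;> rw [h]
    exact hA.even t
  refine ⟨|C| + G 1 / δ, by positivity, fun t ht => ?_⟩
  rcases lt_or_ge |t| δ with h | h
  · have h1 := hball (y := t) (by simpa [Real.dist_eq] using h)
    rw [Real.norm_eq_abs, Real.norm_eq_abs, abs_abs, abs_of_nonneg (hA.nonneg t)] at h1
    have h2 : C * |t| ≤ |C| * |t| := mul_le_mul_of_nonneg_right (le_abs_self _) (abs_nonneg _)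
    have h3 : 0 ≤ G 1 / δ * |t| := by positivity
    rw [add_mul]; linarith
  · have h1 : G t ≤ G 1 := by
      rw [← habs t]
      exact hA.strictMonoOn.monotoneOn (mem_Ici.2 (abs_nonneg t)) (mem_Ici.2 zero_le_one) ht
    have h2 : G 1 ≤ G 1 / δ * |t| := by
      rw [div_mul_eq_mul_div, le_div_iff₀ hδ]
      exact mul_le_mul_of_nonneg_left h hG1
    have h3 : 0 ≤ |C| * |t| := by positivity
    rw [add_mul]; linarith

/-- Split at `|u| = 1`: the linear bound and `u ∈ L²` below, exponential integrability above. -/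
theorem CondA1.memLp {G : ℝ → ℝ} (hA : CondA1 G) {u : ℝ → ℝ} (hu : MemHHalf u) :
    MemLp (fun x => G (u x)) 2 volume := by
  obtain ⟨α, hα, c, -, hle⟩ := hA.growth
  obtain ⟨C, hC0, hC⟩ := hA.exists_le_mul_abs
  refine ⟨hA.continuous.comp_aestronglyMeasurable hu.1.aestronglyMeasurable, ?_⟩
  have habs : AEMeasurable (fun x => |u x|) volume := hu.aemeasurable.norm
  have hs : NullMeasurableSet {x | 1 < |u x|} volume :=
    nullMeasurableSet_lt aemeasurable_const habs
  have hm : AEMeasurable (fun x => ENNReal.ofReal (C ^ 2) * ENNReal.ofReal (u x ^ 2)) volume :=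
    ((hu.aemeasurable.pow_const 2).ennreal_ofReal).const_mul _
  have h2 : eLpNorm (fun x => G (u x)) 2 volume ^ 2 < ∞ := by
    rw [eLpNorm_two_sq]
    calc ∫⁻ x, ‖G (u x)‖ₑ ^ 2
        ≤ ∫⁻ x, (ENNReal.ofReal (C ^ 2) * ENNReal.ofReal (u x ^ 2) + {x | 1 < |u x|}.indicator
          (fun x => ENNReal.ofReal (c ^ 2) * ENNReal.ofReal (Real.exp (2 * α * u x ^ 2))) x) := by
          refine lintegral_mono fun x => ?_
          rw [← ofReal_norm, ← ENNReal.ofReal_pow (norm_nonneg _), Real.norm_eq_abs,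
            abs_of_nonneg (hA.nonneg _)]
          by_cases hx : x ∈ {x | 1 < |u x|}
          · rw [indicator_of_mem hx]
            refine le_trans ?_ le_add_self
            rw [← ENNReal.ofReal_mul (by positivity)]
            apply ENNReal.ofReal_le_ofReal
            have := pow_le_pow_left₀ (hA.nonneg _) (hle (u x)) 2
            rw [mul_pow, ← Real.exp_nat_mul] at this
            refine this.trans (le_of_eq ?_)
            push_cast; ring_nf
          · refine le_trans ?_ le_self_add
            rw [← ENNReal.ofReal_mul (by positivity)]
            apply ENNReal.ofReal_le_ofReal
            have := pow_le_pow_left₀ (hA.nonneg _) (hC (u x) (not_lt.1 hx)) 2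
            rwa [mul_pow, sq_abs] at this
      _ < ∞ := by
          rw [lintegral_add_left' hm, lintegral_indicator₀ hs,
            lintegral_const_mul' _ _ ENNReal.ofReal_ne_top,
            lintegral_const_mul' _ _ ENNReal.ofReal_ne_top]
          exact ENNReal.add_lt_top.2 ⟨ENNReal.mul_lt_top ENNReal.ofReal_lt_top
            (lintegral_sq_lt_top hu.1), ENNReal.mul_lt_top ENNReal.ofReal_lt_top
            (hu.lintegral_exp_lt_top (by positivity))⟩
  by_contra hcon
  rw [not_lt, top_le_iff] at hcon
  rw [hcon] at h2
  simp at h2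

theorem logWeight_le_posLog {x₀ y : ℝ} (h : 2 + |x₀| ≤ |x₀ - y|) :
    logWeight y ≤ 2 * Real.posLog |x₀ - y| := by
  have h1 : 1 ≤ |x₀ - y| := by linarith [abs_nonneg x₀]
  rw [Real.posLog_eq_log (by rwa [abs_abs]), logWeight]
  have h2 : 2 + |y| ≤ |x₀ - y| ^ 2 := by
    have h3 := abs_sub_abs_le_abs_sub y x₀
    rw [abs_sub_comm] at h3
    nlinarith [abs_nonneg x₀]
  have h4 := Real.log_le_log (by positivity) h2
  rwa [Real.log_pow, Nat.cast_ofNat] at h4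

/-- A function of finite energy has an admissible density. -/
theorem CondA1.logAdmissible_univ {G : ℝ → ℝ} (hA : CondA1 G) {u : ℝ → ℝ} (hu : MemHHalf u)
    (hfin : energyNeg univ G u ≠ ∞) :
    LogAdmissible (volume.restrict univ) fun x => G (u x) := by
  rw [Measure.restrict_univ]
  have hf := hA.memLp hu
  have hfm : AEMeasurable (fun x => G (u x)) volume := hf.aestronglyMeasurable.aemeasurable
  by_cases hzero : (fun x => G (u x)) =ᵐ[volume] fun _ => 0
  · have h0 : LogAdmissible volume fun _ => 0 := ⟨MemLp.zero', by simp⟩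
    refine h0.mono hf.aestronglyMeasurable ?_
    filter_upwards [hzero] with x hx
    rw [hx]
  have hk : Measurable fun p : ℝ × ℝ => Real.posLog |p.1 - p.2| := by
    simp only [Real.posLog_apply]; fun_prop
  have hm : AEMeasurable (fun p : ℝ × ℝ =>
      ENNReal.ofReal (Real.posLog |p.1 - p.2| * G (u p.1) * G (u p.2)))
      (volume.prod volume) :=
    ((hk.aemeasurable.mul hfm.comp_fst).mul hfm.comp_snd).ennreal_ofReal
  rw [energyNeg, Measure.restrict_univ] at hfin
  have hae := ae_lt_top' hm.lintegral_prod_right' hfin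
  have hfr : ∃ᵐ x ∂volume, G (u x) ≠ 0 := fun hc => hzero (hc.mono fun x hx => not_not.1 hx)
  -- One point with `G(u x₀) > 0` and finite inner integral suffices: far from `x₀` the weight is at
  -- most `2 log⁺ |x₀ - y|`, and the remaining `y` lie in a bounded set.
  obtain ⟨x₀, hx₀, hlt⟩ := (hfr.and_eventually hae).exists
  have hx₀pos : 0 < G (u x₀) := lt_of_le_of_ne (hA.nonneg _) (Ne.symm hx₀)
  have hintg : Integrable (fun y => Real.posLog |x₀ - y| * G (u y)) := by
    have hmeas : AEStronglyMeasurable (fun y => Real.posLog |x₀ - y| * G (u y)) volume :=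
      (hk.comp measurable_prodMk_left).aestronglyMeasurable.mul hf.aestronglyMeasurable
    have h2 : Integrable (fun y => Real.posLog |x₀ - y| * G (u x₀) * G (u y)) := by
      refine ⟨(hmeas.const_mul (G (u x₀))).congr (ae_of_all _ fun y => by simp only; ring), ?_⟩
      rw [hasFiniteIntegral_iff_ofReal (ae_of_all _ fun y =>
        mul_nonneg (mul_nonneg Real.posLog_nonneg hx₀pos.le) (hA.nonneg _))]
      exact hlt
    refine (h2.const_mul (G (u x₀))⁻¹).congr (ae_of_all _ fun y => ?_)
    simp only
    field_simp
  set R : ℝ := 2 + 2 * |x₀| with hR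
  have hloc : LogAdmissible volume ((Icc (-R) R).indicator fun y => G (u y)) := by
    refine logAdmissible_of_bounded_support le_rfl (R := R) (hf.indicator measurableSet_Icc)
      (ae_of_all _ fun x hx => indicator_of_notMem (fun h => ?_) _)
    exact absurd (abs_le.2 h) (not_le.2 hx)
  refine ⟨hf, ((hintg.const_mul 2).add hloc.integrable).mono'
    (measurable_logWeight.aestronglyMeasurable.mul hf.aestronglyMeasurable)
    (ae_of_all _ fun y => ?_)⟩
  have hly := logWeight_pos y
  have hGy := hA.nonneg (u y)
  rw [Real.norm_eq_abs, abs_of_nonneg (mul_nonneg hly.le hGy), Pi.add_apply]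
  rcases le_or_gt (2 + |x₀|) |x₀ - y| with h | h
  · have h1 := mul_le_mul_of_nonneg_right (logWeight_le_posLog h) hGy
    have h2 : 0 ≤ logWeight y * (Icc (-R) R).indicator (fun y => G (u y)) y :=
      mul_nonneg hly.le (indicator_nonneg (fun x _ => hA.nonneg _) y)
    linarith
  · have hy : y ∈ Icc (-R) R := by
      refine abs_le.1 ?_
      have h3 := abs_sub_abs_le_abs_sub y x₀
      rw [abs_sub_comm] at h3
      linarith
    rw [indicator_of_mem hy]
    have : 0 ≤ 2 * (Real.posLog |x₀ - y| * G (u y)) :=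
      mul_nonneg (by norm_num) (mul_nonneg Real.posLog_nonneg hGy)
    linarith

/-- Since `G 0 = 0`, the zero function is a competitor of energy 0, whereas an infinite negative
part would make the energy `-∞`. -/
theorem CondA1.energyNeg_ne_top {G : ℝ → ℝ} (hA : CondA1 G) {u : ℝ → ℝ}
    (hmax : IsMaxOn (energy univ G) unitSetInfty u) : energyNeg univ G u ≠ ∞ := by
  have h0 : (fun _ : ℝ => (0 : ℝ)) ∈ unitSetInfty := by
    rw [mem_unitSetInfty_iff]
    refine ⟨memHHalf_zero, ?_⟩
    rw [halfForm_eq_zero_of_ae 1 univ (EventuallyEq.refl _ _)]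
    exact zero_le_one
  have h1 : energy univ G (fun _ => 0) ≤ energy univ G u := hmax h0
  have h2 : energy univ G (fun _ => 0) = 0 := by
    simp [energy, energyPos, energyNeg, hA.map_zero]
  intro htop
  rw [h2, energy, htop, EReal.coe_ennreal_top, EReal.sub_top] at h1
  simp at h1

/-! ### The Euler–Lagrange equations -/

theorem MemHHalfZero.isTest {a b : ℝ} {φ : ℝ → ℝ} (hφ : MemHHalfZero (Ioo a b) φ) :
    IsTest (Ioo a b) φ := by
  refine ⟨hφ.1, ⟨max |a| |b|, ?_⟩, hφ.2⟩
  filter_upwards [hφ.2] with x hx hx'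
  exact hx fun h => absurd (abs_le_max_abs_abs h.1.le h.2.le) (not_le.2 hx')

theorem exists_weakSolution {G : ℝ → ℝ} {c α : ℝ} (hG : GrowthBound G c α) {a b : ℝ} {D : Set ℝ}
    {u : ℝ → ℝ} (hu : u ∈ unitSet (Ioo a b) D)
    (hmax : IsMaxOn (energy (Ioo a b) G) (unitSet (Ioo a b) D) u) :
    ∃ θ : ℝ, 0 < θ ∧ WeakSolution (Ioo a b) D G θ u := by
  obtain ⟨hu0, hu1⟩ := mem_unitSet_iff.1 hu
  have hf := hG.condA.logAdmissible_Ioo hu0.1 a b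
  have hcm := isConstrainedMax_halfForm (G := G) (le_refl (0 : ℝ)) hu0.1 hu0.2 hf hu1
    fun φ hφ hle => hmax (mem_unitSet_iff.2 ⟨⟨hu0.1.add hφ.memHHalf, by
      filter_upwards [hu0.2, hφ.vanish] with x h1 h2 h3
      rw [h1 h3, h2 h3, add_zero]⟩, hle⟩)
  have hpot : PotentialDefined (Ioo a b) G u := ae_of_all _ fun x => hf.potential_integrable x
  obtain ⟨θ, hθ, heq⟩ : ∃ θ : ℝ, 0 < θ ∧ ∀ φ, IsTest (Ioo a b) φ →
      halfForm 0 D u φ = θ * energyDeriv (Ioo a b) G u φ := by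
    by_cases hq : ∃ φ, IsTest (Ioo a b) φ ∧ halfForm 0 D u φ ≠ 0
    · obtain ⟨φ₀, hφ₀, hq⟩ := hq
      exact hcm.exists_multiplier hG isOpen_Ioo hφ₀ hq
        fun h0 => hq (halfForm_eq_zero_of_ae 0 D h0 φ₀)
    -- If `q` vanishes identically, then `q₀ = q u = 0` because `u` is itself a test function. The
    -- constraint has slack, `L` vanishes on all test functions, and any positive multiplier works.
    · push Not at hq
      have hq0 : halfForm 0 D u u < 1 := by
        rw [hq u hu0.isTest]; exact zero_lt_one
      refine ⟨1, one_pos, fun φ hφ => ?_⟩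
      have h1 := hcm.energyDeriv_nonpos hG hφ (Or.inr hq0)
      have h2 := hcm.energyDeriv_nonpos hG (hφ.comb hφ (-1) 0) (Or.inr hq0)
      rw [energyDeriv_comb hG hu0.1 hf hφ hφ] at h2
      rw [hq φ hφ]
      linarith
  refine ⟨θ, hθ, hpot, fun φ hφ => ⟨integrable_potential_deriv hG hu0.1 hf hφ.isTest, ?_⟩⟩
  rw [← energyDeriv_eq_integral hG hu0.1 hf hφ.isTest, ← heq φ hφ.isTest, halfForm]
  ring

theorem exists_weakSolutionInfty {G : ℝ → ℝ} {c α : ℝ} (hG : GrowthBound G c α) (hA : CondA1 G)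
    {u : ℝ → ℝ} (hu : u ∈ unitSetInfty) (hmax : IsMaxOn (energy univ G) unitSetInfty u) :
    ∃ θ : ℝ, WeakSolutionInfty G θ u := by
  obtain ⟨hu0, hu1⟩ := mem_unitSetInfty_iff.1 hu
  have hf := hA.logAdmissible_univ hu0 (hA.energyNeg_ne_top hmax)
  have hcm := isConstrainedMax_halfForm (G := G) zero_le_one hu0
    (ae_of_all _ fun x hx => absurd (mem_univ x) hx) hf hu1
    fun φ hφ hle => hmax (mem_unitSetInfty_iff.2 ⟨hu0.add hφ.memHHalf, hle⟩)
  have hpot : PotentialDefined univ G u := ae_of_all _ fun x => hf.potential_integrable x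
  obtain ⟨θ, heq⟩ : ∃ θ : ℝ, ∀ φ, IsTest univ φ →
      halfForm 1 univ u φ = θ * energyDeriv univ G u φ := by
    by_cases hq : ∃ φ, IsTest univ φ ∧ halfForm 1 univ u φ ≠ 0
    · obtain ⟨φ₀, hφ₀, hq⟩ := hq
      obtain ⟨θ, -, heq⟩ := hcm.exists_multiplier hG isOpen_univ hφ₀ hq
        fun h0 => hq (halfForm_eq_zero_of_ae 1 univ h0 φ₀)
      exact ⟨θ, heq⟩
    -- Here `u` need not have bounded support, so it is not available as a test function; the
    -- multiplier 0 settles this case.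
    · push Not at hq
      exact ⟨0, fun φ hφ => by rw [hq φ hφ, zero_mul]⟩
  refine ⟨θ, hpot, fun φ hφ hb => ?_⟩
  have ht : IsTest univ φ := ⟨hφ, hb, ae_of_all _ fun x hx => absurd (mem_univ x) hx⟩
  refine ⟨integrableOn_univ.1 (integrable_potential_deriv hG hu0 hf ht), ?_⟩
  have h1 := heq φ ht
  rw [energyDeriv_eq_integral hG hu0 hf ht, halfForm, one_mul, Measure.restrict_univ] at h1
  have h2 : Integrable fun x => u x * φ x := hu0.1.integrable_mul hφ.1
  rw [integral_add (integrable_quarterLaplacian_mul u φ) h2, h1]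

end

end LogTM

theorem proposition1p5 (G : ℝ → ℝ) (hG : ContDiff ℝ 1 G) (hA : LogTM.CondA G)
    (hg : ∃ c > 0, ∃ α > 0, ∀ t : ℝ, deriv G t ≤ c * Real.exp (α * t ^ 2)) :
    (∀ a b : ℝ, a < b → ∀ D : Set ℝ, (D = Set.Ioo a b ∨ D = Set.univ) →
      ∀ u ∈ LogTM.unitSet (Set.Ioo a b) D,
        IsMaxOn (LogTM.energy (Set.Ioo a b) G) (LogTM.unitSet (Set.Ioo a b) D) u →
        ∃ θ : ℝ, 0 < θ ∧ LogTM.WeakSolution (Set.Ioo a b) D G θ u) ∧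
    (LogTM.CondA1 G →
      ∀ u ∈ LogTM.unitSetInfty,
        IsMaxOn (LogTM.energy Set.univ G) LogTM.unitSetInfty u →
        ∃ θ : ℝ, LogTM.WeakSolutionInfty G θ u) := by
  obtain ⟨c, hc, α, hα, hle⟩ := hg
  have hGB := LogTM.growthBound_of_deriv_le hG hA hc hα hle
  exact ⟨fun a b _ D _ u hu hmax => LogTM.exists_weakSolution hGB hu hmax,
    fun hA1 u hu hmax => LogTM.exists_weakSolutionInfty hGB hA1 hu hmax⟩
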